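/- Let $\psi_i=\psi_i^c+\psi_i^b:\mathbb R\to\mathbb R$ $(i\in\mathbb Z)$ be single-site potentials and $M=(M_{ij})_{i,j\in\mathbb Z}$ a real matrix such that, for some constants $\delta,\alpha>0$ and $B,K\ge 0$ and for all $i,j\in\mathbb Z$ and $z\in\mathbb R$: (a) $\psi_i^c$ is twice differentiable with $(\psi_i^c)''(z)\ge 0$, and $\psi_i^b$ is differentiable with $|\psi_i^b(z)|+|(\psi_i^b)'(z)|\le B$; (b) $M_{ij}=M_{ji}$; (c) $\sum_{l\in\mathbb Z,\,l\ne i}|M_{il}|+\delta\le M_{ii}$; (d) $|M_{ij}|\le \dfrac{K}{|i-j|^{2+\alpha}+1}$. For a finite set $\Lambda\subset\mathbb Z$ and $q\in\mathbb R^\Lambda$ put $\psi_{k,q}(p)=\psi_k(q_k+p)+\psi_k(q_k-p)$ for $k\in\Lambda$, $p\in\mathbb R$, and let $\mu_{\Lambda,q,|M|}$ be the ferromagnetic measure on $\mathbb R^\Lambda$ given by $$\mu_{\Lambda,q,|M|}(dp)=\frac1Z\exp\Big(-\sum_{k\in\Lambda}\psi_{k,q}(p_k)-\sum_{k\in\Lambda}M_{kk}p_k^2+\sum_{k,l\in\Lambda,\,k\ne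 l}|M_{kl}|\,p_kp_l\Big)\,dp ,$$ where $Z$ is the normalization constant. Then $\mu_{\Lambda,q,|M|}$ is a well-defined probability measure with finite second moments, and there are constants $\hat\alpha>0$ and $C\ge 0$, depending only on $\delta,B,K,\alpha$, such that for all such potentials and matrices, all finite $\Lambda\subset\mathbb Z$, all $q\in\mathbb R^\Lambda$ and all $i,j\in\Lambda$, $$\operatorname{cov}_{\mu_{\Lambda,q,|M|}}(p_i,p_j)\le\frac{C}{|i-j|^{2+\hat\alpha}+1}.$$ -/

import Mathlib

open MeasureTheory ProbabilityTheory

noncomputable section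

namespace SpinSystem

/-- The single-site potentials `ψ i = ψc i + ψb i` on the lattice `ℤ` are perturbed convex:
`ψc i` is twice differentiable with `(ψc i)'' ≥ 0`, and `ψb i` is differentiable with
`|ψb i| + |(ψb i)'| ≤ B`, where `B` does not depend on the site. -/
structure PerturbedConvex (ψc ψb : ℤ → ℝ → ℝ) (B : ℝ) : Prop where
  differentiable_convex : ∀ i, Differentiable ℝ (ψc i)
  differentiable_deriv_convex : ∀ i, Differentiable ℝ (deriv (ψc i))
  convex : ∀ i z, 0 ≤ deriv (deriv (ψc i)) z
  differentiable_bounded : ∀ i, Differentiable ℝ (ψb i)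
  bounded : ∀ i z, |ψb i z| + |deriv (ψb i) z| ≤ B

/-- The assumptions on the interaction matrix: symmetry, strict diagonal dominance with
gap `δ`, and algebraic decay of order `2 + α` with constant `K`. -/
structure AdmissibleInteraction (M : ℤ → ℤ → ℝ) (δ K α : ℝ) : Prop where
  symm : ∀ i j, M i j = M j i
  summable : ∀ i, Summable fun j : {j : ℤ // j ≠ i} => |M i j|
  diagonally_dominant : ∀ i, (∑' j : {j : ℤ // j ≠ i}, |M i j|) + δ ≤ M i i
  decay : ∀ i j, |M i j| ≤ K / (|(i : ℝ) - (j : ℝ)| ^ (2 + α) + 1)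

/-- The symmetrization `p ↦ ψ (q + p) + ψ (q - p)` of a single-site potential. -/
def symmetrized (ψ : ℝ → ℝ) (q p : ℝ) : ℝ := ψ (q + p) + ψ (q - p)

/-- The single-site potential `ψ_{k,q} = ψ_{k,q}^c + ψ_{k,q}^b`, evaluated at `p`. -/
def singleSite (ψc ψb : ℤ → ℝ → ℝ) (k : ℤ) (q p : ℝ) : ℝ :=
  symmetrized (ψc k) q p + symmetrized (ψb k) q p

/-- The ferromagnetic (attractive) Hamiltonian
`∑ₖ ψ_{k,q}(pₖ) + ∑ₖ Mₖₖ pₖ² - ∑_{k ≠ l} |Mₖₗ| pₖ pₗ` on `ℝ^Λ`; the last sum is over ordered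
pairs. -/
def ferroHamiltonian (ψc ψb : ℤ → ℝ → ℝ) (M : ℤ → ℤ → ℝ) (Λ : Finset ℤ)
    (q p : Λ → ℝ) : ℝ :=
  (∑ k : Λ, singleSite ψc ψb k (q k) (p k)) + (∑ k : Λ, M k k * p k ^ 2)
    - ∑ k : Λ, ∑ l : Λ with l ≠ k, |M k l| * p k * p l

/-- The ferromagnetic measure `μ_{Λ,q,|M|}` on `ℝ^Λ`: Lebesgue measure weighted by
`exp (-H) / ∫ exp (-H)`, with `H` the ferromagnetic Hamiltonian. -/
def ferroMeasure (ψc ψb : ℤ → ℝ → ℝ) (M : ℤ → ℤ → ℝ) (Λ : Finset ℤ)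
    (q : Λ → ℝ) : Measure (Λ → ℝ) :=
  (volume : Measure (Λ → ℝ)).tilted fun p => -ferroHamiltonian ψc ψb M Λ q p

end SpinSystem

end

/-!
The covariances of the ferromagnetic measure are compared with those of a Gaussian mixture, for
which their decay can be read off from a percolation model.

*Reduction to a mixture of Gaussians.* The measure has the density
`exp (∑ Jₖₗ pₖ pₗ) ∏ wₖ(pₖ)` (`spinDensity`) with couplings `Jₖₗ = |Mₖₗ| ≥ 0` and even weights
`wₖ(x) = exp (-ψ_{k,q}(x) - Mₖₖ x ^ 2)`, so its means vanish and its covariances are the pair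
correlations. By Ginibre's duplication of variables, the correlation given one spin is
nondecreasing in the absolute value of that spin (`partIntegral_mul_le`), as is the conditional
partition function (`partIntegral_one_mono`). Hence correlations increase when the weight of a site
is replaced by one that favours large `|x|` (`SpinDominated`, `correlation_le`). Since the convex
part of a symmetrized potential is nondecreasing in `|x|` and its bounded part is Lipschitz, `wₖ`
is dominated by `exp (-Mₖₖ x ^ 2 + 2 B |x|)`, and that weight is dominated by
`exp (-Mₖₖ x ^ 2) cosh (b x)` with `b = 2 B + 4 K + 1` (`spinDominated_cosh`). All the dependence
on the potentials has now disappeared.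

*Gaussian mixture and Ising model.* The last weight is a symmetric mixture of two shifted Gaussian
weights. Conditionally on the signs of the shifts the measure is Gaussian, with covariance matrix
half the inverse `S` of the diagonally dominant matrix with diagonal `Mₖₖ` and off-diagonal
entries `-Jₖₗ`. The signs themselves have an Ising distribution with couplings `b ^ 2 Sₖₗ / 4`. The
inverse `S` decays like the matrix itself, by a contraction argument (`exists_inverse_decay`), so
it remains to bound the correlations of an Ising model whose couplings are bounded by a constant
times `|k - l| ^ (-s)` with `s = 2 + α > 2` (`exists_coshWeight_decay`).

*Ising model and percolation.* By the Griffiths inequalities the Ising correlations are at most the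
connection probabilities of an independent bond percolation that opens an edge of coupling `c` with
probability `1 - exp (-2 c)` (`ising_le_pairConn`). As `s > 2`, the expected number of open
edges across any point of the line is bounded, and with positive probability no edge at all
crosses. A path over a long distance must therefore be unlikely, which gives smallness of the
connection probabilities at long distances; the inequality of Simon and Lieb
(`pairConn_le_sum`) turns this into decay of the order `s` of the couplings
(`decay_of_contraction`, `exists_pairConn_decay`).
-/

open MeasureTheory ProbabilityTheory

namespace SpinSystem

/-! ### Sign configurations and the first Griffiths inequality -/

/-- A sign `u = ±1` as a real number. -/
def spin (u : ℤˣ) : ℝ := ((u : ℤ) : ℝ)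

@[simp] lemma spin_one : spin 1 = 1 := by simp [spin]
@[simp] lemma spin_neg (u : ℤˣ) : spin (-u) = -spin u := by simp [spin]
lemma spin_mul (u v : ℤˣ) : spin (u * v) = spin u * spin v := by simp [spin]
lemma spin_eq_or (u : ℤˣ) : spin u = 1 ∨ spin u = -1 := by
  rcases Int.units_eq_one_or u with rfl | rfl <;> simp
@[simp] lemma spin_mul_self (u : ℤˣ) : spin u * spin u = 1 := by
  rcases spin_eq_or u with h | h <;> simp [h]

lemma exists_spin_mul_abs (x : ℝ) : ∃ u : ℤˣ, x = spin u * |x| := by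
  rcases le_total 0 x with h | h
  · exact ⟨1, by simp [abs_of_nonneg h]⟩
  · exact ⟨-1, by simp [abs_of_nonpos h]⟩

lemma sum_units (f : ℤˣ → ℝ) : ∑ u, f u = f 1 + f (-1) := by
  have : (Finset.univ : Finset ℤˣ) = {1, -1} := by decide
  rw [this, Finset.sum_pair (by decide)]

/-- The functions of a sign configuration that are polynomials in the signs with nonnegative
coefficients. -/
def signCone (κ : Type*) : Subsemiring ((κ → ℤˣ) → ℝ) :=
  Subsemiring.closure ({f | ∃ c : ℝ, 0 ≤ c ∧ f = fun _ => c} ∪ {f | ∃ i, f = fun σ => spin (σ i)})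

section cone
variable {κ : Type*}

lemma const_mem_signCone {c : ℝ} (hc : 0 ≤ c) : (fun _ => c) ∈ signCone κ :=
  Subsemiring.subset_closure (Or.inl ⟨c, hc, rfl⟩)

lemma spin_mem_signCone (i : κ) : (fun σ : κ → ℤˣ => spin (σ i)) ∈ signCone κ :=
  Subsemiring.subset_closure (Or.inr ⟨i, rfl⟩)

lemma mul_mem_signCone {f g : (κ → ℤˣ) → ℝ} (hf : f ∈ signCone κ) (hg : g ∈ signCone κ) :
    (fun σ => f σ * g σ) ∈ signCone κ := mul_mem hf hg

lemma add_mem_signCone {f g : (κ → ℤˣ) → ℝ} (hf : f ∈ signCone κ) (hg : g ∈ signCone κ) :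
    (fun σ => f σ + g σ) ∈ signCone κ := add_mem hf hg

lemma const_mul_mem_signCone {c : ℝ} (hc : 0 ≤ c) {f : (κ → ℤˣ) → ℝ} (hf : f ∈ signCone κ) :
    (fun σ => c * f σ) ∈ signCone κ := mul_mem_signCone (const_mem_signCone hc) hf

lemma prod_mem_signCone {ι : Type*} (s : Finset ι) {f : ι → (κ → ℤˣ) → ℝ}
    (hf : ∀ i ∈ s, f i ∈ signCone κ) : (fun σ => ∏ i ∈ s, f i σ) ∈ signCone κ := by
  have := prod_mem hf
  convert this using 1
  ext σ; simp

/-- The exponential of a nonnegative multiple of a `±1`-valued function `f` is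
`cosh c + f sinh c`. -/
lemma exp_mem_signCone {c : ℝ} (hc : 0 ≤ c) {f : (κ → ℤˣ) → ℝ} (hf : f ∈ signCone κ)
    (h1 : ∀ σ, f σ = 1 ∨ f σ = -1) : (fun σ => Real.exp (c * f σ)) ∈ signCone κ := by
  have : (fun σ => Real.exp (c * f σ)) = fun σ => Real.cosh c + Real.sinh c * f σ := by
    ext σ
    rcases h1 σ with h | h
    · rw [h, mul_one, mul_one, Real.cosh_add_sinh]
    · rw [h, mul_neg, mul_neg, mul_one, mul_one, ← sub_eq_add_neg, Real.cosh_sub_sinh]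
  rw [this]
  exact add_mem_signCone (const_mem_signCone (Real.cosh_pos c).le)
    (const_mul_mem_signCone (Real.sinh_nonneg_iff.2 hc) hf)

lemma sum_spin_pow_nonneg (n : ℕ) : 0 ≤ ∑ u : ℤˣ, spin u ^ n := by
  rw [sum_units]
  rcases neg_one_pow_eq_or ℝ n with h | h <;> simp [h]

/-- The first Griffiths inequality: every function in the cone has a nonnegative sum. -/
lemma sum_nonneg_of_mem_signCone [Fintype κ] [DecidableEq κ] {f : (κ → ℤˣ) → ℝ}
    (hf : f ∈ signCone κ) : 0 ≤ ∑ σ, f σ := by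
  rw [signCone, Subsemiring.mem_closure_iff] at hf
  induction hf using AddSubmonoid.closure_induction with
  | mem x hx =>
    have : ∃ c : ℝ, 0 ≤ c ∧ ∃ n : κ → ℕ, x = fun σ => c * ∏ i, spin (σ i) ^ n i := by
      induction hx using Submonoid.closure_induction with
      | mem x hx =>
        rcases hx with ⟨c, hc, rfl⟩ | ⟨i, rfl⟩
        · exact ⟨c, hc, 0, by simp⟩
        · refine ⟨1, zero_le_one, Pi.single i 1, ?_⟩
          ext σ
          rw [Finset.prod_eq_single i] <;> simp +contextual
      | one => exact ⟨1, zero_le_one, 0, by ext; simp⟩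
      | mul x y _ _ hx hy =>
        obtain ⟨c, hc, n, rfl⟩ := hx
        obtain ⟨d, hd, m, rfl⟩ := hy
        refine ⟨c * d, mul_nonneg hc hd, n + m, ?_⟩
        ext σ
        simp only [Pi.mul_apply, Pi.add_apply, pow_add, Finset.prod_mul_distrib]
        ring
    obtain ⟨c, hc, n, rfl⟩ := this
    rw [← Finset.mul_sum]
    refine mul_nonneg hc ?_
    have h := Finset.prod_univ_sum (fun _ : κ => (Finset.univ : Finset ℤˣ))
      (fun i u => spin u ^ n i)
    rw [Fintype.piFinset_univ] at h
    rw [← h]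
    exact Finset.prod_nonneg fun i _ => sum_spin_pow_nonneg _
  | zero => simp
  | add x y _ _ hx hy => simpa [Finset.sum_add_distrib] using add_nonneg hx hy

end cone

/-! ### Independent Bernoulli variables on a finite set -/

section bernoulli
variable {E : Type*} [DecidableEq E]

/-- The expectation of `f ω`, where `ω ⊆ S` is the random set that contains each `e ∈ S`
independently with probability `p e`. -/
noncomputable def bernSum (S : Finset E) (p : E → ℝ) (f : Finset E → ℝ) : ℝ :=
  ∑ T ∈ S.powerset, ((∏ e ∈ T, p e) * ∏ e ∈ S \ T, (1 - p e)) * f T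

lemma bernSum_empty (p : E → ℝ) (f : Finset E → ℝ) : bernSum ∅ p f = f ∅ := by
  simp [bernSum]

lemma bernSum_insert {S : Finset E} {a : E} (ha : a ∉ S) (p : E → ℝ) (f : Finset E → ℝ) :
    bernSum (insert a S) p f
      = (1 - p a) * bernSum S p f + p a * bernSum S p (fun T => f (insert a T)) := by
  unfold bernSum
  rw [Finset.sum_powerset_insert ha, Finset.mul_sum, Finset.mul_sum]
  congr 1
  · refine Finset.sum_congr rfl fun T hT => ?_
    have haT : a ∉ T := fun h => ha (Finset.mem_powerset.1 hT h)
    rw [Finset.insert_sdiff_of_notMem _ haT, Finset.prod_insert (by simp [ha])]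
    ring
  · refine Finset.sum_congr rfl fun T hT => ?_
    have haT : a ∉ T := fun h => ha (Finset.mem_powerset.1 hT h)
    rw [Finset.prod_insert haT, Finset.insert_sdiff_insert, Finset.sdiff_insert_of_notMem ha]
    ring

lemma bernSum_mono {S : Finset E} {p : E → ℝ} (h0 : ∀ e, 0 ≤ p e) (h1 : ∀ e, p e ≤ 1)
    {f g : Finset E → ℝ} (hfg : ∀ T, f T ≤ g T) : bernSum S p f ≤ bernSum S p g :=
  Finset.sum_le_sum fun T _ => mul_le_mul_of_nonneg_left (hfg T)
    (mul_nonneg (Finset.prod_nonneg fun e _ => h0 e)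
      (Finset.prod_nonneg fun e _ => sub_nonneg.2 (h1 e)))

lemma bernSum_const (S : Finset E) (p : E → ℝ) (c : ℝ) : bernSum S p (fun _ => c) = c := by
  induction S using Finset.induction_on with
  | empty => rw [bernSum_empty]
  | insert a S ha ih => rw [bernSum_insert ha, ih]; ring

lemma bernSum_nonneg {S : Finset E} {p : E → ℝ} (h0 : ∀ e, 0 ≤ p e) (h1 : ∀ e, p e ≤ 1)
    {f : Finset E → ℝ} (hf : ∀ T, 0 ≤ f T) : 0 ≤ bernSum S p f := by
  rw [← bernSum_const S p 0]; exact bernSum_mono h0 h1 hf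

lemma bernSum_add (S : Finset E) (p : E → ℝ) (f g : Finset E → ℝ) :
    bernSum S p (fun T => f T + g T) = bernSum S p f + bernSum S p g := by
  simp only [bernSum, mul_add, Finset.sum_add_distrib]

lemma bernSum_mul_left (S : Finset E) (p : E → ℝ) (c : ℝ) (f : Finset E → ℝ) :
    bernSum S p (fun T => c * f T) = c * bernSum S p f := by
  simp only [bernSum, Finset.mul_sum]
  exact Finset.sum_congr rfl fun T _ => by ring

lemma bernSum_sum {ι : Type*} (A : Finset ι) (S : Finset E) (p : E → ℝ)
    (f : ι → Finset E → ℝ) :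
    bernSum S p (fun T => ∑ i ∈ A, f i T) = ∑ i ∈ A, bernSum S p (f i) := by
  simp only [bernSum, Finset.mul_sum]
  rw [Finset.sum_comm]

lemma bernSum_union {S T : Finset E} (hST : Disjoint S T) (p : E → ℝ) (f : Finset E → ℝ) :
    bernSum (S ∪ T) p f = bernSum S p (fun A => bernSum T p (fun B => f (A ∪ B))) := by
  induction S using Finset.induction_on generalizing f with
  | empty => simp [bernSum_empty]
  | insert a S ha ih =>
    rw [Finset.disjoint_insert_left] at hST
    rw [Finset.insert_union, bernSum_insert (by simp [ha, hST.1]), bernSum_insert ha, ih hST.2,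
      ih hST.2]
    simp only [Finset.insert_union]

variable [Fintype E]

/-- The expectation of `f ω` under independent Bernoulli percolation on all of `E`. -/
noncomputable def percExp (p : E → ℝ) (f : Finset E → ℝ) : ℝ := bernSum Finset.univ p f

/-- A function of `ω` that is determined by `ω ∩ S`. -/
def DeterminedBy (S : Finset E) (f : Finset E → ℝ) : Prop := ∀ ω, f ω = f (ω ∩ S)

omit [Fintype E] in
lemma DeterminedBy.mono {S T : Finset E} (hST : S ⊆ T) {f : Finset E → ℝ}
    (hf : DeterminedBy S f) : DeterminedBy T f := fun ω => by
  rw [hf ω, hf (ω ∩ T), Finset.inter_assoc, Finset.inter_eq_right.2 hST]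

omit [Fintype E] in
lemma DeterminedBy.mul {S : Finset E} {f g : Finset E → ℝ}
    (hf : DeterminedBy S f) (hg : DeterminedBy S g) : DeterminedBy S (fun ω => f ω * g ω) :=
  fun ω => by simp only []; rw [hf ω, hg ω]

lemma percExp_eq_bernSum (S : Finset E) (p : E → ℝ) {f : Finset E → ℝ} (hf : DeterminedBy S f) :
    percExp p f = bernSum S p f := by
  rw [percExp, ← Finset.union_compl S, bernSum_union disjoint_compl_right]
  unfold bernSum
  refine Finset.sum_congr rfl fun A hA => ?_
  congr 1
  have h : ∀ B ∈ Sᶜ.powerset, f (A ∪ B) = f A := by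
    intro B hB
    rw [hf (A ∪ B), hf A, Finset.union_inter_distrib_right,
      Finset.disjoint_iff_inter_eq_empty.1
        (Finset.disjoint_of_subset_left (Finset.mem_powerset.1 hB) disjoint_compl_left),
      Finset.union_empty]
  refine Eq.trans (Finset.sum_congr rfl fun B hB => ?_) (bernSum_const Sᶜ p (f A))
  simp only [h B hB]

/-- Functions determined by disjoint sets of coordinates are independent. -/
lemma percExp_mul {S T : Finset E} (hST : Disjoint S T) (p : E → ℝ) {f g : Finset E → ℝ}
    (hf : DeterminedBy S f) (hg : DeterminedBy T g) :
    percExp p (fun ω => f ω * g ω) = percExp p f * percExp p g := by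
  have hfg : DeterminedBy (S ∪ T) (fun ω => f ω * g ω) :=
    (hf.mono Finset.subset_union_left).mul (hg.mono Finset.subset_union_right)
  rw [percExp_eq_bernSum _ p hfg, percExp_eq_bernSum _ p hf, percExp_eq_bernSum _ p hg,
    bernSum_union hST]
  have h : ∀ A ∈ S.powerset, bernSum T p (fun B => f (A ∪ B) * g (A ∪ B))
      = bernSum T p g * f A := by
    intro A hA
    rw [mul_comm, ← bernSum_mul_left]
    refine Finset.sum_congr rfl fun B hB => ?_
    have hAB := Finset.disjoint_of_subset_left (Finset.mem_powerset.1 hA)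
      (Finset.disjoint_of_subset_right (Finset.mem_powerset.1 hB) hST)
    simp only []
    rw [hf (A ∪ B), hg (A ∪ B), Finset.union_inter_distrib_right,
      Finset.union_inter_distrib_right, hf A, hg B,
      Finset.disjoint_iff_inter_eq_empty.1
        (Finset.disjoint_of_subset_left (Finset.mem_powerset.1 hB) hST.symm),
      Finset.disjoint_iff_inter_eq_empty.1
        (Finset.disjoint_of_subset_left (Finset.mem_powerset.1 hA) hST),
      Finset.union_empty, Finset.empty_union]
  have h2 : bernSum S p (fun A => bernSum T p (fun B => f (A ∪ B) * g (A ∪ B)))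
      = bernSum S p (fun A => bernSum T p g * f A) :=
    Finset.sum_congr rfl fun A hA => by simp only []; rw [h A hA]
  rw [h2, bernSum_mul_left, mul_comm]

lemma percExp_mem (p : E → ℝ) (e : E) :
    percExp p (fun ω => if e ∈ ω then 1 else 0) = p e := by
  rw [percExp_eq_bernSum {e} p (fun ω => by simp), ← insert_empty_eq,
    bernSum_insert (Finset.notMem_empty e), bernSum_empty, bernSum_empty]
  simp

lemma percExp_disjoint (p : E → ℝ) (S : Finset E) :
    percExp p (fun ω => if Disjoint ω S then 1 else 0) = ∏ e ∈ S, (1 - p e) := by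
  rw [percExp_eq_bernSum S p (fun ω => by simp [Finset.disjoint_iff_inter_eq_empty])]
  unfold bernSum
  rw [Finset.sum_eq_single ∅]
  · simp
  · intro T hT hne
    simp only []
    rw [if_neg, mul_zero]
    intro hd
    exact hne (Finset.disjoint_self_iff_empty T |>.1
      (Finset.disjoint_of_subset_right (Finset.mem_powerset.1 hT) hd))
  · simp

/-- A function on `[0,1]^E` that lies below its chords in every coordinate direction is bounded
by the expectation of its values at the random vertices of the cube. -/
lemma le_percExp_of_le_chord (g : (E → ℝ) → ℝ)
    (hg : ∀ p : E → ℝ, (∀ e, 0 ≤ p e) → (∀ e, p e ≤ 1) → ∀ e,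
      g p ≤ (1 - p e) * g (Function.update p e 0) + p e * g (Function.update p e 1))
    (p : E → ℝ) (h0 : ∀ e, 0 ≤ p e) (h1 : ∀ e, p e ≤ 1) :
    g p ≤ percExp p (fun ω => g (fun e => if e ∈ ω then 1 else 0)) := by
  have key : ∀ S : Finset E, g p ≤ bernSum S p (fun ω => g (fun e =>
      if e ∈ S then (if e ∈ ω then 1 else 0) else p e)) := by
    intro S
    induction S using Finset.induction_on with
    | empty => simp [bernSum_empty]
    | insert a S ha ih =>
      refine ih.trans ?_
      rw [bernSum_insert ha, ← bernSum_mul_left, ← bernSum_mul_left, ← bernSum_add]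
      unfold bernSum
      refine Finset.sum_le_sum fun T hT => ?_
      refine mul_le_mul_of_nonneg_left ?_ (mul_nonneg (Finset.prod_nonneg fun e _ => h0 e)
        (Finset.prod_nonneg fun e _ => sub_nonneg.2 (h1 e)))
      have haT : a ∉ T := fun h => ha (Finset.mem_powerset.1 hT h)
      refine (hg _ ?_ ?_ a).trans_eq ?_
      · intro e; split_ifs <;> simp [h0]
      · intro e; split_ifs <;> simp [h1]
      · simp only [ha, if_false]
        congr 3
        · ext e
          by_cases he : e = a
          · subst he; simp [haT]
          · simp [he]
        · ext e
          by_cases he : e = a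
          · subst he; simp
          · simp [he]
  simpa [percExp] using key Finset.univ

end bernoulli

/-! ### Ising correlations are bounded by percolation probabilities -/

section ising
variable {V E : Type*} (s t : E → V)

/-- The product of the two signs at the ends of the edge `e`. -/
def edgeSpin (e : E) (σ : V → ℤˣ) : ℝ := spin (σ (s e)) * spin (σ (t e))

/-- `k` and `l` are the ends of an edge of `ω`. -/
def OpenAdj (ω : Finset E) (k l : V) : Prop := ∃ e ∈ ω, (s e = k ∧ t e = l) ∨ (s e = l ∧ t e = k)

/-- `k` and `l` are joined by a path of edges of `ω`. -/
def OpenConn (ω : Finset E) : V → V → Prop := Relation.ReflTransGen (OpenAdj s t ω)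

lemma edgeSpin_eq_or (e : E) (σ : V → ℤˣ) : edgeSpin s t e σ = 1 ∨ edgeSpin s t e σ = -1 := by
  unfold edgeSpin
  rcases spin_eq_or (σ (s e)) with h | h <;> rcases spin_eq_or (σ (t e)) with h' | h' <;>
    simp [h, h']

lemma edgeSpin_mul (e : E) (σ τ : V → ℤˣ) :
    edgeSpin s t e (σ * τ) = edgeSpin s t e σ * edgeSpin s t e τ := by
  simp only [edgeSpin, Pi.mul_apply, spin_mul]; ring

lemma edgeSpin_mem_signCone (e : E) : edgeSpin s t e ∈ signCone V :=
  mul_mem_signCone (spin_mem_signCone _) (spin_mem_signCone _)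

variable [Fintype E]

/-- The weight of a sign configuration in the Ising model in which, along every edge, the two
signs are forced to agree with probability `p e`. The coupling constant `J` of the Gibbs weight
`exp (J σ σ')` corresponds to `p = 1 - exp (-2 J)`. -/
noncomputable def isingWeight (p : E → ℝ) (σ : V → ℤˣ) : ℝ :=
  ∏ e, (1 - p e + p e * ((1 + edgeSpin s t e σ) / 2))

/-- The unnormalized expectation of `f` in the Ising model. -/
noncomputable def isingSum [Fintype V] [DecidableEq V] (p : E → ℝ) (f : (V → ℤˣ) → ℝ) : ℝ :=
  ∑ σ, f σ * isingWeight s t p σ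

lemma isingWeight_nonneg {p : E → ℝ} (h0 : ∀ e, 0 ≤ p e) (h1 : ∀ e, p e ≤ 1) (σ : V → ℤˣ) :
    0 ≤ isingWeight s t p σ := by
  refine Finset.prod_nonneg fun e _ => ?_
  have := h0 e
  have := h1 e
  rcases edgeSpin_eq_or s t e σ with h | h <;> rw [h] <;> linarith

variable [Fintype V] [DecidableEq V]

lemma isingSum_one_pos {p : E → ℝ} (h0 : ∀ e, 0 ≤ p e) (h1 : ∀ e, p e ≤ 1) :
    0 < isingSum s t p (fun _ => 1) := by
  have h : (1 : ℝ) * isingWeight s t p 1 ≤ isingSum s t p (fun _ => 1) :=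
    Finset.single_le_sum (f := fun σ => (1 : ℝ) * isingWeight s t p σ)
      (fun σ _ => by rw [one_mul]; exact isingWeight_nonneg s t h0 h1 σ) (Finset.mem_univ 1)
  have h2 : isingWeight s t p 1 = 1 := by simp [isingWeight, edgeSpin]
  rw [h2] at h
  linarith

/-- The second Griffiths inequality, for a polynomial in the signs with nonnegative coefficients and
the pair observable of an edge. -/
lemma isingSum_mul_le {p : E → ℝ} (h0 : ∀ e, 0 ≤ p e) (h1 : ∀ e, p e ≤ 1) (a : E)
    {f : (V → ℤˣ) → ℝ} (hf : f ∈ signCone V) :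
    isingSum s t p f * isingSum s t p (edgeSpin s t a)
      ≤ isingSum s t p (fun σ => f σ * edgeSpin s t a σ) * isingSum s t p (fun _ => 1) := by
  -- in a pair of configurations `(σ, σ')` the second one is written as `σ' = σ * τ`
  have key : isingSum s t p (fun σ => f σ * edgeSpin s t a σ) * isingSum s t p (fun _ => 1)
      - isingSum s t p f * isingSum s t p (edgeSpin s t a)
      = ∑ τ, ∑ σ, f σ * edgeSpin s t a σ * (1 - edgeSpin s t a τ)
          * (isingWeight s t p σ * isingWeight s t p (σ * τ)) := by
    unfold isingSum
    rw [Finset.sum_mul_sum, Finset.sum_mul_sum, ← Finset.sum_sub_distrib, Finset.sum_comm]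
    conv_rhs => rw [Finset.sum_comm]
    rw [Finset.sum_comm]
    refine Finset.sum_congr rfl fun σ _ => ?_
    rw [← Finset.sum_sub_distrib, ← Equiv.sum_comp (Equiv.mulLeft σ)]
    refine Finset.sum_congr rfl fun τ _ => ?_
    simp only [Equiv.coe_mulLeft, edgeSpin_mul]
    ring
  rw [← sub_nonneg, key]
  refine Finset.sum_nonneg fun τ _ => sum_nonneg_of_mem_signCone ?_
  have hτ : ∀ e, -1 ≤ edgeSpin s t e τ ∧ edgeSpin s t e τ ≤ 1 := fun e => by
    rcases edgeSpin_eq_or s t e τ with h | h <;> rw [h] <;> norm_num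
  have hW : (fun σ => isingWeight s t p σ * isingWeight s t p (σ * τ)) ∈ signCone V := by
    simp only [isingWeight, ← Finset.prod_mul_distrib]
    refine prod_mem_signCone _ fun e _ => ?_
    have : (fun σ => (1 - p e + p e * ((1 + edgeSpin s t e σ) / 2)) *
        (1 - p e + p e * ((1 + edgeSpin s t e (σ * τ)) / 2)))
        = fun σ => ((1 - p e / 2) ^ 2 + (p e / 2) ^ 2 * edgeSpin s t e τ)
          + ((1 - p e / 2) * (p e / 2) * (1 + edgeSpin s t e τ)) * edgeSpin s t e σ := by
      ext σ
      rw [edgeSpin_mul]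
      have hx : edgeSpin s t e σ ^ 2 = 1 := by
        rcases edgeSpin_eq_or s t e σ with h | h <;> rw [h] <;> norm_num
      linear_combination (p e ^ 2 / 4 * edgeSpin s t e τ) * hx
    rw [this]
    have := h0 e
    have := h1 e
    have := (hτ e).1
    refine add_mem_signCone (const_mem_signCone ?_)
      (const_mul_mem_signCone ?_ (edgeSpin_mem_signCone s t e))
    · nlinarith [sq_nonneg (p e / 2)]
    · have : 0 ≤ 1 - p e / 2 := by linarith
      have : 0 ≤ 1 + edgeSpin s t e τ := by linarith
      positivity
  refine mul_mem_signCone ?_ hW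
  have hc : 0 ≤ 1 - edgeSpin s t a τ := by linarith [(hτ a).2]
  exact mul_mem_signCone (mul_mem_signCone hf (edgeSpin_mem_signCone s t a))
    (const_mem_signCone hc)

variable [DecidableEq E]

omit [Fintype V] [DecidableEq V] in
lemma isingWeight_update (p : E → ℝ) (a : E) (x : ℝ) (σ : V → ℤˣ) :
    isingWeight s t (Function.update p a x) σ = (1 - x + x * ((1 + edgeSpin s t a σ) / 2))
      * ∏ e ∈ Finset.univ.erase a, (1 - p e + p e * ((1 + edgeSpin s t e σ) / 2)) := by
  rw [isingWeight, ← Finset.mul_prod_erase _ _ (Finset.mem_univ a), Function.update_self]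
  congr 1
  refine Finset.prod_congr rfl fun e he => ?_
  rw [Function.update_of_ne (Finset.ne_of_mem_erase he)]

/-- The expectation of `f` in the Ising model. -/
noncomputable def isingMean (p : E → ℝ) (f : (V → ℤˣ) → ℝ) : ℝ :=
  isingSum s t p f / isingSum s t p (fun _ => 1)

/-- As a function of the probability `p a` that the signs at the ends of `a` are forced to agree,
an Ising correlation is below its chord: the weight of the second alternative only decreases
through normalization, and that alternative has the larger correlation. -/
lemma isingMean_le_chord {f : (V → ℤˣ) → ℝ} (hf : f ∈ signCone V) (p : E → ℝ)
    (h0 : ∀ e, 0 ≤ p e) (h1 : ∀ e, p e ≤ 1) (a : E) :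
    isingMean s t p f ≤ (1 - p a) * isingMean s t (Function.update p a 0) f
      + p a * isingMean s t (Function.update p a 1) f := by
  have hu : ∀ x : ℝ, 0 ≤ x → x ≤ 1 → (∀ e, 0 ≤ Function.update p a x e) ∧
      (∀ e, Function.update p a x e ≤ 1) := by
    intro x hx0 hx1
    constructor <;> intro e <;> by_cases he : e = a
    · subst he; simpa
    · simpa [he] using h0 e
    · subst he; simpa
    · simpa [he] using h1 e
  obtain ⟨h00, h01⟩ := hu 0 le_rfl zero_le_one
  obtain ⟨h10, h11⟩ := hu 1 zero_le_one le_rfl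
  have hW : ∀ σ, isingWeight s t p σ = (1 - p a) * isingWeight s t (Function.update p a 0) σ
      + p a * isingWeight s t (Function.update p a 1) σ := by
    intro σ
    conv_lhs => rw [← Function.update_eq_self a p]
    rw [isingWeight_update, isingWeight_update, isingWeight_update]
    ring
  have hW1 : ∀ σ, isingWeight s t (Function.update p a 1) σ
      = (1 + edgeSpin s t a σ) / 2 * isingWeight s t (Function.update p a 0) σ := by
    intro σ
    rw [isingWeight_update, isingWeight_update]
    ring
  have hS : ∀ g, isingSum s t p g = (1 - p a) * isingSum s t (Function.update p a 0) g
      + p a * isingSum s t (Function.update p a 1) g := by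
    intro g
    simp only [isingSum, Finset.mul_sum, ← Finset.sum_add_distrib]
    exact Finset.sum_congr rfl fun σ _ => by rw [hW]; ring
  have hS1 : ∀ g, 2 * isingSum s t (Function.update p a 1) g
      = isingSum s t (Function.update p a 0) g
        + isingSum s t (Function.update p a 0) (fun σ => g σ * edgeSpin s t a σ) := by
    intro g
    simp only [isingSum, Finset.mul_sum, ← Finset.sum_add_distrib]
    exact Finset.sum_congr rfl fun σ _ => by rw [hW1]; ring
  have gks := isingSum_mul_le s t h00 h01 a hf
  have e1 := hS1 f
  have e2 := hS1 (fun _ => 1)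
  simp only [one_mul] at e2
  have z0 := isingSum_one_pos s t h00 h01
  have z1 := isingSum_one_pos s t h10 h11
  have z := isingSum_one_pos s t h0 h1
  have hZ : isingSum s t (Function.update p a 1) (fun _ => 1)
      ≤ isingSum s t (Function.update p a 0) (fun _ => 1) := by
    refine Finset.sum_le_sum fun σ _ => ?_
    rw [hW1]
    have := isingWeight_nonneg s t h00 h01 σ
    rcases edgeSpin_eq_or s t a σ with h | h <;> rw [h] <;> linarith
  unfold isingMean
  rw [hS f, hS (fun _ => 1)] at *
  set N0 := isingSum s t (Function.update p a 0) f
  set N1 := isingSum s t (Function.update p a 1) f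
  set Z0 := isingSum s t (Function.update p a 0) (fun _ => 1)
  set Z1 := isingSum s t (Function.update p a 1) (fun _ => 1)
  set Nε := isingSum s t (Function.update p a 0) (fun σ => f σ * edgeSpin s t a σ)
  set Zε := isingSum s t (Function.update p a 0) (edgeSpin s t a)
  have hn : N0 / Z0 ≤ N1 / Z1 := by
    rw [div_le_div_iff₀ z0 z1]
    have a1 : N0 * Z1 = (N0 * Z0 + N0 * Zε) / 2 := by linear_combination (N0 / 2) * e2
    have a2 : N1 * Z0 = (N0 * Z0 + Nε * Z0) / 2 := by linear_combination (Z0 / 2) * e1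
    linarith
  rw [div_le_iff₀ z]
  have x0 : N0 = N0 / Z0 * Z0 := by field_simp
  have x1 : N1 = N1 / Z1 * Z1 := by field_simp
  set n0 := N0 / Z0
  set n1 := N1 / Z1
  rw [x0, x1]
  have hq : 0 ≤ p a * (1 - p a) * ((n1 - n0) * (Z0 - Z1)) :=
    mul_nonneg (mul_nonneg (h0 a) (sub_nonneg.2 (h1 a)))
      (mul_nonneg (sub_nonneg.2 hn) (sub_nonneg.2 hZ))
  nlinarith

/-- If every edge is either removed or contracted, then signs in different clusters are
uncorrelated. -/
lemma isingMean_pair_le_conn (ω : Finset E) (i j : V) [Decidable (OpenConn s t ω i j)] :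
    isingMean s t (fun e => if e ∈ ω then 1 else 0) (fun σ => spin (σ i) * spin (σ j))
      ≤ if OpenConn s t ω i j then 1 else 0 := by
  have h0 : ∀ e, (0 : ℝ) ≤ if e ∈ ω then 1 else 0 := fun e => by split_ifs <;> simp
  have h1 : ∀ e, (if e ∈ ω then (1 : ℝ) else 0) ≤ 1 := fun e => by split_ifs <;> simp
  have z := isingSum_one_pos s t h0 h1
  split_ifs with hc
  · rw [isingMean, div_le_one z]
    refine Finset.sum_le_sum fun σ _ => ?_
    refine mul_le_mul_of_nonneg_right ?_ (isingWeight_nonneg s t h0 h1 σ)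
    rcases spin_eq_or (σ i) with h | h <;> rcases spin_eq_or (σ j) with h' | h' <;> simp [h, h']
  · -- flip all signs in the cluster of `i`
    classical
    let τ : V → ℤˣ := fun k => if OpenConn s t ω i k then -1 else 1
    have hW : ∀ σ, isingWeight s t (fun e => if e ∈ ω then 1 else 0) (σ * τ)
        = isingWeight s t (fun e => if e ∈ ω then 1 else 0) σ := by
      intro σ
      refine Finset.prod_congr rfl fun e _ => ?_
      by_cases he : e ∈ ω
      · have : OpenConn s t ω i (s e) ↔ OpenConn s t ω i (t e) :=
          ⟨fun h => h.tail ⟨e, he, Or.inl ⟨rfl, rfl⟩⟩, fun h => h.tail ⟨e, he, Or.inr ⟨rfl, rfl⟩⟩⟩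
        have hτ : edgeSpin s t e τ = 1 := by
          simp only [edgeSpin, τ, this, spin_mul_self]
        rw [edgeSpin_mul, hτ, mul_one]
      · simp [he]
    have hN : isingSum s t (fun e => if e ∈ ω then 1 else 0) (fun σ => spin (σ i) * spin (σ j))
        = - isingSum s t (fun e => if e ∈ ω then 1 else 0) (fun σ => spin (σ i) * spin (σ j)) := by
      conv_lhs => rw [isingSum, ← Equiv.sum_comp (Equiv.mulRight τ)]
      rw [isingSum, ← Finset.sum_neg_distrib]
      refine Finset.sum_congr rfl fun σ _ => ?_
      have hi : τ i = -1 := if_pos Relation.ReflTransGen.refl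
      have hj : τ j = 1 := if_neg hc
      rw [Equiv.coe_mulRight, hW]
      simp [hi, hj]
    have : isingSum s t (fun e => if e ∈ ω then (1 : ℝ) else 0)
        (fun σ => spin (σ i) * spin (σ j)) = 0 := by linarith
    rw [isingMean, this, zero_div]

open scoped Classical in
/-- The probability that `i` and `j` are connected in independent bond percolation. -/
noncomputable def connProb (p : E → ℝ) (i j : V) : ℝ :=
  percExp p (fun ω => if OpenConn s t ω i j then 1 else 0)

/-- An Ising correlation lies below its chords in every edge probability, so it is bounded by the
average of its values over random configurations of removed and contracted edges. -/
theorem isingMean_pair_le_connProb (p : E → ℝ) (h0 : ∀ e, 0 ≤ p e) (h1 : ∀ e, p e ≤ 1) (i j : V) :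
    isingMean s t p (fun σ => spin (σ i) * spin (σ j)) ≤ connProb s t p i j := by
  classical
  refine (le_percExp_of_le_chord
    (fun p => isingMean s t p (fun σ => spin (σ i) * spin (σ j))) ?_ p h0 h1).trans ?_
  · intro p h0 h1 e
    exact isingMean_le_chord s t
      (mul_mem_signCone (spin_mem_signCone i) (spin_mem_signCone j)) p h0 h1 e
  · refine bernSum_mono h0 h1 fun ω => ?_
    convert isingMean_pair_le_conn s t ω i j

end ising

/-! ### A Simon–Lieb inequality for percolation -/

section simonLieb
open scoped Classical
variable {V E : Type*} (s t : E → V)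

lemma openAdj_comm (ω : Finset E) (k l : V) : OpenAdj s t ω k l ↔ OpenAdj s t ω l k := by
  simp only [OpenAdj, or_comm]

lemma openConn_comm (ω : Finset E) (k l : V) : OpenConn s t ω k l ↔ OpenConn s t ω l k := by
  have : Std.Symm (OpenAdj s t ω) := ⟨fun a b h => (openAdj_comm s t ω a b).1 h⟩
  have h2 : Std.Symm (Relation.ReflTransGen (OpenAdj s t ω)) := Relation.ReflTransGen.stdSymm
  exact ⟨h2.symm k l, h2.symm l k⟩

section
variable [Fintype E] [DecidableEq E]

lemma connProb_nonneg {p : E → ℝ} (h0 : ∀ e, 0 ≤ p e) (h1 : ∀ e, p e ≤ 1) (i j : V) :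
    0 ≤ connProb s t p i j :=
  bernSum_nonneg h0 h1 fun ω => by split_ifs <;> simp

lemma connProb_le_one {p : E → ℝ} (h0 : ∀ e, 0 ≤ p e) (h1 : ∀ e, p e ≤ 1) (i j : V) :
    connProb s t p i j ≤ 1 := by
  rw [← bernSum_const (Finset.univ : Finset E) p 1]
  exact bernSum_mono h0 h1 fun ω => by split_ifs <;> simp

lemma connProb_comm (p : E → ℝ) (i j : V) : connProb s t p i j = connProb s t p j i := by
  simp only [connProb, openConn_comm s t _ i j]

end

lemma OpenConn.mono {ω ω' : Finset E} (h : ω ⊆ ω') {k l : V} (hc : OpenConn s t ω k l) :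
    OpenConn s t ω' k l :=
  Relation.ReflTransGen.mono (r := OpenAdj s t ω) (p := OpenAdj s t ω')
    (fun _ _ ⟨e, he, h'⟩ => ⟨e, h he, h'⟩) _ _ hc

variable [Fintype V] [Fintype E] [DecidableEq V] [DecidableEq E]

/-- The edges with both ends in `B`. -/
noncomputable def edgesIn (B : Finset V) : Finset E := {e | s e ∈ B ∧ t e ∈ B}

/-- The edges with both ends outside `C`. -/
noncomputable def edgesAvoiding (C : Finset V) : Finset E := {e | s e ∉ C ∧ t e ∉ C}

/-- The edges with both ends in `B` and an end in `C`. -/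
noncomputable def edgesTouching (B C : Finset V) : Finset E :=
  {e | (s e ∈ B ∧ t e ∈ B) ∧ (s e ∈ C ∨ t e ∈ C)}

/-- The cluster of `i` in the open subgraph induced on `B`. -/
noncomputable def cluster (B : Finset V) (i : V) (ω : Finset E) : Finset V :=
  {k | OpenConn s t (ω ∩ edgesIn s t B) i k}

lemma mem_cluster {B : Finset V} {i k : V} {ω : Finset E} :
    k ∈ cluster s t B i ω ↔ OpenConn s t (ω ∩ edgesIn s t B) i k := by
  simp [cluster]

lemma self_mem_cluster (B : Finset V) (i : V) (ω : Finset E) : i ∈ cluster s t B i ω :=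
  (mem_cluster s t).2 Relation.ReflTransGen.refl

lemma cluster_subset {B : Finset V} {i : V} (hi : i ∈ B) (ω : Finset E) :
    cluster s t B i ω ⊆ B := by
  intro k hk
  rw [mem_cluster] at hk
  induction hk with
  | refl => exact hi
  | tail _ h _ =>
    obtain ⟨e, he, h⟩ := h
    simp only [edgesIn, Finset.mem_inter, Finset.mem_filter, Finset.mem_univ, true_and] at he
    rcases h with ⟨_, rfl⟩ | ⟨rfl, _⟩
    · exact he.2.2
    · exact he.2.1

/-- Exploring the cluster of `i` in `B` only reveals the edges that touch it. -/
lemma cluster_eq_of_inter_eq {B C : Finset V} {i : V} {ω ω' : Finset E}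
    (h : ω ∩ edgesTouching s t B C = ω' ∩ edgesTouching s t B C)
    (hC : cluster s t B i ω = C) : cluster s t B i ω' = C := by
  have htr : ∀ {ω₁ ω₂ : Finset E}, ω₁ ∩ edgesTouching s t B C = ω₂ ∩ edgesTouching s t B C →
      ∀ {k l}, k ∈ C → OpenAdj s t (ω₁ ∩ edgesIn s t B) k l →
        OpenAdj s t (ω₂ ∩ edgesIn s t B) k l := by
    rintro ω₁ ω₂ h12 k l hk ⟨e, he, hkl⟩
    refine ⟨e, ?_, hkl⟩
    rw [Finset.mem_inter] at he ⊢
    refine ⟨?_, he.2⟩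
    have : e ∈ ω₁ ∩ edgesTouching s t B C := by
      refine Finset.mem_inter.2 ⟨he.1, ?_⟩
      have h2 := he.2
      simp only [edgesIn, edgesTouching, Finset.mem_filter, Finset.mem_univ, true_and] at h2 ⊢
      refine ⟨h2, ?_⟩
      rcases hkl with ⟨rfl, _⟩ | ⟨_, rfl⟩
      · exact Or.inl hk
      · exact Or.inr hk
    rw [h12] at this
    exact (Finset.mem_inter.1 this).1
  ext k
  constructor
  · intro hk
    rw [mem_cluster] at hk
    induction hk with
    | refl => rw [← hC]; exact self_mem_cluster s t B i ω
    | tail _ hxy ih =>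
      have := htr h.symm ih hxy
      rw [← hC, mem_cluster] at ih ⊢
      exact ih.tail this
  · intro hk
    have hk' := hk
    rw [← hC, mem_cluster] at hk'
    rw [mem_cluster]
    clear hk
    induction hk' with
    | refl => exact Relation.ReflTransGen.refl
    | tail hix hxy ih => exact ih.tail (htr h (by rw [← hC, mem_cluster]; exact hix) hxy)

/-- A path from `i ∈ B` to `j ∉ B` leaves the cluster of `i` in `B` for the last time through an
edge from this cluster to the outside of `B`. -/
lemma exists_exit {B : Finset V} {i j : V} (hi : i ∈ B) (hj : j ∉ B) {ω : Finset E}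
    (h : OpenConn s t ω i j) :
    ∃ k ∈ cluster s t B i ω, ∃ l ∉ B, OpenAdj s t ω k l ∧
      OpenConn s t (ω ∩ edgesAvoiding s t (cluster s t B i ω)) l j := by
  set C := cluster s t B i ω with hC
  have hjC : j ∉ C := fun h => hj (cluster_subset s t hi ω h)
  have stay : ∀ y, OpenConn s t (ω ∩ edgesAvoiding s t C) y j → y ∉ C := by
    intro y hy hyC
    rcases Relation.ReflTransGen.cases_head hy with rfl | ⟨z, ⟨e, he, hyz⟩, _⟩
    · exact hjC hyC
    · simp only [edgesAvoiding, Finset.mem_inter, Finset.mem_filter, Finset.mem_univ,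
        true_and] at he
      rcases hyz with ⟨rfl, _⟩ | ⟨_, rfl⟩
      · exact he.2.1 hyC
      · exact he.2.2 hyC
  have key : ∀ x, OpenConn s t ω x j → OpenConn s t (ω ∩ edgesAvoiding s t C) x j ∨
      ∃ k ∈ C, ∃ l ∉ C, OpenAdj s t ω k l ∧ OpenConn s t (ω ∩ edgesAvoiding s t C) l j := by
    intro x hx
    induction hx using Relation.ReflTransGen.head_induction_on with
    | refl => exact Or.inl Relation.ReflTransGen.refl
    | @head x y hxy _ ih =>
      rcases ih with ih | ih
      · have hy := stay y ih
        by_cases hxC : x ∈ C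
        · exact Or.inr ⟨x, hxC, y, hy, hxy, ih⟩
        · left
          refine Relation.ReflTransGen.head ?_ ih
          obtain ⟨e, he, hxy⟩ := hxy
          refine ⟨e, ?_, hxy⟩
          simp only [edgesAvoiding, Finset.mem_inter, Finset.mem_filter, Finset.mem_univ,
            true_and]
          rcases hxy with ⟨rfl, rfl⟩ | ⟨rfl, rfl⟩
          · exact ⟨he, hxC, hy⟩
          · exact ⟨he, hy, hxC⟩
      · exact Or.inr ih
  rcases key i h with h' | ⟨k, hk, l, hl, hkl, hlj⟩
  · exact absurd (self_mem_cluster s t B i ω) (stay i h')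
  · refine ⟨k, hk, l, fun hlB => hl ?_, hkl, hlj⟩
    have hkB := cluster_subset s t hi ω hk
    rw [hC, mem_cluster] at hk ⊢
    refine hk.tail ?_
    obtain ⟨e, he, hkl⟩ := hkl
    refine ⟨e, ?_, hkl⟩
    simp only [edgesIn, Finset.mem_inter, Finset.mem_filter, Finset.mem_univ, true_and]
    rcases hkl with ⟨rfl, rfl⟩ | ⟨rfl, rfl⟩
    · exact ⟨he, hkB, hlB⟩
    · exact ⟨he, hlB, hkB⟩

end simonLieb

section simonLiebPairs
open scoped Classical
variable {V : Type*} [Fintype V] [DecidableEq V]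

/-- The indicator of the event that the pair `e` is open. -/
noncomputable def openInd {E : Type*} [DecidableEq E] (e : E) (ω : Finset E) : ℝ := if e ∈ ω then 1 else 0

lemma determinedBy_openInd {E : Type*} [DecidableEq E] (e : E) : DeterminedBy {e} (openInd e) :=
  fun ω => by simp [openInd]

/-- Connection probabilities when the edges are the ordered pairs of vertices. -/
noncomputable def pairConn (p : V × V → ℝ) (i j : V) : ℝ := connProb Prod.fst Prod.snd p i j

/-- The Simon–Lieb inequality: a connection from `i ∈ B` to `j ∉ B` uses an edge from the
cluster of `i` in `B` to a site `l ∉ B`, and a connection from `l` to `j` off this cluster. -/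
theorem pairConn_le_sum {p : V × V → ℝ} (h0 : ∀ e, 0 ≤ p e) (h1 : ∀ e, p e ≤ 1)
    {B : Finset V} {i j : V} (hi : i ∈ B) (hj : j ∉ B) :
    pairConn p i j ≤ ∑ k ∈ B, ∑ l ∈ Bᶜ, pairConn p i k * (p (k, l) + p (l, k)) * pairConn p l j := by
  set F : V × V → V := Prod.fst
  set S : V × V → V := Prod.snd
  -- `f1 C` indicates that `C` is the cluster of `i` in `B`, and `f3 C l` that `l` is connected to
  -- `j` off `C`
  let f1 : Finset V → Finset (V × V) → ℝ := fun C ω => if cluster F S B i ω = C then 1 else 0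
  let f3 : Finset V → V → Finset (V × V) → ℝ := fun C l ω =>
    if OpenConn F S (ω ∩ edgesAvoiding F S C) l j then 1 else 0
  have f1n : ∀ C ω, 0 ≤ f1 C ω := fun C ω => by simp only [f1]; split_ifs <;> simp
  have f3n : ∀ C l ω, 0 ≤ f3 C l ω := fun C l ω => by simp only [f3]; split_ifs <;> simp
  have f2n : ∀ e ω, 0 ≤ openInd (E := V × V) e ω := fun e ω => by
    simp only [openInd]; split_ifs <;> simp
  let term : V → V → Finset V → Finset (V × V) → ℝ := fun k l C ω =>
    (if k ∈ C then 1 else 0) * (f1 C ω * (openInd (k, l) ω * f3 C l ω)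
      + f1 C ω * (openInd (l, k) ω * f3 C l ω))
  have tn : ∀ k l C ω, 0 ≤ term k l C ω := fun k l C ω => by
    have := f1n C ω
    have := f2n (k, l) ω
    have := f2n (l, k) ω
    have := f3n C l ω
    simp only [term]
    refine mul_nonneg (by split_ifs <;> simp) (by positivity)
  -- union bound over the last edge `(k, l)` leaving the cluster and over the cluster itself
  have step1 : pairConn p i j ≤ percExp p (fun ω => ∑ k ∈ B, ∑ l ∈ Bᶜ, ∑ C, term k l C ω) := by
    refine bernSum_mono h0 h1 fun ω => ?_
    split_ifs with hc
    · obtain ⟨k, hk, l, hl, hkl, hlj⟩ := exists_exit F S hi hj hc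
      have hkB := cluster_subset F S hi ω hk
      have h1 : 1 ≤ term k l (cluster F S B i ω) ω := by
        have hopen : 1 ≤ openInd (k, l) ω + openInd (l, k) ω := by
          obtain ⟨⟨x, y⟩, he, hkl⟩ := hkl
          rcases hkl with ⟨rfl, rfl⟩ | ⟨rfl, rfl⟩
          · have := f2n (S (x, y), F (x, y)) ω
            have h : openInd (F (x, y), S (x, y)) ω = 1 := if_pos he
            linarith
          · have := f2n (S (x, y), F (x, y)) ω
            have h : openInd (F (x, y), S (x, y)) ω = 1 := if_pos he
            linarith
        have e3 : f3 (cluster F S B i ω) l ω = 1 := by simp only [f3]; exact if_pos hlj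
        have e1 : f1 (cluster F S B i ω) ω = 1 := if_pos rfl
        simp only [term, e1, e3, if_pos hk]
        linarith
      calc (1 : ℝ) ≤ term k l (cluster F S B i ω) ω := h1
        _ ≤ ∑ C, term k l C ω :=
          Finset.single_le_sum (f := fun C => term k l C ω) (fun C _ => tn k l C ω)
            (Finset.mem_univ _)
        _ ≤ ∑ l ∈ Bᶜ, ∑ C, term k l C ω :=
          Finset.single_le_sum (f := fun l => ∑ C, term k l C ω)
            (fun l _ => Finset.sum_nonneg fun C _ => tn k l C ω) (Finset.mem_compl.2 hl)
        _ ≤ ∑ k ∈ B, ∑ l ∈ Bᶜ, ∑ C, term k l C ω :=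
          Finset.single_le_sum (f := fun k => ∑ l ∈ Bᶜ, ∑ C, term k l C ω)
            (fun k _ => Finset.sum_nonneg fun l _ => Finset.sum_nonneg fun C _ => tn k l C ω) hkB
    · exact Finset.sum_nonneg fun k _ => Finset.sum_nonneg fun l _ =>
        Finset.sum_nonneg fun C _ => tn k l C ω
  refine step1.trans ?_
  rw [percExp, bernSum_sum]
  refine Finset.sum_le_sum fun k hk => ?_
  rw [bernSum_sum]
  refine Finset.sum_le_sum fun l hl => ?_
  rw [bernSum_sum]
  rw [Finset.mem_compl] at hl
  have hP1 : ∀ C, 0 ≤ percExp p (f1 C) := fun C => bernSum_nonneg h0 h1 (f1n C)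
  -- the three events in a term are determined by disjoint sets of edges
  have hterm : ∀ C, bernSum Finset.univ p (term k l C)
      ≤ (if k ∈ C then 1 else 0) * percExp p (f1 C) * ((p (k, l) + p (l, k)) * pairConn p l j) := by
    intro C
    rw [bernSum_mul_left, bernSum_add]
    split_ifs with hkC
    swap
    · simp
    have d1 : DeterminedBy (edgesTouching F S B C) (f1 C) := by
      intro ω
      have : cluster F S B i ω = C ↔ cluster F S B i (ω ∩ edgesTouching F S B C) = C := by
        constructor <;> refine cluster_eq_of_inter_eq F S ?_ <;> simp [Finset.inter_assoc]
      simp only [f1, this]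
    have d3 : DeterminedBy (edgesAvoiding F S C) (f3 C l) := by
      intro ω
      simp only [f3, Finset.inter_assoc, Finset.inter_self]
    have h3 : percExp p (f3 C l) ≤ pairConn p l j := by
      refine bernSum_mono h0 h1 fun ω => ?_
      simp only [f3]
      split_ifs with ha hb
      · exact le_rfl
      · exact absurd (OpenConn.mono F S Finset.inter_subset_left ha) hb
      · exact zero_le_one
      · exact le_rfl
    have ind : ∀ e : V × V, (F e = k ∧ S e = l) ∨ (F e = l ∧ S e = k) →
        percExp p (fun ω => f1 C ω * (openInd e ω * f3 C l ω))
          ≤ percExp p (f1 C) * (p e * pairConn p l j) := by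
      intro e he
      have hd1 : Disjoint ({e} : Finset (V × V)) (edgesAvoiding F S C) := by
        rw [Finset.disjoint_singleton_left]
        simp only [edgesAvoiding, Finset.mem_filter, Finset.mem_univ, true_and]
        rcases he with ⟨h, _⟩ | ⟨_, h⟩ <;> simp [h, hkC]
      have hd2 : Disjoint (edgesTouching F S B C) ({e} ∪ edgesAvoiding F S C) := by
        rw [Finset.disjoint_union_right, Finset.disjoint_singleton_right]
        refine ⟨?_, ?_⟩
        · simp only [edgesTouching, Finset.mem_filter, Finset.mem_univ, true_and]
          rcases he with ⟨_, h⟩ | ⟨h, _⟩ <;> simp [h, hl]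
        · rw [Finset.disjoint_left]
          intro e' h1 h2
          simp only [edgesTouching, edgesAvoiding, Finset.mem_filter, Finset.mem_univ,
            true_and] at h1 h2
          exact h1.2.elim h2.1 h2.2
      rw [percExp_mul hd2 p d1 (((determinedBy_openInd e).mono Finset.subset_union_left).mul
        (d3.mono Finset.subset_union_right)), percExp_mul hd1 p (determinedBy_openInd e) d3]
      have : percExp p (openInd e) = p e := percExp_mem p e
      rw [this]
      exact mul_le_mul_of_nonneg_left (mul_le_mul_of_nonneg_left h3 (h0 e)) (hP1 C)
    have i1 := ind (k, l) (Or.inl ⟨rfl, rfl⟩)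
    have i2 := ind (l, k) (Or.inr ⟨rfl, rfl⟩)
    unfold percExp at i1 i2
    unfold percExp
    linarith
  calc ∑ C, bernSum Finset.univ p (term k l C)
      ≤ ∑ C, (if k ∈ C then 1 else 0) * percExp p (f1 C)
          * ((p (k, l) + p (l, k)) * pairConn p l j) := Finset.sum_le_sum fun C _ => hterm C
    _ = (∑ C, (if k ∈ C then 1 else 0) * percExp p (f1 C))
          * ((p (k, l) + p (l, k)) * pairConn p l j) := by rw [Finset.sum_mul]
    _ ≤ pairConn p i k * ((p (k, l) + p (l, k)) * pairConn p l j) := by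
      refine mul_le_mul_of_nonneg_right ?_ (mul_nonneg (add_nonneg (h0 _) (h0 _))
        (connProb_nonneg F S h0 h1 l j))
      -- summing over the clusters `C` that contain `k` gives back the event that `k` is connected
      -- to `i` in `B`
      have hsum : ∀ ω, ∑ C : Finset V, (if k ∈ C then 1 else 0) * f1 C ω
          = if k ∈ cluster F S B i ω then 1 else 0 := by
        intro ω
        rw [Finset.sum_eq_single (cluster F S B i ω)]
        · simp [f1]
        · intro C _ hne
          simp [f1, hne.symm]
        · simp
      have hE : ∑ C : Finset V, (if k ∈ C then 1 else 0) * percExp p (f1 C)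
          = percExp p (fun ω => ∑ C : Finset V, (if k ∈ C then 1 else 0) * f1 C ω) := by
        rw [percExp, bernSum_sum]
        exact Finset.sum_congr rfl fun C _ => (bernSum_mul_left _ _ _ _).symm
      rw [hE]
      refine bernSum_mono h0 h1 fun ω => ?_
      rw [hsum]
      split_ifs with ha hb
      · exact le_rfl
      · exact absurd (OpenConn.mono F S Finset.inter_subset_left ((mem_cluster F S).1 ha)) hb
      · exact zero_le_one
      · exact le_rfl
    _ = _ := by ring

end simonLiebPairs

/-! ### Algebraic decay from a contraction -/

/-- The inverse `|x - y| ^ s + 1` of the decay profile of order `s`. -/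
noncomputable def decayWeight (s : ℝ) (x y : ℤ) : ℝ := |(x : ℝ) - (y : ℝ)| ^ s + 1

lemma decayWeight_pos (s : ℝ) (x y : ℤ) : 0 < decayWeight s x y := by
  unfold decayWeight; positivity

lemma decayWeight_comm (s : ℝ) (x y : ℤ) : decayWeight s x y = decayWeight s y x := by
  unfold decayWeight; rw [abs_sub_comm]

lemma rpow_mul_decayWeight_le {s θ : ℝ} (hs : 0 ≤ s) (hθ : 0 ≤ θ) (hθ1 : θ ≤ 1) {x y x' y' : ℤ}
    (h : θ * |(x : ℝ) - y| ≤ |(x' : ℝ) - y'|) :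
    θ ^ s * decayWeight s x y ≤ decayWeight s x' y' := by
  unfold decayWeight
  have h1 : (θ * |(x : ℝ) - y|) ^ s ≤ |(x' : ℝ) - y'| ^ s :=
    Real.rpow_le_rpow (by positivity) h hs
  rw [Real.mul_rpow hθ (abs_nonneg _)] at h1
  have h2 : θ ^ s ≤ 1 := Real.rpow_le_one hθ hθ1 hs
  linarith

/-- The sum of the decay profile of order `s` over `ℤ`. -/
noncomputable def decaySum (s : ℝ) : ℝ := ∑' z : ℤ, 1 / decayWeight s z 0

lemma summable_decay {s : ℝ} (hs : 1 < s) : Summable fun z : ℤ => 1 / decayWeight s z 0 := by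
  refine Summable.of_norm_bounded_eventually (g := fun z : ℤ => |(z : ℝ)| ^ (-s))
    (Real.summable_abs_int_rpow hs) ?_
  rw [Filter.eventually_cofinite]
  refine (Set.finite_singleton (0 : ℤ)).subset fun z hz => ?_
  by_contra hz0
  apply hz
  have hpos : 0 < |(z : ℝ)| := by simpa using hz0
  rw [Real.norm_of_nonneg (one_div_nonneg.2 (decayWeight_pos s z 0).le), Real.rpow_neg
    (abs_nonneg _), ← one_div]
  refine one_div_le_one_div_of_le (by positivity) ?_
  simp [decayWeight]

lemma decaySum_nonneg (s : ℝ) : 0 ≤ decaySum s :=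
  tsum_nonneg fun z => one_div_nonneg.2 (decayWeight_pos s z 0).le

section
variable {V : Type*} [Fintype V] {pos : V → ℤ} (hpos : Function.Injective pos)
include hpos

lemma sum_decay_le {s : ℝ} (hs : 1 < s) (x : ℤ) :
    ∑ k, 1 / decayWeight s x (pos k) ≤ decaySum s := by
  classical
  have hinj : Function.Injective fun k => x - pos k := fun a b h => hpos (by simpa using h)
  have h : ∀ k, 1 / decayWeight s x (pos k) = 1 / decayWeight s (x - pos k) 0 := by
    intro k; simp [decayWeight]
  simp only [h]
  rw [← Finset.sum_image (f := fun z => 1 / decayWeight s z 0) (g := fun k => x - pos k)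
    (hinj.injOn)]
  exact (summable_decay hs).sum_le_tsum _
    fun z _ => one_div_nonneg.2 (decayWeight_pos s z 0).le

/-- Convolutions of decay profiles. -/
lemma sum_decay_mul_decay_le {s : ℝ} (hs : 1 < s) (x y : ℤ) :
    ∑ k, 1 / decayWeight s x (pos k) * (1 / decayWeight s (pos k) y)
      ≤ 2 * 2 ^ s * decaySum s / decayWeight s x y := by
  have hk : ∀ k, 1 / decayWeight s x (pos k) * (1 / decayWeight s (pos k) y)
      ≤ 2 ^ s / decayWeight s x y * (1 / decayWeight s x (pos k) + 1 / decayWeight s y (pos k)) := by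
    intro k
    have h2 : (0 : ℝ) < 2 ^ s := by positivity
    have hw := decayWeight_pos s x y
    have ha := decayWeight_pos s x (pos k)
    have hb := decayWeight_pos s (pos k) y
    have key : ∀ {a b : ℤ}, 1 / 2 * |(x : ℝ) - y| ≤ |(a : ℝ) - b| →
        1 / decayWeight s a b ≤ 2 ^ s / decayWeight s x y := by
      intro a b h
      have := rpow_mul_decayWeight_le (by linarith : 0 ≤ s) (by norm_num) (by norm_num) h
      rw [one_div, Real.inv_rpow (by norm_num)] at this
      rw [div_le_div_iff₀ (decayWeight_pos s a b) hw, one_mul]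
      calc decayWeight s x y = 2 ^ s * ((2 ^ s)⁻¹ * decayWeight s x y) := by field_simp
        _ ≤ 2 ^ s * decayWeight s a b := by gcongr
    rw [decayWeight_comm s y (pos k), mul_add]
    have tri : |(x : ℝ) - y| ≤ |(x : ℝ) - pos k| + |(pos k : ℝ) - y| := abs_sub_le _ _ _
    rcases le_total (|(x : ℝ) - pos k|) (|(pos k : ℝ) - y|) with h | h
    · have := key (a := pos k) (b := y) (by linarith)
      have h3 : 1 / decayWeight s x (pos k) * (1 / decayWeight s (pos k) y)
          ≤ 1 / decayWeight s x (pos k) * (2 ^ s / decayWeight s x y) := by gcongr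
      have h4 : 0 ≤ 2 ^ s / decayWeight s x y * (1 / decayWeight s (pos k) y) := by positivity
      linarith
    · have := key (a := x) (b := pos k) (by linarith)
      have h3 : 1 / decayWeight s x (pos k) * (1 / decayWeight s (pos k) y)
          ≤ 2 ^ s / decayWeight s x y * (1 / decayWeight s (pos k) y) := by gcongr
      have h4 : 0 ≤ 2 ^ s / decayWeight s x y * (1 / decayWeight s x (pos k)) := by positivity
      linarith
  refine (Finset.sum_le_sum fun k _ => hk k).trans ?_
  rw [← Finset.mul_sum, Finset.sum_add_distrib]
  have h1 := sum_decay_le hpos hs x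
  have h2 := sum_decay_le hpos hs y
  have hw := decayWeight_pos s x y
  calc 2 ^ s / decayWeight s x y * (∑ k, 1 / decayWeight s x (pos k)
        + ∑ k, 1 / decayWeight s y (pos k))
      ≤ 2 ^ s / decayWeight s x y * (decaySum s + decaySum s) := by gcongr
    _ = _ := by ring

end

/-- A symmetric matrix `G ≥ 0` with `G ≤ κ G + D`, where the rows of `κ ≥ 0` have sums at most
`η < 1` and the entries of `κ` and `D` decay with order `s > 1`, decays with order `s`. The rows of
`G` have bounded sums; in `∑ κ(i,l) G(l,j)` the terms with `l` about as far from `j` as `i` is are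
absorbed, and in the others `κ(i,l)` is of the order of the claim. -/
theorem decay_of_contraction {s η C₁ C₂ : ℝ} (hs : 1 < s) (hη : η < 1)
    (hC₁ : 0 ≤ C₁) (hC₂ : 0 ≤ C₂) :
    ∃ C : ℝ, 0 ≤ C ∧ ∀ {V : Type} [Fintype V] (pos : V → ℤ), Function.Injective pos →
      ∀ (G κ : V → V → ℝ), (∀ i j, 0 ≤ G i j) → (∀ i j, G i j = G j i) → (∀ i j, 0 ≤ κ i j) →
      (∀ i, ∑ l, κ i l ≤ η) → (∀ i j, κ i j ≤ C₁ / decayWeight s (pos i) (pos j)) →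
      (∀ i j, G i j ≤ ∑ l, κ i l * G l j + C₂ / decayWeight s (pos i) (pos j)) →
      ∀ i j, G i j ≤ C / decayWeight s (pos i) (pos j) := by
  have hs0 : 0 ≤ s := by linarith
  -- `θ` is close to `1`, so that `θ ^ (-s) * η` is still less than `1`
  obtain ⟨θ, hθ0, hθ1, hθ⟩ : ∃ θ : ℝ, 0 < θ ∧ θ < 1 ∧ η < θ ^ s := by
    have hcont : Filter.Tendsto (fun θ : ℝ => θ ^ s) (nhdsWithin 1 (Set.Iio 1)) (nhds ((1 : ℝ) ^ s)) :=
      ((Real.continuous_rpow_const hs0).tendsto 1).mono_left nhdsWithin_le_nhds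
    rw [Real.one_rpow] at hcont
    have h1 := hcont.eventually_const_lt hη
    have h2 : ∀ᶠ θ : ℝ in nhdsWithin 1 (Set.Iio 1), 0 < θ :=
      nhdsWithin_le_nhds (lt_mem_nhds zero_lt_one)
    obtain ⟨θ, ⟨ha, hb⟩, hc⟩ := ((h1.and h2).and self_mem_nhdsWithin).exists
    exact ⟨θ, hb, hc, ha⟩
  have hθs : 0 < θ ^ s := by positivity
  have h1θ : 0 < 1 - θ := by linarith
  have h1θs : 0 < (1 - θ) ^ s := by positivity
  set S := C₂ * decaySum s / (1 - η) with hS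
  have hS0 : 0 ≤ S := div_nonneg (mul_nonneg hC₂ (decaySum_nonneg s)) (by linarith)
  set C := (C₁ / (1 - θ) ^ s * S + C₂) / (1 - η / θ ^ s) with hC
  have hden : 0 < 1 - η / θ ^ s := by rw [sub_pos, div_lt_one hθs]; exact hθ
  have hC0 : 0 ≤ C := by positivity
  refine ⟨C, hC0, ?_⟩
  intro V _ pos hpos G κ hG hsymm hκ hrow hκd hle i j
  have hne : Nonempty V := ⟨i⟩
  -- the row sums
  have hrowG : ∀ i, ∑ j, G i j ≤ S := by
    obtain ⟨i₀, _, hi₀⟩ := Finset.exists_max_image Finset.univ (fun i => ∑ j, G i j)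
      Finset.univ_nonempty
    have h1 : ∑ j, G i₀ j ≤ η * ∑ j, G i₀ j + C₂ * decaySum s := by
      calc ∑ j, G i₀ j ≤ ∑ j, (∑ l, κ i₀ l * G l j + C₂ / decayWeight s (pos i₀) (pos j)) :=
            Finset.sum_le_sum fun j _ => hle i₀ j
        _ = ∑ l, κ i₀ l * ∑ j, G l j + C₂ * ∑ j, 1 / decayWeight s (pos i₀) (pos j) := by
            rw [Finset.sum_add_distrib, Finset.sum_comm, Finset.mul_sum]
            simp only [Finset.mul_sum, mul_one_div]
        _ ≤ ∑ l, κ i₀ l * ∑ j, G i₀ j + C₂ * decaySum s := by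
            refine add_le_add (Finset.sum_le_sum fun l _ => ?_) ?_
            · exact mul_le_mul_of_nonneg_left (hi₀ l (Finset.mem_univ l)) (hκ _ _)
            · exact mul_le_mul_of_nonneg_left (sum_decay_le hpos hs _) hC₂
        _ ≤ η * ∑ j, G i₀ j + C₂ * decaySum s := by
            rw [← Finset.sum_mul]
            gcongr
            · exact Finset.sum_nonneg fun j _ => hG _ _
            · exact hrow i₀
    intro i
    refine (hi₀ i (Finset.mem_univ i)).trans ?_
    rw [hS, le_div_iff₀ (by linarith)]
    linarith
  -- the largest value `W` of `G` relative to the claimed decay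
  obtain ⟨⟨i₀, j₀⟩, _, hmax⟩ := Finset.exists_max_image (Finset.univ : Finset (V × V))
    (fun e => G e.1 e.2 * decayWeight s (pos e.1) (pos e.2)) Finset.univ_nonempty
  set W := G i₀ j₀ * decayWeight s (pos i₀) (pos j₀) with hW
  have hmax' : ∀ a b, G a b * decayWeight s (pos a) (pos b) ≤ W :=
    fun a b => hmax (a, b) (Finset.mem_univ _)
  have hW0 : 0 ≤ W := mul_nonneg (hG _ _) (decayWeight_pos _ _ _).le
  have hWle : W ≤ η / θ ^ s * W + C₁ / (1 - θ) ^ s * S + C₂ := by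
    have hw := decayWeight_pos s (pos i₀) (pos j₀)
    have hterm : ∀ l, κ i₀ l * G l j₀ * decayWeight s (pos i₀) (pos j₀)
        ≤ κ i₀ l * (W / θ ^ s) + C₁ / (1 - θ) ^ s * G l j₀ := by
      intro l
      have tri : |(pos i₀ : ℝ) - pos j₀| ≤ |(pos i₀ : ℝ) - pos l| + |(pos l : ℝ) - pos j₀| :=
        abs_sub_le _ _ _
      rcases le_total (θ * |(pos i₀ : ℝ) - pos j₀|) |(pos l : ℝ) - pos j₀| with h | h
      · have h1 := rpow_mul_decayWeight_le hs0 hθ0.le hθ1.le h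
        have h2 : G l j₀ * decayWeight s (pos i₀) (pos j₀) ≤ W / θ ^ s := by
          rw [le_div_iff₀ hθs]
          calc _ = G l j₀ * (θ ^ s * decayWeight s (pos i₀) (pos j₀)) := by ring
            _ ≤ G l j₀ * decayWeight s (pos l) (pos j₀) :=
              mul_le_mul_of_nonneg_left h1 (hG _ _)
            _ ≤ W := hmax' _ _
        have h3 := mul_le_mul_of_nonneg_left h2 (hκ i₀ l)
        have h4 : 0 ≤ C₁ / (1 - θ) ^ s * G l j₀ := mul_nonneg (by positivity) (hG _ _)
        linarith
      · have h1 := rpow_mul_decayWeight_le (x := pos i₀) (y := pos j₀) (x' := pos i₀)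
          (y' := pos l) hs0 h1θ.le (by linarith) (by linarith)
        have h2 : κ i₀ l * decayWeight s (pos i₀) (pos j₀) ≤ C₁ / (1 - θ) ^ s := by
          rw [le_div_iff₀ h1θs]
          calc _ = κ i₀ l * ((1 - θ) ^ s * decayWeight s (pos i₀) (pos j₀)) := by ring
            _ ≤ κ i₀ l * decayWeight s (pos i₀) (pos l) :=
              mul_le_mul_of_nonneg_left h1 (hκ _ _)
            _ ≤ C₁ := (le_div_iff₀ (decayWeight_pos _ _ _)).1 (hκd _ _)
        have h3 := mul_le_mul_of_nonneg_right h2 (hG l j₀)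
        have h4 : 0 ≤ κ i₀ l * (W / θ ^ s) := mul_nonneg (hκ _ _) (by positivity)
        linarith
    calc W ≤ (∑ l, κ i₀ l * G l j₀ + C₂ / decayWeight s (pos i₀) (pos j₀))
          * decayWeight s (pos i₀) (pos j₀) := mul_le_mul_of_nonneg_right (hle _ _) hw.le
      _ = ∑ l, κ i₀ l * G l j₀ * decayWeight s (pos i₀) (pos j₀) + C₂ := by
          rw [add_mul, Finset.sum_mul, div_mul_cancel₀ _ hw.ne']
      _ ≤ ∑ l, (κ i₀ l * (W / θ ^ s) + C₁ / (1 - θ) ^ s * G l j₀) + C₂ := by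
          gcongr with l; exact hterm l
      _ = (∑ l, κ i₀ l) * (W / θ ^ s) + C₁ / (1 - θ) ^ s * (∑ l, G j₀ l) + C₂ := by
          rw [Finset.sum_add_distrib, Finset.sum_mul, Finset.mul_sum]
          simp only [hsymm j₀]
      _ ≤ η * (W / θ ^ s) + C₁ / (1 - θ) ^ s * S + C₂ := by
          gcongr
          · exact hrow i₀
          · exact hrowG j₀
      _ = _ := by ring
  have hWC : W ≤ C := by
    rw [hC, le_div_iff₀ hden]
    linarith
  rw [le_div_iff₀ (decayWeight_pos _ _ _)]
  exact (hmax' i j).trans hWC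

/-! ### Long-range percolation in one dimension -/

section
variable {E : Type*} [Fintype E] [DecidableEq E]

lemma percExp_prod {ι : Type*} [DecidableEq ι] (A : Finset ι) (S : ι → Finset E)
    (hS : ∀ a ∈ A, ∀ b ∈ A, a ≠ b → Disjoint (S a) (S b)) (p : E → ℝ)
    (f : ι → Finset E → ℝ) (hf : ∀ a, DeterminedBy (S a) (f a)) :
    percExp p (fun ω => ∏ a ∈ A, f a ω) = ∏ a ∈ A, percExp p (f a) := by
  have key : DeterminedBy (A.biUnion S) (fun ω => ∏ a ∈ A, f a ω) ∧
      percExp p (fun ω => ∏ a ∈ A, f a ω) = ∏ a ∈ A, percExp p (f a) := by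
    induction A using Finset.induction_on with
    | empty => exact ⟨fun ω => by simp, by simpa [percExp] using bernSum_const Finset.univ p 1⟩
    | insert a A ha ih =>
      obtain ⟨h1, h2⟩ := ih fun b hb c hc => hS b (Finset.mem_insert_of_mem hb) c
        (Finset.mem_insert_of_mem hc)
      simp only [Finset.prod_insert ha, Finset.biUnion_insert]
      refine ⟨((hf a).mono Finset.subset_union_left).mul (h1.mono Finset.subset_union_right), ?_⟩
      rw [percExp_mul ?_ p (hf a) h1, h2]
      rw [Finset.disjoint_biUnion_right]
      intro b hb
      exact hS a (Finset.mem_insert_self _ _) b (Finset.mem_insert_of_mem hb)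
        fun h => ha (h ▸ hb)
  exact key.2

end

/-- The sum of `g n` over `n ≥ N`. -/
noncomputable def tailSum (g : ℕ → ℝ) (N : ℕ) : ℝ := ∑' n, g (n + N)

lemma tailSum_nonneg {g : ℕ → ℝ} (hg : ∀ n, 0 ≤ g n) (N : ℕ) : 0 ≤ tailSum g N :=
  tsum_nonneg fun _ => hg _

lemma sum_le_tailSum {V : Type*} {g : ℕ → ℝ} (hg : ∀ n, 0 ≤ g n) (hgs : Summable g) (A : Finset V)
    (φ : V → ℕ) (hφ : Set.InjOn φ A) (N : ℕ) (hN : ∀ k ∈ A, N ≤ φ k) :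
    ∑ k ∈ A, g (φ k) ≤ tailSum g N := by
  classical
  have hinj : Set.InjOn (fun k => φ k - N) A := fun a ha b hb h => hφ ha hb (by
    have := hN a ha
    have := hN b hb
    simp only [] at h
    omega)
  have h : ∑ k ∈ A, g (φ k) = ∑ k ∈ A, g (φ k - N + N) :=
    Finset.sum_congr rfl fun k hk => by rw [Nat.sub_add_cancel (hN k hk)]
  rw [h, ← Finset.sum_image (f := fun n => g (n + N)) hinj]
  exact ((summable_nat_add_iff N).2 hgs).sum_le_tsum _ fun n _ => hg _

/-- The couplings `J` between the sites left and right of a cut `x` (between the sites `x` and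
`x + 1`) are bounded by a product of functions of the distances to the cut. -/
structure CutBound {V : Type*} (pos : V → ℤ) (J : V × V → ℝ) (A : ℝ) (g : ℕ → ℝ) : Prop where
  injective : Function.Injective pos
  nonneg : ∀ e, 0 ≤ J e
  le : ∀ x k l, pos k ≤ x → x < pos l →
    J (k, l) ≤ A * (g (x - pos k).toNat * g (pos l - x - 1).toNat)
  le' : ∀ x k l, pos k ≤ x → x < pos l →
    J (l, k) ≤ A * (g (x - pos k).toNat * g (pos l - x - 1).toNat)

/-- The probability that an edge with coupling `J` is open. -/
noncomputable def edgeProb {E : Type*} (J : E → ℝ) (e : E) : ℝ := 1 - Real.exp (-J e)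

section
variable {E : Type*} {J : E → ℝ} (hJ : ∀ e, 0 ≤ J e)
include hJ

lemma edgeProb_nonneg (e : E) : 0 ≤ edgeProb J e := by
  have : Real.exp (-J e) ≤ 1 := Real.exp_le_one_iff.2 (by linarith [hJ e])
  unfold edgeProb; linarith

omit hJ in
lemma edgeProb_le_one (e : E) : edgeProb J e ≤ 1 := by
  have := Real.exp_pos (-J e)
  unfold edgeProb; linarith

omit hJ in
lemma edgeProb_le (e : E) : edgeProb J e ≤ J e := by
  have := Real.add_one_le_exp (-J e)
  unfold edgeProb; linarith

end

section cuts
variable {V : Type*} [Fintype V] [DecidableEq V] (pos : V → ℤ)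

/-- The edges across the cut `x` that start at distance at least `a` on its left and end at
distance at least `b` on its right, or conversely. -/
def cutEdges (x : ℤ) (a b : ℕ) : Finset (V × V) :=
  {e | (pos e.1 + a ≤ x ∧ x + b < pos e.2) ∨ (pos e.2 + a ≤ x ∧ x + b < pos e.1)}

variable {pos}

lemma sum_cutEdges_le {J : V × V → ℝ} {A : ℝ} {g : ℕ → ℝ} (h : CutBound pos J A g) (hA : 0 ≤ A)
    (hg : ∀ n, 0 ≤ g n) (hgs : Summable g) (x : ℤ) (a b : ℕ) :
    ∑ e ∈ cutEdges pos x a b, J e ≤ 2 * A * (tailSum g a * tailSum g b) := by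
  set L : Finset V := {k | pos k + a ≤ x}
  set R : Finset V := {k | x + b < pos k}
  have hL : ∑ k ∈ L, g (x - pos k).toNat ≤ tailSum g a := by
    refine sum_le_tailSum hg hgs L _ ?_ a ?_
    · intro k hk l hl hkl
      simp only [L, Finset.coe_filter, Finset.mem_univ, true_and, Set.mem_ofPred_eq] at hk hl hkl
      exact h.injective (by omega)
    · intro k hk
      simp only [L, Finset.mem_filter, Finset.mem_univ, true_and] at hk
      omega
  have hR : ∑ k ∈ R, g (pos k - x - 1).toNat ≤ tailSum g b := by
    refine sum_le_tailSum hg hgs R _ ?_ b ?_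
    · intro k hk l hl hkl
      simp only [R, Finset.coe_filter, Finset.mem_univ, true_and, Set.mem_ofPred_eq] at hk hl hkl
      exact h.injective (by omega)
    · intro k hk
      simp only [R, Finset.mem_filter, Finset.mem_univ, true_and] at hk
      omega
  have hsub : cutEdges pos x a b ⊆ L ×ˢ R ∪ R ×ˢ L := by
    intro e he
    simp only [cutEdges, L, R, Finset.mem_filter, Finset.mem_univ, true_and, Finset.mem_union,
      Finset.mem_product] at he ⊢
    tauto
  have hL0 : 0 ≤ ∑ k ∈ L, g (x - pos k).toNat := Finset.sum_nonneg fun k _ => hg _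
  have hR0 : 0 ≤ ∑ k ∈ R, g (pos k - x - 1).toNat := Finset.sum_nonneg fun k _ => hg _
  have hprod : ∑ k ∈ L, ∑ l ∈ R, A * (g (x - pos k).toNat * g (pos l - x - 1).toNat)
      ≤ A * (tailSum g a * tailSum g b) := by
    simp only [← Finset.mul_sum]
    rw [← Finset.sum_mul]
    exact mul_le_mul_of_nonneg_left (mul_le_mul hL hR hR0 (tailSum_nonneg hg a)) hA
  have hk : ∀ k ∈ L, pos k ≤ x := fun k hk => by
    simp only [L, Finset.mem_filter, Finset.mem_univ, true_and] at hk; omega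
  have hl : ∀ k ∈ R, x < pos k := fun k hk => by
    simp only [R, Finset.mem_filter, Finset.mem_univ, true_and] at hk; omega
  calc ∑ e ∈ cutEdges pos x a b, J e ≤ ∑ e ∈ L ×ˢ R ∪ R ×ˢ L, J e :=
        Finset.sum_le_sum_of_subset_of_nonneg hsub fun e _ _ => h.nonneg e
    _ ≤ ∑ e ∈ L ×ˢ R, J e + ∑ e ∈ R ×ˢ L, J e := by
        rw [← Finset.sum_union_inter]
        exact le_add_of_nonneg_right (Finset.sum_nonneg fun e _ => h.nonneg e)
    _ ≤ A * (tailSum g a * tailSum g b) + A * (tailSum g a * tailSum g b) := by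
        refine add_le_add ?_ ?_
        · rw [Finset.sum_product]
          exact (Finset.sum_le_sum fun k hk' => Finset.sum_le_sum fun l hl' =>
            h.le x k l (hk k hk') (hl l hl')).trans hprod
        · rw [Finset.sum_product_right]
          exact (Finset.sum_le_sum fun k hk' => Finset.sum_le_sum fun l hl' =>
            h.le' x k l (hk k hk') (hl l hl')).trans hprod
    _ = _ := by ring

omit [DecidableEq V] in
lemma not_openConn_of_disjoint_cutEdges {ω : Finset (V × V)} {x : ℤ}
    (hω : Disjoint ω (cutEdges pos x 0 0)) {i j : V} (hi : pos i ≤ x) (hj : x < pos j) :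
    ¬ OpenConn Prod.fst Prod.snd ω i j := by
  intro h
  have : pos j ≤ x := by
    clear hj
    induction h with
    | refl => exact hi
    | tail _ hkl ih =>
      obtain ⟨e, he, hkl⟩ := hkl
      by_contra hlt
      refine Finset.disjoint_left.1 hω he ?_
      simp only [cutEdges, Finset.mem_filter, Finset.mem_univ, true_and]
      push Not at hlt
      rcases hkl with ⟨rfl, rfl⟩ | ⟨rfl, rfl⟩
      · left; constructor <;> push_cast <;> omega
      · right; constructor <;> push_cast <;> omega
  omega

end cuts

/-- Connection probabilities tend to zero, uniformly, as the distance tends to infinity: between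
two far sites there are many well-separated cuts; each is crossed by a short open edge with
probability bounded away from one, independently of the others, and it is unlikely that one of them
is crossed by a long open edge. -/
theorem exists_pairConn_le {A : ℝ} (hA : 0 ≤ A) {g : ℕ → ℝ} (hg : ∀ n, 0 ≤ g n) (hgs : Summable g)
    {ε : ℝ} (hε : 0 < ε) :
    ∃ N : ℕ, ∀ {V : Type} [Fintype V] [DecidableEq V] (pos : V → ℤ) (J : V × V → ℝ),
      CutBound pos J A g → ∀ i j : V, (N : ℤ) ≤ |pos i - pos j| →
        pairConn (edgeProb J) i j ≤ ε := by
  set T := tailSum g 0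
  have hT : 0 ≤ T := tailSum_nonneg hg 0
  set γ := Real.exp (-(2 * A * (T * T))) with hγ
  have hγ0 : 0 < γ := Real.exp_pos _
  have hγ1 : γ ≤ 1 := Real.exp_le_one_iff.2 (by
    have : 0 ≤ 2 * A * (T * T) := by positivity
    linarith)
  -- `m` cuts are considered, and an edge is long if it extends over more than `n` on one side
  obtain ⟨m, hm⟩ := exists_pow_lt_of_lt_one (half_pos hε) (by linarith : 1 - γ < 1)
  obtain ⟨n, hn, hn1⟩ : ∃ n : ℕ, (m : ℝ) * (4 * A * T * tailSum g n) ≤ ε / 2 ∧ 1 ≤ n := by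
    have h1 : Filter.Tendsto (fun n => (m : ℝ) * (4 * A * T * tailSum g n)) Filter.atTop
        (nhds ((m : ℝ) * (4 * A * T * 0))) :=
      ((tendsto_sum_nat_add g).const_mul _).const_mul _
    rw [mul_zero, mul_zero] at h1
    exact ((h1.eventually (ge_mem_nhds (half_pos hε))).and (Filter.eventually_ge_atTop 1)).exists
  refine ⟨2 * m * n + 1, ?_⟩
  intro V _ _ pos J hJ i j hij
  wlog hlt : pos i < pos j generalizing i j
  · have := this j i (by rw [abs_sub_comm]; exact hij) (by
      have : pos i ≠ pos j := fun h => by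
        rw [h, sub_self, abs_zero] at hij; push_cast at hij; nlinarith
      omega)
    unfold pairConn at this ⊢
    rwa [connProb_comm]
  rw [abs_of_neg (by omega)] at hij
  push_cast at hij
  have h0 := edgeProb_nonneg hJ.nonneg
  have h1 := edgeProb_le_one (J := J)
  -- the cuts, the long edges across them, and the short edges across them; short edges stay within
  -- distance `n` of their cut, and the cuts are at distance `2 * n`
  let x : ℕ → ℤ := fun a => pos i + (2 * a + 1) * n
  let long : ℕ → Finset (V × V) := fun a => cutEdges pos (x a) n 0 ∪ cutEdges pos (x a) 0 n
  let short : ℕ → Finset (V × V) := fun a => cutEdges pos (x a) 0 0 \ long a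
  have hxi : ∀ a, pos i ≤ x a := fun a => by
    have : (0 : ℤ) ≤ (2 * a + 1) * n := by positivity
    simp only [x]; linarith
  have hxj : ∀ a ∈ Finset.range m, x a < pos j := fun a ha => by
    have ham : (a : ℤ) + 1 ≤ m := by exact_mod_cast Finset.mem_range.1 ha
    have hn0 : (1 : ℤ) ≤ n := by exact_mod_cast hn1
    simp only [x]
    nlinarith
  have hdisj : ∀ a ∈ Finset.range m, ∀ b ∈ Finset.range m, a ≠ b →
      Disjoint (short a) (short b) := by
    have hwin : ∀ a, ∀ e ∈ short a, x a - n < pos e.1 ∧ pos e.1 ≤ x a + n := by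
      intro a e he
      simp only [short, long, cutEdges, Finset.mem_sdiff, Finset.mem_union, Finset.mem_filter,
        Finset.mem_univ, true_and] at he
      push_cast at he
      have hn0 : (0 : ℤ) ≤ n := by positivity
      constructor <;> by_contra hcon <;> push Not at hcon
      · refine he.2 (Or.inl ?_)
        rcases he.1 with h | h
        · left; constructor <;> linarith [h.1, h.2]
        · exfalso; linarith [h.1, h.2]
      · refine he.2 (Or.inr ?_)
        rcases he.1 with h | h
        · exfalso; linarith [h.1, h.2]
        · right; constructor <;> linarith [h.1, h.2]
    have hord : ∀ a b : ℕ, a < b → x a + n ≤ x b - n := by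
      intro a b hab
      have h : (a : ℤ) + 1 ≤ b := by exact_mod_cast hab
      have hn0 : (1 : ℤ) ≤ n := by exact_mod_cast hn1
      simp only [x]
      nlinarith
    intro a _ b _ hab
    rw [Finset.disjoint_left]
    intro e hea heb
    have ha := hwin a e hea
    have hb := hwin b e heb
    rcases lt_or_gt_of_ne hab with h | h
    · have := hord a b h; omega
    · have := hord b a h; omega
  -- the indicator that the cut `x a` is crossed by a short open edge
  let f : ℕ → Finset (V × V) → ℝ := fun a ω => 1 - if Disjoint ω (short a) then 1 else 0
  have hf : ∀ a, DeterminedBy (short a) (f a) := fun a ω => by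
    simp [f, Finset.disjoint_iff_inter_eq_empty, Finset.inter_assoc]
  have hf0 : ∀ a ω, 0 ≤ f a ω := fun a ω => by simp only [f]; split_ifs <;> simp
  have hpt : pairConn (edgeProb J) i j ≤ percExp (edgeProb J) (fun ω =>
      (∑ a ∈ Finset.range m, ∑ e ∈ long a, if e ∈ ω then 1 else 0)
        + ∏ a ∈ Finset.range m, f a ω) := by
    refine bernSum_mono h0 h1 fun ω => ?_
    have hs0 : ∀ a, (0 : ℝ) ≤ ∑ e ∈ long a, if e ∈ ω then 1 else 0 := fun a =>
      Finset.sum_nonneg fun e _ => by split_ifs <;> simp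
    have hp0 : 0 ≤ ∏ a ∈ Finset.range m, f a ω := Finset.prod_nonneg fun a _ => hf0 a ω
    split_ifs with hc
    · by_cases hlong : ∃ a ∈ Finset.range m, ∃ e ∈ long a, e ∈ ω
      · obtain ⟨a, ha, e, he, heω⟩ := hlong
        have : (1 : ℝ) ≤ ∑ e ∈ long a, if e ∈ ω then 1 else 0 := by
          have := Finset.single_le_sum (f := fun e => if e ∈ ω then (1 : ℝ) else 0)
            (fun e _ => by split_ifs <;> simp) he
          simpa [heω] using this
        have h2 := Finset.single_le_sum
          (f := fun a => ∑ e ∈ long a, if e ∈ ω then (1 : ℝ) else 0) (fun a _ => hs0 a) ha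
        linarith
      · have : ∏ a ∈ Finset.range m, f a ω = 1 := by
          refine Finset.prod_eq_one fun a ha => ?_
          simp only [f]
          rw [if_neg, sub_zero]
          intro hd
          refine not_openConn_of_disjoint_cutEdges (pos := pos) (x := x a) ?_ (hxi a) (hxj a ha) hc
          rw [Finset.disjoint_left]
          intro e heω he
          by_cases hel : e ∈ long a
          · exact hlong ⟨a, ha, e, hel, heω⟩
          · exact Finset.disjoint_left.1 hd heω (Finset.mem_sdiff.2 ⟨he, hel⟩)
        rw [this]
        have := Finset.sum_nonneg fun a (_ : a ∈ Finset.range m) => hs0 a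
        linarith
    · exact add_nonneg (Finset.sum_nonneg fun a _ => hs0 a) hp0
  refine hpt.trans ?_
  rw [percExp, bernSum_add]
  have hlongE : bernSum Finset.univ (edgeProb J)
      (fun ω => ∑ a ∈ Finset.range m, ∑ e ∈ long a, if e ∈ ω then 1 else 0) ≤ ε / 2 := by
    rw [bernSum_sum]
    refine le_trans ?_ hn
    have : (m : ℝ) * (4 * A * T * tailSum g n)
        = ∑ a ∈ Finset.range m, (4 * A * T * tailSum g n) := by simp
    rw [this]
    refine Finset.sum_le_sum fun a _ => ?_
    rw [bernSum_sum]
    calc ∑ e ∈ long a, bernSum Finset.univ (edgeProb J) (fun ω => if e ∈ ω then 1 else 0)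
        = ∑ e ∈ long a, edgeProb J e := Finset.sum_congr rfl fun e _ => percExp_mem _ e
      _ ≤ ∑ e ∈ long a, J e := Finset.sum_le_sum fun e _ => edgeProb_le e
      _ ≤ ∑ e ∈ cutEdges pos (x a) n 0, J e + ∑ e ∈ cutEdges pos (x a) 0 n, J e := by
        rw [← Finset.sum_union_inter]
        exact le_add_of_nonneg_right (Finset.sum_nonneg fun e _ => hJ.nonneg e)
      _ ≤ 2 * A * (tailSum g n * tailSum g 0) + 2 * A * (tailSum g 0 * tailSum g n) :=
        add_le_add (sum_cutEdges_le hJ hA hg hgs _ _ _) (sum_cutEdges_le hJ hA hg hgs _ _ _)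
      _ = _ := by simp only [T]; ring
  have hprod : bernSum Finset.univ (edgeProb J) (fun ω => ∏ a ∈ Finset.range m, f a ω) ≤ ε / 2 := by
    refine le_trans ?_ hm.le
    have := percExp_prod (Finset.range m) short hdisj (edgeProb J) f hf
    rw [percExp] at this
    rw [this]
    refine (Finset.prod_le_prod (g := fun _ => 1 - γ) (fun a _ => bernSum_nonneg h0 h1 (hf0 a))
      fun a _ => ?_).trans_eq (by simp)
    have e1 : percExp (edgeProb J) (f a) = 1 - ∏ e ∈ short a, (1 - edgeProb J e) := by
      rw [← percExp_disjoint]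
      have : f a = fun ω => 1 + (-1) * (if Disjoint ω (short a) then (1 : ℝ) else 0) := by
        ext ω; simp only [f]; ring
      rw [this, percExp, bernSum_add, bernSum_const, bernSum_mul_left, percExp]
      ring
    change percExp (edgeProb J) (f a) ≤ 1 - γ
    rw [e1]
    have e2 : ∏ e ∈ short a, (1 - edgeProb J e) = Real.exp (-∑ e ∈ short a, J e) := by
      rw [← Finset.sum_neg_distrib, Real.exp_sum]
      exact Finset.prod_congr rfl fun e _ => by simp [edgeProb]
    have e3 : ∑ e ∈ short a, J e ≤ 2 * A * (T * T) :=
      (Finset.sum_le_sum_of_subset_of_nonneg Finset.sdiff_subset fun e _ _ => hJ.nonneg e).trans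
        (sum_cutEdges_le hJ hA hg hgs _ 0 0)
    have : γ ≤ ∏ e ∈ short a, (1 - edgeProb J e) := by
      rw [e2]; exact Real.exp_le_exp.2 (by linarith)
    linarith
  linarith

/-- For a long block `B` around `i`, the expected number of open edges from the cluster of `i` to
the outside of `B` is at most `1/2`: a site of `B` that is far from `i` is unlikely to be connected
to `i`, and one near `i` is far from the complement of `B`. -/
theorem exists_block_sum_le {A : ℝ} (hA : 0 ≤ A) {g : ℕ → ℝ} (hg : ∀ n, 0 ≤ g n)
    (hgs : Summable g) :
    ∃ L : ℕ, ∀ {V : Type} [Fintype V] [DecidableEq V] (pos : V → ℤ) (J : V × V → ℝ),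
      CutBound pos J A g → ∀ (i : V) (B : Finset V), (∀ k, k ∈ B ↔ |pos i - pos k| ≤ L) →
        ∑ k ∈ B, ∑ l ∈ Bᶜ, pairConn (edgeProb J) i k * (J (k, l) + J (l, k)) ≤ 1 / 2 := by
  set T := tailSum g 0
  have hT : 0 ≤ T := tailSum_nonneg hg 0
  -- `ε` bounds the probability of a connection to a far site of `B`
  set ε := 1 / (16 * A * T * T + 1)
  have hden : 0 < 16 * A * T * T + 1 := by positivity
  have hε : 0 < ε := by positivity
  have hεT : 4 * A * T * (ε * T) ≤ 1 / 4 := by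
    have : 4 * A * T * (ε * T) = (16 * A * T * T) / (16 * A * T * T + 1) / 4 := by
      simp only [ε]; field_simp; ring
    rw [this]
    have : (16 * A * T * T) / (16 * A * T * T + 1) ≤ 1 := by rw [div_le_one hden]; linarith
    linarith
  obtain ⟨N, hN⟩ := exists_pairConn_le hA hg hgs hε
  obtain ⟨M, hM⟩ : ∃ M : ℕ, 4 * A * T * tailSum g M ≤ 1 / 4 := by
    have h1 : Filter.Tendsto (fun n => 4 * A * T * tailSum g n) Filter.atTop
        (nhds (4 * A * T * 0)) := (tendsto_sum_nat_add g).const_mul _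
    rw [mul_zero] at h1
    exact (h1.eventually (ge_mem_nhds (by norm_num))).exists
  refine ⟨N + M, ?_⟩
  intro V _ _ pos J hJ i B hB
  have h0 := edgeProb_nonneg hJ.nonneg
  have h1 := edgeProb_le_one (J := J)
  set Θ := pairConn (edgeProb J) i
  have hΘ0 : ∀ k, 0 ≤ Θ k := fun k => connProb_nonneg _ _ h0 h1 _ _
  have hΘ1 : ∀ k, Θ k ≤ 1 := fun k => connProb_le_one _ _ h0 h1 _ _
  -- the sum over the sites of `B` with weights given by the distance to an end of `B`
  have inner : ∀ φ : V → ℕ, Set.InjOn φ B →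
      (∀ k ∈ B, |pos i - pos k| < N → M ≤ φ k) →
      ∑ k ∈ B, Θ k * g (φ k) ≤ ε * T + tailSum g M := by
    intro φ hφ hφM
    rw [← Finset.sum_filter_add_sum_filter_not B (fun k => (N : ℤ) ≤ |pos i - pos k|)]
    refine add_le_add ?_ ?_
    · calc ∑ k ∈ B with (N : ℤ) ≤ |pos i - pos k|, Θ k * g (φ k)
          ≤ ∑ k ∈ B with (N : ℤ) ≤ |pos i - pos k|, ε * g (φ k) := by
            refine Finset.sum_le_sum fun k hk => mul_le_mul_of_nonneg_right ?_ (hg _)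
            exact hN pos J hJ i k (Finset.mem_filter.1 hk).2
        _ ≤ ε * T := by
            rw [← Finset.mul_sum]
            refine mul_le_mul_of_nonneg_left ?_ hε.le
            exact sum_le_tailSum hg hgs _ φ
              (hφ.mono (Finset.coe_subset.2 (Finset.filter_subset _ _))) 0 fun _ _ => Nat.zero_le _
    · refine (Finset.sum_le_sum fun k _ => mul_le_mul_of_nonneg_right (hΘ1 k) (hg _)).trans ?_
      simp only [one_mul]
      refine sum_le_tailSum hg hgs _ φ
        (hφ.mono (Finset.coe_subset.2 (Finset.filter_subset _ _))) M fun k hk => ?_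
      rw [Finset.mem_filter, not_le] at hk
      exact hφM k hk.1 hk.2
  -- the complement of `B` lies on the right and on the left of `B`
  let R : Finset V := {l | pos i + (N + M) < pos l}
  let L : Finset V := {l | pos l < pos i - (N + M)}
  have hBc : Bᶜ ⊆ R ∪ L := by
    intro l hl
    rw [Finset.mem_compl, hB, abs_le] at hl
    simp only [R, L, Finset.mem_union, Finset.mem_filter, Finset.mem_univ, true_and]
    push_cast at hl
    by_contra hcon
    push Not at hcon
    exact hl ⟨by linarith [hcon.1], by linarith [hcon.2]⟩
  have hBk : ∀ k ∈ B, pos k ≤ pos i + (N + M) ∧ pos i - (N + M) ≤ pos k := by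
    intro k hk
    rw [hB, abs_le] at hk
    push_cast at hk
    constructor <;> linarith [hk.1, hk.2]
  have hright : ∀ k ∈ B, ∑ l ∈ R, Θ k * (J (k, l) + J (l, k))
      ≤ 2 * A * T * (Θ k * g (pos i + (N + M) - pos k).toNat) := by
    intro k hk
    rw [← Finset.mul_sum]
    have hs : ∑ l ∈ R, (J (k, l) + J (l, k))
        ≤ 2 * A * g (pos i + (N + M) - pos k).toNat * T := by
      calc ∑ l ∈ R, (J (k, l) + J (l, k))
          ≤ ∑ l ∈ R, 2 * A * g (pos i + (N + M) - pos k).toNat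
              * g (pos l - (pos i + (N + M)) - 1).toNat := by
            refine Finset.sum_le_sum fun l hl => ?_
            simp only [R, Finset.mem_filter, Finset.mem_univ, true_and] at hl
            have := hJ.le _ k l (hBk k hk).1 hl
            have := hJ.le' _ k l (hBk k hk).1 hl
            linarith
        _ ≤ _ := by
            rw [← Finset.mul_sum]
            refine mul_le_mul_of_nonneg_left ?_ (mul_nonneg (by positivity) (hg _))
            refine sum_le_tailSum hg hgs _ _ ?_ 0 fun _ _ => Nat.zero_le _
            intro a ha b hb hab
            simp only [R, Finset.coe_filter, Finset.mem_univ, true_and, Set.mem_ofPred_eq]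
              at ha hb hab
            exact hJ.injective (by omega)
    calc Θ k * ∑ l ∈ R, (J (k, l) + J (l, k))
        ≤ Θ k * (2 * A * g (pos i + (N + M) - pos k).toNat * T) :=
          mul_le_mul_of_nonneg_left hs (hΘ0 k)
      _ = _ := by ring
  have hleft : ∀ k ∈ B, ∑ l ∈ L, Θ k * (J (k, l) + J (l, k))
      ≤ 2 * A * T * (Θ k * g (pos k - (pos i - (N + M) - 1) - 1).toNat) := by
    intro k hk
    rw [← Finset.mul_sum]
    have hs : ∑ l ∈ L, (J (k, l) + J (l, k))
        ≤ 2 * A * g (pos k - (pos i - (N + M) - 1) - 1).toNat * T := by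
      calc ∑ l ∈ L, (J (k, l) + J (l, k))
          ≤ ∑ l ∈ L, 2 * A * g (pos k - (pos i - (N + M) - 1) - 1).toNat
              * g ((pos i - (N + M) - 1) - pos l).toNat := by
            refine Finset.sum_le_sum fun l hl => ?_
            simp only [L, Finset.mem_filter, Finset.mem_univ, true_and] at hl
            have hk2 := (hBk k hk).2
            have := hJ.le (pos i - (N + M) - 1) l k (by omega) (by omega)
            have := hJ.le' (pos i - (N + M) - 1) l k (by omega) (by omega)
            linarith
        _ ≤ _ := by
            rw [← Finset.mul_sum]
            refine mul_le_mul_of_nonneg_left ?_ (mul_nonneg (by positivity) (hg _))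
            refine sum_le_tailSum hg hgs _ _ ?_ 0 fun _ _ => Nat.zero_le _
            intro a ha b hb hab
            simp only [L, Finset.coe_filter, Finset.mem_univ, true_and, Set.mem_ofPred_eq]
              at ha hb hab
            exact hJ.injective (by omega)
    calc Θ k * ∑ l ∈ L, (J (k, l) + J (l, k))
        ≤ Θ k * (2 * A * g (pos k - (pos i - (N + M) - 1) - 1).toNat * T) :=
          mul_le_mul_of_nonneg_left hs (hΘ0 k)
      _ = _ := by ring
  have iR := inner (fun k => (pos i + (N + M) - pos k).toNat) (by
      intro a ha b hb hab
      have := hBk a ha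
      have := hBk b hb
      simp only [] at hab
      exact hJ.injective (by omega)) (by
      intro k _ hkN
      rw [abs_lt] at hkN
      omega)
  have iL := inner (fun k => (pos k - (pos i - (N + M) - 1) - 1).toNat) (by
      intro a ha b hb hab
      have := hBk a ha
      have := hBk b hb
      simp only [] at hab
      exact hJ.injective (by omega)) (by
      intro k _ hkN
      rw [abs_lt] at hkN
      omega)
  have hAT : 0 ≤ 2 * A * T := by positivity
  calc ∑ k ∈ B, ∑ l ∈ Bᶜ, Θ k * (J (k, l) + J (l, k))
      ≤ ∑ k ∈ B, (∑ l ∈ R, Θ k * (J (k, l) + J (l, k)) + ∑ l ∈ L, Θ k * (J (k, l) + J (l, k))) := by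
        have hn : ∀ k l, 0 ≤ Θ k * (J (k, l) + J (l, k)) := fun k l =>
          mul_nonneg (hΘ0 k) (add_nonneg (hJ.nonneg _) (hJ.nonneg _))
        refine Finset.sum_le_sum fun k _ => ?_
        rw [← Finset.sum_union_inter]
        exact (Finset.sum_le_sum_of_subset_of_nonneg hBc fun l _ _ => hn k l).trans
          (le_add_of_nonneg_right (Finset.sum_nonneg fun l _ => hn k l))
    _ ≤ ∑ k ∈ B, (2 * A * T * (Θ k * g (pos i + (N + M) - pos k).toNat)
          + 2 * A * T * (Θ k * g (pos k - (pos i - (N + M) - 1) - 1).toNat)) :=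
        Finset.sum_le_sum fun k hk => add_le_add (hright k hk) (hleft k hk)
    _ = 2 * A * T * ∑ k ∈ B, Θ k * g (pos i + (N + M) - pos k).toNat
          + 2 * A * T * ∑ k ∈ B, Θ k * g (pos k - (pos i - (N + M) - 1) - 1).toNat := by
        rw [Finset.sum_add_distrib, Finset.mul_sum, Finset.mul_sum]
    _ ≤ 2 * A * T * (ε * T + tailSum g M) + 2 * A * T * (ε * T + tailSum g M) :=
        add_le_add (mul_le_mul_of_nonneg_left iR hAT) (mul_le_mul_of_nonneg_left iL hAT)
    _ ≤ 1 / 2 := by linarith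

/-- Couplings of decay order `s > 2` on the half-lines left and right of a cut are bounded by a
product, since `(u + v + 1) ^ s ≥ (u + 1) ^ (s / 2) * (v + 1) ^ (s / 2)`. -/
lemma cutBound_of_decay {V : Type*} {pos : V → ℤ} (hpos : Function.Injective pos)
    {J : V × V → ℝ} (hJ : ∀ e, 0 ≤ J e) {c s : ℝ} (hc : 0 ≤ c) (hs : 2 < s)
    (hdecay : ∀ k l, J (k, l) ≤ c / decayWeight s (pos k) (pos l)) :
    CutBound pos J c (fun n : ℕ => ((n : ℝ) + 1) ^ (-(s / 2))) := by
  have key : ∀ x k l, pos k ≤ x → x < pos l → c / decayWeight s (pos k) (pos l)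
      ≤ c * ((((x - pos k).toNat : ℝ) + 1) ^ (-(s / 2))
        * (((pos l - x - 1).toNat : ℝ) + 1) ^ (-(s / 2))) := by
    intro x k l hk hl
    rw [Real.rpow_neg (by positivity), Real.rpow_neg (by positivity), ← mul_inv, div_eq_mul_inv]
    refine mul_le_mul_of_nonneg_left (inv_anti₀ (by positivity) ?_) hc
    have e1 : ((x - pos k).toNat : ℝ) = (x : ℝ) - pos k := by
      have : ((x - pos k).toNat : ℤ) = x - pos k := Int.toNat_of_nonneg (by omega)
      exact_mod_cast this
    have e2 : ((pos l - x - 1).toNat : ℝ) = (pos l : ℝ) - x - 1 := by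
      have : ((pos l - x - 1).toNat : ℤ) = pos l - x - 1 := Int.toNat_of_nonneg (by omega)
      exact_mod_cast this
    have h1 : (pos k : ℝ) ≤ x := by exact_mod_cast hk
    have h2 : (x : ℝ) + 1 ≤ pos l := by exact_mod_cast hl
    rw [e1, e2, decayWeight, abs_sub_comm, abs_of_nonneg (by linarith)]
    have hs2 : s = s / 2 + s / 2 := by ring
    have h3 : ((pos l : ℝ) - pos k) ^ s = ((pos l : ℝ) - pos k) ^ (s / 2)
        * ((pos l : ℝ) - pos k) ^ (s / 2) := by
      conv_lhs => rw [hs2]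
      exact Real.rpow_add (by linarith) _ _
    have h4 : ((x : ℝ) - pos k + 1) ^ (s / 2) ≤ ((pos l : ℝ) - pos k) ^ (s / 2) :=
      Real.rpow_le_rpow (by linarith) (by linarith) (by linarith)
    have h5 : ((pos l : ℝ) - x - 1 + 1) ^ (s / 2) ≤ ((pos l : ℝ) - pos k) ^ (s / 2) :=
      Real.rpow_le_rpow (by linarith) (by linarith) (by linarith)
    have h6 := mul_le_mul h4 h5 (Real.rpow_nonneg (by linarith) _)
      (Real.rpow_nonneg (by linarith) _)
    linarith
  refine ⟨hpos, hJ, fun x k l hk hl => (hdecay k l).trans (key x k l hk hl), fun x k l hk hl => ?_⟩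
  refine (hdecay l k).trans ?_
  rw [decayWeight_comm]
  exact key x k l hk hl

/-- In one-dimensional percolation with edge probabilities of decay order `s > 2`, the connection
probabilities decay with the same order. -/
theorem exists_pairConn_decay {c s : ℝ} (hc : 0 ≤ c) (hs : 2 < s) :
    ∃ C : ℝ, 0 ≤ C ∧ ∀ {V : Type} [Fintype V] [DecidableEq V] (pos : V → ℤ),
      Function.Injective pos → ∀ J : V × V → ℝ, (∀ e, 0 ≤ J e) →
      (∀ k l, J (k, l) ≤ c / decayWeight s (pos k) (pos l)) →
      ∀ i j, pairConn (edgeProb J) i j ≤ C / decayWeight s (pos i) (pos j) := by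
  have hg : ∀ n : ℕ, (0 : ℝ) ≤ ((n : ℝ) + 1) ^ (-(s / 2)) := fun n => by positivity
  have hgs : Summable fun n : ℕ => ((n : ℝ) + 1) ^ (-(s / 2)) := by
    have h := (summable_nat_add_iff 1).2
      (Real.summable_nat_rpow (p := -(s / 2)) |>.2 (by linarith))
    simpa using h
  obtain ⟨L, hL⟩ := exists_block_sum_le hc hg hgs
  -- moving from `i` to another site of its block of radius `L` shortens the distance to a site
  -- outside the block at most by the factor `θ`
  set θ : ℝ := 1 / ((L : ℝ) + 1) with hθ
  have hθ0 : 0 < θ := by positivity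
  have hθ1 : θ ≤ 1 := by
    rw [hθ, div_le_one (by positivity)]
    have : (0 : ℝ) ≤ L := by positivity
    linarith
  have hθs : 0 < θ ^ s := by positivity
  obtain ⟨C, hC0, hC⟩ := decay_of_contraction (s := s) (η := 1 / 2)
    (C₁ := (2 * (L : ℝ) + 1) * (2 * c / θ ^ s)) (C₂ := (L : ℝ) ^ s + 1) (by linarith)
    (by norm_num) (by positivity) (by positivity)
  refine ⟨C, hC0, ?_⟩
  intro V _ _ pos hpos J hJ hdecay
  have h0 := edgeProb_nonneg hJ
  have h1 := edgeProb_le_one (J := J)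
  have hp := edgeProb_le (J := J)
  set Θ := pairConn (edgeProb J)
  have hΘ0 : ∀ i k, 0 ≤ Θ i k := fun i k => connProb_nonneg _ _ h0 h1 _ _
  have hΘ1 : ∀ i k, Θ i k ≤ 1 := fun i k => connProb_le_one _ _ h0 h1 _ _
  let B : V → Finset V := fun i => {k | |pos i - pos k| ≤ L}
  have hB : ∀ i k, k ∈ B i ↔ |pos i - pos k| ≤ L := fun i k => by simp [B]
  have hblock := fun i => hL pos J (cutBound_of_decay hpos hJ hc hs hdecay) i (B i) (hB i)
  -- the kernel that appears in the Simon–Lieb inequality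
  let κ : V → V → ℝ := fun i l => if l ∈ (B i)ᶜ then
    ∑ k ∈ B i, Θ i k * (edgeProb J (k, l) + edgeProb J (l, k)) else 0
  have hsw : ∀ i (φ : V → ℝ), ∑ l, κ i l * φ l
      = ∑ k ∈ B i, ∑ l ∈ (B i)ᶜ, Θ i k * (edgeProb J (k, l) + edgeProb J (l, k)) * φ l := by
    intro i φ
    rw [Finset.sum_comm]
    simp only [κ, ite_mul, zero_mul, Finset.sum_mul]
    rw [Finset.sum_ite_mem, Finset.univ_inter]
  refine hC pos hpos Θ κ hΘ0 (fun i j => connProb_comm _ _ _ i j) ?_ ?_ ?_ ?_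
  · intro i l
    simp only [κ]
    split_ifs
    · exact Finset.sum_nonneg fun k _ => mul_nonneg (hΘ0 _ _) (add_nonneg (h0 _) (h0 _))
    · exact le_rfl
  · intro i
    have h := hsw i (fun _ => 1)
    simp only [mul_one] at h
    rw [h]
    refine le_trans ?_ (hblock i)
    exact Finset.sum_le_sum fun k _ => Finset.sum_le_sum fun l _ =>
      mul_le_mul_of_nonneg_left (add_le_add (hp _) (hp _)) (hΘ0 _ _)
  · intro i l
    simp only [κ]
    have hw := decayWeight_pos s (pos i) (pos l)
    split_ifs with hl
    swap
    · positivity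
    have hcard : ((B i).card : ℝ) ≤ 2 * L + 1 := by
      have h := Finset.card_le_card_of_injOn (s := B i) (t := Finset.Icc (pos i - L) (pos i + L)) pos
        (by
          intro k hk
          have hk' := (hB i k).1 hk
          rw [abs_le] at hk'
          simp only [Finset.coe_Icc, Set.mem_Icc]
          constructor <;> linarith [hk'.1, hk'.2]) hpos.injOn
      rw [Int.card_Icc] at h
      have h' : (B i).card ≤ 2 * L + 1 := by omega
      exact_mod_cast h'
    have hterm : ∀ k ∈ B i, Θ i k * (edgeProb J (k, l) + edgeProb J (l, k))
        ≤ 2 * c / θ ^ s / decayWeight s (pos i) (pos l) := by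
      intro k hk
      have hkl : θ * |(pos i : ℝ) - pos l| ≤ |(pos k : ℝ) - pos l| := by
        have hk' : |(pos i : ℝ) - pos k| ≤ L := by exact_mod_cast (hB i k).1 hk
        have hne : pos k ≠ pos l := fun h => by
          rw [Finset.mem_compl, hB, ← h, ← hB] at hl
          exact hl hk
        have h1 : (1 : ℝ) ≤ |(pos k : ℝ) - pos l| := by
          have : 1 ≤ |pos k - pos l| := Int.one_le_abs (sub_ne_zero.2 hne)
          exact_mod_cast this
        have tri : |(pos i : ℝ) - pos l| ≤ |(pos i : ℝ) - pos k| + |(pos k : ℝ) - pos l| :=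
          abs_sub_le _ _ _
        rw [hθ, one_div, inv_mul_le_iff₀ (by positivity)]
        have : (0 : ℝ) ≤ L := by positivity
        nlinarith
      have h2 := rpow_mul_decayWeight_le (by linarith : 0 ≤ s) hθ0.le hθ1 hkl
      have h3 : c / decayWeight s (pos k) (pos l) ≤ c / θ ^ s / decayWeight s (pos i) (pos l) := by
        rw [div_div]
        exact div_le_div_of_nonneg_left hc (by positivity) h2
      have h4 := hdecay k l
      have h5 := hdecay l k
      rw [decayWeight_comm] at h5
      calc Θ i k * (edgeProb J (k, l) + edgeProb J (l, k))
          ≤ 1 * (edgeProb J (k, l) + edgeProb J (l, k)) :=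
            mul_le_mul_of_nonneg_right (hΘ1 _ _) (add_nonneg (h0 _) (h0 _))
        _ ≤ c / θ ^ s / decayWeight s (pos i) (pos l) + c / θ ^ s / decayWeight s (pos i) (pos l) := by
            linarith [hp (k, l), hp (l, k)]
        _ = _ := by ring
    calc ∑ k ∈ B i, Θ i k * (edgeProb J (k, l) + edgeProb J (l, k))
        ≤ ∑ k ∈ B i, 2 * c / θ ^ s / decayWeight s (pos i) (pos l) := Finset.sum_le_sum hterm
      _ = (B i).card * (2 * c / θ ^ s / decayWeight s (pos i) (pos l)) := by
          rw [Finset.sum_const, nsmul_eq_mul]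
      _ ≤ (2 * L + 1) * (2 * c / θ ^ s / decayWeight s (pos i) (pos l)) := by gcongr
      _ = _ := by ring
  · intro i j
    have hw := decayWeight_pos s (pos i) (pos j)
    rw [hsw]
    by_cases hj : j ∈ B i
    · have hn : 0 ≤ ∑ k ∈ B i, ∑ l ∈ (B i)ᶜ,
          Θ i k * (edgeProb J (k, l) + edgeProb J (l, k)) * Θ l j :=
        Finset.sum_nonneg fun k _ => Finset.sum_nonneg fun l _ =>
          mul_nonneg (mul_nonneg (hΘ0 _ _) (add_nonneg (h0 _) (h0 _))) (hΘ0 _ _)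
      have h2 : 1 ≤ ((L : ℝ) ^ s + 1) / decayWeight s (pos i) (pos j) := by
        rw [one_le_div hw, decayWeight]
        have : |(pos i : ℝ) - pos j| ≤ L := by exact_mod_cast (hB i j).1 hj
        have := Real.rpow_le_rpow (abs_nonneg _) this (by linarith : 0 ≤ s)
        linarith
      linarith [hΘ1 i j]
    · have h := pairConn_le_sum h0 h1 (i := i) (j := j) (B := B i) ((hB i i).2 (by simp)) hj
      have : 0 ≤ ((L : ℝ) ^ s + 1) / decayWeight s (pos i) (pos j) := by positivity
      linarith

/-! ### Quadratic interactions -/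

section
variable {ι : Type*} [Fintype ι]

/-- The interaction `∑ₖ ∑ₗ Jₖₗ pₖ pₗ`, summed over ordered pairs. -/
def pairEnergy (J : ι → ι → ℝ) (p : ι → ℝ) : ℝ := ∑ k, ∑ l, J k l * p k * p l

/-- A sign configuration as a real vector. -/
def spinVec (σ : ι → ℤˣ) (k : ι) : ℝ := spin (σ k)

/-- The pair correlations of the ferromagnetic Ising model with couplings `c` are bounded by the
connection probabilities of the bond percolation that opens each ordered pair with probability
`1 - exp (-2 c)`. -/
theorem ising_le_pairConn [DecidableEq ι] {c : ι → ι → ℝ} (hc : ∀ k l, 0 ≤ c k l) (i j : ι) :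
    ∑ σ, spin (σ i) * spin (σ j) * Real.exp (pairEnergy c (spinVec σ))
      ≤ pairConn (edgeProb fun e => 2 * c e.1 e.2) i j
        * ∑ σ : ι → ℤˣ, Real.exp (pairEnergy c (spinVec σ)) := by
  set p : ι × ι → ℝ := edgeProb fun e => 2 * c e.1 e.2
  have hJ : ∀ e : ι × ι, 0 ≤ 2 * c e.1 e.2 := fun e => mul_nonneg zero_le_two (hc _ _)
  have h0 : ∀ e, 0 ≤ p e := edgeProb_nonneg hJ
  have h1 : ∀ e, p e ≤ 1 := edgeProb_le_one
  have hW : ∀ σ, Real.exp (pairEnergy c (spinVec σ))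
      = Real.exp (∑ e : ι × ι, c e.1 e.2) * isingWeight Prod.fst Prod.snd p σ := by
    intro σ
    have hE : pairEnergy c (spinVec σ)
        = ∑ e : ι × ι, c e.1 e.2 + ∑ e : ι × ι, c e.1 e.2 * (edgeSpin Prod.fst Prod.snd e σ - 1) := by
      rw [← Finset.sum_add_distrib, Fintype.sum_prod_type, pairEnergy]
      refine Finset.sum_congr rfl fun k _ => Finset.sum_congr rfl fun l _ => ?_
      simp only [edgeSpin, spinVec]; ring
    rw [hE, Real.exp_add, isingWeight, Real.exp_sum (f := fun e : ι × ι =>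
      c e.1 e.2 * (edgeSpin Prod.fst Prod.snd e σ - 1))]
    congr 1
    refine Finset.prod_congr rfl fun e _ => ?_
    simp only [p, edgeProb]
    rcases edgeSpin_eq_or Prod.fst Prod.snd e σ with h | h <;> rw [h]
    · simp
    · have : c e.1 e.2 * (-1 - 1) = -(2 * c e.1 e.2) := by ring
      rw [this]; ring
  have h := isingMean_pair_le_connProb Prod.fst Prod.snd p h0 h1 i j
  rw [isingMean, div_le_iff₀ (isingSum_one_pos _ _ h0 h1)] at h
  have h2 := mul_le_mul_of_nonneg_left h (Real.exp_pos (∑ e : ι × ι, c e.1 e.2)).le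
  simp only [hW]
  unfold isingSum at h2
  rw [Finset.mul_sum, ← mul_assoc, mul_comm (Real.exp _), mul_assoc, Finset.mul_sum] at h2
  simp only [one_mul] at h2
  refine le_trans (le_of_eq ?_) h2
  exact Finset.sum_congr rfl fun σ _ => by ring

lemma pairEnergy_le {J : ι → ι → ℝ} (hJ : ∀ k l, 0 ≤ J k l) (hsymm : ∀ k l, J k l = J l k)
    (p : ι → ℝ) : pairEnergy J p ≤ ∑ k, (∑ l, J k l) * p k ^ 2 := by
  have h1 : pairEnergy J p ≤ ∑ k, ∑ l, (J k l * p k ^ 2 / 2 + J k l * p l ^ 2 / 2) := by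
    refine Finset.sum_le_sum fun k _ => Finset.sum_le_sum fun l _ => ?_
    have := mul_nonneg (hJ k l) (sq_nonneg (p k - p l))
    nlinarith
  refine h1.trans_eq ?_
  simp only [Finset.sum_add_distrib]
  have h2 : ∑ k, ∑ l, J k l * p l ^ 2 / 2 = ∑ k, ∑ l, J k l * p k ^ 2 / 2 := by
    rw [Finset.sum_comm]
    exact Finset.sum_congr rfl fun k _ => Finset.sum_congr rfl fun l _ => by rw [hsymm]
  rw [h2, ← Finset.sum_add_distrib]
  refine Finset.sum_congr rfl fun k _ => ?_
  rw [Finset.sum_mul, ← Finset.sum_add_distrib]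
  exact Finset.sum_congr rfl fun l _ => by ring

lemma pairEnergy_neg (J : ι → ι → ℝ) (p : ι → ℝ) : pairEnergy J (-p) = pairEnergy J p := by
  simp [pairEnergy]

lemma pairEnergy_add_single [DecidableEq ι] {J : ι → ι → ℝ} (hsymm : ∀ k l, J k l = J l k)
    (p : ι → ℝ) (l : ι) (x : ℝ) : pairEnergy J (p + x • Pi.single l 1)
      = pairEnergy J p + 2 * x * ∑ k, J l k * p k + x ^ 2 * J l l := by
  have h2 : ∀ k, (p + x • (Pi.single l 1 : ι → ℝ)) k = p k + if k = l then x else 0 := by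
    intro k; simp [Pi.single_apply]
  have h3 : ∀ k m, J k m * (p k + if k = l then x else 0) * (p m + if m = l then x else 0)
      = J k m * p k * p m + (if m = l then x * (J k m * p k) else 0)
        + (if k = l then x * (J k m * p m) else 0)
        + (if k = l then (if m = l then x ^ 2 * J k m else 0) else 0) := by
    intro k m; split_ifs <;> ring
  simp only [pairEnergy, h2, h3, Finset.sum_add_distrib]
  have h4 : ∑ k, ∑ m, (if k = l then x * (J k m * p m) else 0) = x * ∑ m, J l m * p m := by
    rw [Finset.sum_comm, Finset.mul_sum]; simp
  have h5 : ∑ k, ∑ m, (if m = l then x * (J k m * p k) else 0) = x * ∑ m, J l m * p m := by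
    rw [Finset.mul_sum]
    simp [hsymm l]
  have h6 : ∑ k, ∑ m, (if k = l then (if m = l then x ^ 2 * J k m else 0) else 0)
      = x ^ 2 * J l l := by
    rw [Finset.sum_comm]; simp
  rw [h4, h5, h6]; ring

lemma continuous_pairEnergy (J : ι → ι → ℝ) : Continuous (pairEnergy J) := by
  unfold pairEnergy; fun_prop

omit [Fintype ι] in
lemma one_le_prod_one_add_sq (p : ι → ℝ) (A : Finset ι) : 1 ≤ ∏ k ∈ A, (1 + p k ^ 2) := by
  simpa using Finset.prod_le_prod (s := A) (f := fun _ => (1 : ℝ)) (fun k _ => zero_le_one)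
    fun k _ => le_add_of_nonneg_right (sq_nonneg (p k))

lemma one_add_sq_le_prod (p : ι → ℝ) (i : ι) : 1 + p i ^ 2 ≤ ∏ k, (1 + p k ^ 2) := by
  classical
  rw [← Finset.mul_prod_erase _ _ (Finset.mem_univ i)]
  have := one_le_prod_one_add_sq p (Finset.univ.erase i)
  nlinarith [sq_nonneg (p i)]

lemma abs_le_prod (p : ι → ℝ) (i : ι) : |p i| ≤ ∏ k, (1 + p k ^ 2) := by
  refine le_trans ?_ (one_add_sq_le_prod p i)
  nlinarith [sq_abs (p i), sq_nonneg (|p i| - 1)]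

lemma abs_mul_le_prod (p : ι → ℝ) (i j : ι) : |p i * p j| ≤ ∏ k, (1 + p k ^ 2) := by
  have h1 := one_add_sq_le_prod p i
  have h2 := one_add_sq_le_prod p j
  rw [abs_mul]
  nlinarith [sq_abs (p i), sq_abs (p j), sq_nonneg (|p i| - |p j|)]

/-- The unnormalized density `exp (∑ Jₖₗ pₖ pₗ) ∏ wₖ(pₖ)`. -/
noncomputable def spinDensity (J : ι → ι → ℝ) (w : ι → ℝ → ℝ) (p : ι → ℝ) : ℝ :=
  Real.exp (pairEnergy J p) * ∏ k, w k (p k)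

lemma continuous_spinDensity (J : ι → ι → ℝ) {w : ι → ℝ → ℝ} (hc : ∀ k, Continuous (w k)) :
    Continuous (spinDensity J w) := by
  unfold spinDensity
  have := continuous_pairEnergy J
  fun_prop

/-- A single-site weight that is integrable against `(1 + x ^ 2) * exp (r * x ^ 2)`; here `r`
is the total coupling of the site. -/
structure SiteWeight (r : ℝ) (w : ℝ → ℝ) : Prop where
  continuous : Continuous w
  pos : ∀ x, 0 < w x
  integrable : Integrable fun x => (1 + x ^ 2) * (Real.exp (r * x ^ 2) * w x)

/-- Since `2 pₖ pₗ ≤ pₖ ^ 2 + pₗ ^ 2`, the density is bounded by a product. -/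
lemma integrable_mul_spinDensity {J : ι → ι → ℝ} (hJ : ∀ k l, 0 ≤ J k l)
    (hsymm : ∀ k l, J k l = J l k) {w : ι → ℝ → ℝ} (hw : ∀ k, SiteWeight (∑ l, J k l) (w k))
    {f : (ι → ℝ) → ℝ} (hf : Continuous f) (hbound : ∀ p, |f p| ≤ ∏ k, (1 + p k ^ 2)) :
    Integrable fun p => f p * spinDensity J w p := by
  have h := Integrable.fintype_prod (μ := fun _ : ι => (volume : Measure ℝ))
    (fun k => (hw k).integrable)
  rw [← volume_pi] at h
  refine h.mono' ((hf.mul (continuous_spinDensity J fun k => (hw k).continuous)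
    ).aestronglyMeasurable) (Filter.Eventually.of_forall fun p => ?_)
  have hw0 : 0 ≤ ∏ k, w k (p k) := Finset.prod_nonneg fun k _ => ((hw k).pos _).le
  rw [Real.norm_eq_abs, abs_mul, Finset.prod_mul_distrib, Finset.prod_mul_distrib, spinDensity,
    abs_of_nonneg (mul_nonneg (Real.exp_pos _).le hw0), ← Real.exp_sum]
  refine mul_le_mul (hbound p) ?_ (mul_nonneg (Real.exp_pos _).le hw0)
    (Finset.prod_nonneg fun k _ => by positivity)
  exact mul_le_mul_of_nonneg_right (Real.exp_le_exp.2 (pairEnergy_le hJ hsymm p)) hw0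

lemma spinDensity_pos (J : ι → ι → ℝ) {w : ι → ℝ → ℝ} (hw : ∀ k x, 0 < w k x) (p : ι → ℝ) :
    0 < spinDensity J w p :=
  mul_pos (Real.exp_pos _) (Finset.prod_pos fun k _ => hw k _)

lemma integrable_spinDensity {J : ι → ι → ℝ} (hJ : ∀ k l, 0 ≤ J k l)
    (hsymm : ∀ k l, J k l = J l k) {w : ι → ℝ → ℝ} (hw : ∀ k, SiteWeight (∑ l, J k l) (w k)) :
    Integrable (spinDensity J w) := by
  simpa using integrable_mul_spinDensity hJ hsymm hw (f := fun _ => 1) continuous_const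
    fun p => by simpa using one_le_prod_one_add_sq p Finset.univ

lemma integral_spinDensity_pos {J : ι → ι → ℝ} (hJ : ∀ k l, 0 ≤ J k l)
    (hsymm : ∀ k l, J k l = J l k) {w : ι → ℝ → ℝ} (hw : ∀ k, SiteWeight (∑ l, J k l) (w k)) :
    0 < ∫ p, spinDensity J w p := by
  have hpos := spinDensity_pos J fun k => (hw k).pos
  rw [integral_pos_iff_support_of_nonneg (fun p => (hpos p).le)
    (integrable_spinDensity hJ hsymm hw)]
  have : Function.support (spinDensity J w) = Set.univ := by
    ext p; simp [(hpos p).ne']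
  rw [this]
  exact Measure.measure_univ_pos.2 (NeZero.ne _)

lemma integrable_gaussian_weight {δ t : ℝ} (hδ : 0 < δ) :
    Integrable fun x : ℝ => (1 + x ^ 2) * Real.exp (-δ * x ^ 2 + t * |x|) := by
  have h := (integrable_exp_neg_mul_sq (half_pos hδ)).const_mul
    ((1 + 4 / δ) * Real.exp (t ^ 2 / δ))
  refine h.mono' (by fun_prop) (Filter.Eventually.of_forall fun x => ?_)
  rw [Real.norm_of_nonneg (by positivity)]
  have h1 : 1 + x ^ 2 ≤ (1 + 4 / δ) * Real.exp (δ / 4 * x ^ 2) := by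
    have h2 : δ / 4 * x ^ 2 + 1 ≤ Real.exp (δ / 4 * x ^ 2) := Real.add_one_le_exp _
    have h3 : 1 + x ^ 2 ≤ (1 + 4 / δ) * (δ / 4 * x ^ 2 + 1) := by
      have : (1 + 4 / δ) * (δ / 4 * x ^ 2 + 1) = δ / 4 * x ^ 2 + 1 + x ^ 2 + 4 / δ := by
        field_simp; ring
      rw [this]
      have : 0 ≤ δ / 4 * x ^ 2 := by positivity
      have : 0 ≤ 4 / δ := by positivity
      linarith
    exact h3.trans (mul_le_mul_of_nonneg_left h2 (by positivity))
  have h4 : t * |x| ≤ δ / 4 * x ^ 2 + t ^ 2 / δ := by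
    have h5 : 0 ≤ (δ / 2 * |x| - t) ^ 2 / δ := by positivity
    have h6 : (δ / 2 * |x| - t) ^ 2 / δ = δ / 4 * x ^ 2 - t * |x| + t ^ 2 / δ := by
      rw [← sq_abs x]; field_simp; ring
    linarith
  calc (1 + x ^ 2) * Real.exp (-δ * x ^ 2 + t * |x|)
      ≤ ((1 + 4 / δ) * Real.exp (δ / 4 * x ^ 2))
          * Real.exp (-δ * x ^ 2 + (δ / 4 * x ^ 2 + t ^ 2 / δ)) := by
        gcongr
    _ = (1 + 4 / δ) * (Real.exp (δ / 4 * x ^ 2)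
          * Real.exp (-δ * x ^ 2 + (δ / 4 * x ^ 2 + t ^ 2 / δ))) := by ring
    _ = (1 + 4 / δ) * (Real.exp (t ^ 2 / δ) * Real.exp (-(δ / 2) * x ^ 2)) := by
        rw [← Real.exp_add, ← Real.exp_add]; congr 2; ring
    _ = _ := by ring

/-- Weights bounded by `D * exp (-a * x ^ 2 + t * |x|)` with `a > r` are admissible. -/
lemma SiteWeight.of_le {r a δ D t : ℝ} (hδ : 0 < δ) (ha : r + δ ≤ a) {w : ℝ → ℝ}
    (hc : Continuous w) (hpos : ∀ x, 0 < w x)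
    (hle : ∀ x, w x ≤ D * Real.exp (-a * x ^ 2 + t * |x|)) : SiteWeight r w := by
  refine ⟨hc, hpos, ?_⟩
  have hD : 0 ≤ D := by
    have h := (hpos 0).trans_le (hle 0)
    by_contra hneg
    push Not at hneg
    nlinarith [Real.exp_pos (-a * 0 ^ 2 + t * |0|)]
  refine ((integrable_gaussian_weight (t := t) hδ).const_mul D).mono' (by fun_prop)
    (Filter.Eventually.of_forall fun x => ?_)
  have := (hpos x).le
  rw [Real.norm_of_nonneg (by positivity)]
  calc (1 + x ^ 2) * (Real.exp (r * x ^ 2) * w x)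
      ≤ (1 + x ^ 2) * (Real.exp (r * x ^ 2) * (D * Real.exp (-a * x ^ 2 + t * |x|))) := by
        gcongr; exact hle x
    _ = D * ((1 + x ^ 2) * Real.exp (r * x ^ 2 + (-a * x ^ 2 + t * |x|))) := by
        rw [Real.exp_add (r * x ^ 2)]; ring
    _ ≤ D * ((1 + x ^ 2) * Real.exp (-δ * x ^ 2 + t * |x|)) := by
        have hx : r * x ^ 2 + (-a * x ^ 2 + t * |x|) ≤ -δ * x ^ 2 + t * |x| := by
          nlinarith [sq_nonneg x]
        have := Real.exp_le_exp.2 hx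
        gcongr

end

/-! ### Gaussian measures and their mixtures over sign configurations -/

section
variable {ι : Type*} [Fintype ι]

/-- The off-diagonal part `J` and the diagonal `a` of a symmetric diagonally dominant matrix with
gap `δ` and nonpositive off-diagonal entries `-J k l`. -/
structure DominantCoupling (a : ι → ℝ) (J : ι → ι → ℝ) (δ : ℝ) : Prop where
  gap_pos : 0 < δ
  nonneg : ∀ k l, 0 ≤ J k l
  symm : ∀ k l, J k l = J l k
  le : ∀ k, ∑ l, J k l + δ ≤ a k

namespace DominantCoupling
variable {a : ι → ℝ} {J : ι → ι → ℝ} {δ : ℝ} (h : DominantCoupling a J δ)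
include h

lemma diag_pos (k : ι) : 0 < a k := by
  have := h.le k
  have := h.gap_pos
  have := Finset.sum_nonneg fun l (_ : l ∈ Finset.univ) => h.nonneg k l
  linarith

/-- The minimum principle. -/
lemma nonneg_of_le {x : ι → ℝ} (hx : ∀ i, ∑ l, J i l * x l ≤ a i * x i) (i : ι) : 0 ≤ x i := by
  obtain ⟨m, _, hm⟩ := Finset.exists_min_image Finset.univ x ⟨i, Finset.mem_univ i⟩
  refine le_trans ?_ (hm i (Finset.mem_univ i))
  have h1 : (∑ l, J m l) * x m ≤ ∑ l, J m l * x l := by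
    rw [Finset.sum_mul]
    exact Finset.sum_le_sum fun l hl => mul_le_mul_of_nonneg_left (hm l hl) (h.nonneg _ _)
  have h2 := hx m
  have h3 := h.le m
  have h4 := h.gap_pos
  have h5 : 0 ≤ (a m - ∑ l, J m l) * x m := by linarith
  exact nonneg_of_mul_nonneg_right h5 (by linarith)

/-- The inverse of a symmetric diagonally dominant matrix with nonpositive off-diagonal entries is
symmetric and has nonnegative entries. -/
lemma exists_inverse [DecidableEq ι] : ∃ S : ι → ι → ℝ, (∀ i j, 0 ≤ S i j) ∧
    (∀ i j, S i j = S j i) ∧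
    ∀ i j, a i * S i j = ∑ l, J i l * S l j + if i = j then 1 else 0 := by
  set A : Matrix ι ι ℝ := Matrix.diagonal a - Matrix.of J with hA
  have hmul : ∀ (x : ι → ℝ) i, (A.mulVec x) i = a i * x i - ∑ l, J i l * x l := by
    intro x i
    rw [hA, Matrix.sub_mulVec, Pi.sub_apply, Matrix.mulVec_diagonal]
    rfl
  have hinj : Function.Injective A.mulVec := by
    intro x y hxy
    have hz : ∀ i, a i * x i - ∑ l, J i l * x l = a i * y i - ∑ l, J i l * y l := fun i => by
      rw [← hmul, ← hmul, hxy]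
    have h1 := h.nonneg_of_le (x := fun i => x i - y i) fun i => by
      simp only [mul_sub, Finset.sum_sub_distrib]; linarith [hz i]
    have h2 := h.nonneg_of_le (x := fun i => y i - x i) fun i => by
      simp only [mul_sub, Finset.sum_sub_distrib]; linarith [hz i]
    ext i
    linarith [h1 i, h2 i]
  have hunit : IsUnit A := Matrix.mulVec_injective_iff_isUnit.1 hinj
  have hdet : IsUnit A.det := (Matrix.isUnit_iff_isUnit_det A).1 hunit
  have hAS : ∀ i j, a i * A⁻¹ i j - ∑ l, J i l * A⁻¹ l j = if i = j then 1 else 0 := by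
    intro i j
    have h1 := congrFun (congrFun (Matrix.mul_nonsing_inv A hdet) i) j
    rw [Matrix.one_apply] at h1
    rw [← h1, ← hmul (fun l => A⁻¹ l j)]
    rfl
  have hAt : A.transpose = A := by
    ext i j
    by_cases hij : i = j
    · subst hij; rfl
    · simp [hA, Matrix.diagonal_apply_ne _ hij, Matrix.diagonal_apply_ne _ (Ne.symm hij),
        h.symm i j]
  refine ⟨fun i j => A⁻¹ i j, fun i j => ?_, fun i j => ?_, fun i j => ?_⟩
  · refine h.nonneg_of_le (x := fun l => A⁻¹ l j) (fun l => ?_) i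
    have h1 := hAS l j
    have h2 : (0 : ℝ) ≤ if l = j then 1 else 0 := by split_ifs <;> simp
    linarith
  · have h1 := Matrix.transpose_nonsing_inv A
    rw [hAt] at h1
    exact congrFun (congrFun h1 j) i
  · linarith [hAS i j]

end DominantCoupling

/-- The Gaussian single-site weights `exp (-aₖ x ^ 2 + tₖ x)`. -/
noncomputable def gaussWeight (a t : ι → ℝ) (k : ι) (x : ℝ) : ℝ := Real.exp (-a k * x ^ 2 + t k * x)

/-- The symmetric mixture `exp (-aₖ x ^ 2) cosh (b x)` of two Gaussian weights. -/
noncomputable def coshWeight (a : ι → ℝ) (b : ℝ) (k : ι) (x : ℝ) : ℝ :=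
  Real.exp (-a k * x ^ 2) * Real.cosh (b * x)

omit [Fintype ι] in
lemma continuous_gaussWeight (a t : ι → ℝ) (k : ι) : Continuous (gaussWeight a t k) := by
  unfold gaussWeight; fun_prop

section
variable {a : ι → ℝ} {J : ι → ι → ℝ} {δ : ℝ} (h : DominantCoupling a J δ)
include h

lemma siteWeight_gaussWeight (t : ι → ℝ) (k : ι) :
    SiteWeight (∑ l, J k l) (gaussWeight a t k) := by
  refine SiteWeight.of_le (D := 1) (t := |t k|) h.gap_pos (h.le k) (continuous_gaussWeight a t k)
    (fun x => Real.exp_pos _) fun x => ?_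
  rw [one_mul, gaussWeight]
  refine Real.exp_le_exp.2 (add_le_add_right ?_ _)
  rw [← abs_mul]
  exact le_abs_self _

lemma siteWeight_coshWeight (b : ℝ) (k : ι) : SiteWeight (∑ l, J k l) (coshWeight a b k) := by
  refine SiteWeight.of_le (D := 1) (t := |b|) h.gap_pos (h.le k)
    (by unfold coshWeight; fun_prop)
    (fun x => mul_pos (Real.exp_pos _) (Real.cosh_pos _)) fun x => ?_
  rw [one_mul, coshWeight, Real.exp_add, ← abs_mul]
  refine mul_le_mul_of_nonneg_left ?_ (Real.exp_pos _).le
  rw [← Real.cosh_abs, Real.cosh_eq]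
  have : Real.exp (-|b * x|) ≤ Real.exp |b * x| :=
    Real.exp_le_exp.2 (by linarith [abs_nonneg (b * x)])
  linarith

/-- Completing the square. -/
lemma spinDensity_gaussWeight_add {t m : ι → ℝ}
    (hm : ∀ k, 2 * (a k * m k) = 2 * ∑ l, J k l * m l + t k) (p : ι → ℝ) :
    spinDensity J (gaussWeight a t) (p + m)
      = Real.exp (∑ k, t k * m k / 2) * spinDensity J (gaussWeight a 0) p := by
  simp only [spinDensity, gaussWeight, ← Real.exp_sum, ← Real.exp_add]
  congr 1
  have e1 : pairEnergy J (p + m) = pairEnergy J p + 2 * ∑ k, p k * ∑ l, J k l * m l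
      + ∑ k, m k * ∑ l, J k l * m l := by
    have hcross : ∑ k, ∑ l, J k l * m k * p l = ∑ k, ∑ l, J k l * p k * m l := by
      rw [Finset.sum_comm]
      exact Finset.sum_congr rfl fun k _ => Finset.sum_congr rfl fun l _ => by
        rw [h.symm]; ring
    have : pairEnergy J (p + m) = pairEnergy J p + ∑ k, ∑ l, J k l * p k * m l
        + ∑ k, ∑ l, J k l * m k * p l + ∑ k, ∑ l, J k l * m k * m l := by
      simp only [pairEnergy, ← Finset.sum_add_distrib, Pi.add_apply]
      exact Finset.sum_congr rfl fun k _ => Finset.sum_congr rfl fun l _ => by ring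
    rw [this, hcross]
    have e2 : ∀ x : ι → ℝ, ∑ k, ∑ l, J k l * x k * m l = ∑ k, x k * ∑ l, J k l * m l := by
      intro x
      refine Finset.sum_congr rfl fun k _ => ?_
      rw [Finset.mul_sum]
      exact Finset.sum_congr rfl fun l _ => by ring
    rw [e2, e2]; ring
  rw [e1, Finset.mul_sum]
  have e3 : ∀ k, ∑ l, J k l * m l = a k * m k - t k / 2 := fun k => by linarith [hm k]
  simp only [e3]
  rw [add_assoc, add_assoc, add_comm (∑ k, t k * m k / 2), add_assoc]
  congr 1
  simp only [← Finset.sum_add_distrib]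
  refine Finset.sum_congr rfl fun k _ => ?_
  simp only [Pi.add_apply, Pi.zero_apply]
  ring

lemma integral_mul_gaussWeight {t m : ι → ℝ}
    (hm : ∀ k, 2 * (a k * m k) = 2 * ∑ l, J k l * m l + t k) (f : (ι → ℝ) → ℝ) :
    ∫ p, f p * spinDensity J (gaussWeight a t) p
      = Real.exp (∑ k, t k * m k / 2) * ∫ p, f (p + m) * spinDensity J (gaussWeight a 0) p := by
  rw [← integral_add_right_eq_self _ m, ← integral_const_mul]
  congr 1
  ext p
  rw [spinDensity_gaussWeight_add h hm]
  ring

omit h in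
lemma spinDensity_neg {w : ι → ℝ → ℝ} (hw : ∀ k x, w k (-x) = w k x) (p : ι → ℝ) :
    spinDensity J w (-p) = spinDensity J w p := by
  simp [spinDensity, pairEnergy_neg, hw]

omit h in
lemma integral_mul_spinDensity_eq_zero {w : ι → ℝ → ℝ} (hw : ∀ k x, w k (-x) = w k x)
    (i : ι) : ∫ p, p i * spinDensity J w p = 0 := by
  have h1 := integral_neg_eq_self (fun p : ι → ℝ => p i * spinDensity J w p) volume
  simp only [spinDensity_neg hw, Pi.neg_apply, neg_mul] at h1
  rw [integral_neg] at h1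
  linarith

/-- The derivative of the centred Gaussian density. -/
lemma hasLineDerivAt_gauss [DecidableEq ι] (p : ι → ℝ) (l : ι) :
    HasLineDerivAt ℝ (spinDensity J (gaussWeight a 0))
      ((2 * ∑ k, J l k * p k - 2 * (a l * p l)) * spinDensity J (gaussWeight a 0) p) p
      (Pi.single l 1) := by
  unfold HasLineDerivAt
  have hE : ∀ x : ℝ, spinDensity J (gaussWeight a 0) (p + x • Pi.single l 1)
      = spinDensity J (gaussWeight a 0) p
        * Real.exp (x * (2 * ∑ k, J l k * p k - 2 * (a l * p l)) + x ^ 2 * (J l l - a l)) := by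
    intro x
    simp only [spinDensity, gaussWeight, ← Real.exp_sum, ← Real.exp_add]
    congr 1
    have e2 : ∑ k, (-a k * (p + x • (Pi.single l 1 : ι → ℝ)) k ^ 2
        + (0 : ι → ℝ) k * (p + x • (Pi.single l 1 : ι → ℝ)) k)
        = ∑ k, (-a k * p k ^ 2 + (0 : ι → ℝ) k * p k) - 2 * x * (a l * p l) - x ^ 2 * a l := by
      have h2 : ∀ k, -a k * (p + x • (Pi.single l 1 : ι → ℝ)) k ^ 2
          + (0 : ι → ℝ) k * (p + x • (Pi.single l 1 : ι → ℝ)) k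
          = (-a k * p k ^ 2 + (0 : ι → ℝ) k * p k)
            + if k = l then (- (2 * x * (a k * p k)) - x ^ 2 * a k) else 0 := by
        intro k
        simp only [Pi.add_apply, Pi.smul_apply, Pi.single_apply, smul_eq_mul, Pi.zero_apply]
        split_ifs <;> ring
      simp only [h2, Finset.sum_add_distrib]
      simp
      ring
    rw [pairEnergy_add_single h.symm, e2]; ring
  simp only [hE]
  have hd : HasDerivAt (fun x : ℝ => x * (2 * ∑ k, J l k * p k - 2 * (a l * p l))
      + x ^ 2 * (J l l - a l)) (2 * ∑ k, J l k * p k - 2 * (a l * p l)) 0 := by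
    have h1 := ((hasDerivAt_id (0 : ℝ)).mul_const (2 * ∑ k, J l k * p k - 2 * (a l * p l))).add
      (((hasDerivAt_id (0 : ℝ)).pow 2).mul_const (J l l - a l))
    exact h1.congr_deriv (by simp)
  have h2 := (hd.exp).const_mul (spinDensity J (gaussWeight a 0) p)
  refine h2.congr_deriv ?_
  rw [zero_mul, zero_pow two_ne_zero, zero_mul, add_zero, Real.exp_zero]
  ring

/-- The covariance of a centred Gaussian measure solves the linear system of its Hamiltonian. -/
lemma gauss_covariance_system [DecidableEq ι] (l j : ι) :
    2 * (a l * ∫ p, p l * p j * spinDensity J (gaussWeight a 0) p)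
      = 2 * ∑ k, (J l k * ∫ p, p k * p j * spinDensity J (gaussWeight a 0) p)
        + (if l = j then 1 else 0) * ∫ p, spinDensity J (gaussWeight a 0) p := by
  set D := spinDensity J (gaussWeight a 0) with hD
  have hw := siteWeight_gaussWeight h 0
  have i2 : ∀ k m : ι, Integrable fun p => p k * p m * D p := fun k m =>
    integrable_mul_spinDensity h.nonneg h.symm hw (by fun_prop) fun p => abs_mul_le_prod p k m
  have i1 : Integrable fun p => p j * D p :=
    integrable_mul_spinDensity h.nonneg h.symm hw (by fun_prop) fun p => abs_le_prod p j
  have i0 : Integrable D := integrable_spinDensity h.nonneg h.symm hw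
  have hexp : ∀ p : ι → ℝ, p j * ((2 * ∑ k, J l k * p k - 2 * (a l * p l)) * D p)
      = 2 * ∑ k, J l k * (p k * p j * D p) - 2 * (a l * (p l * p j * D p)) := by
    intro p
    have : ∑ k, J l k * (p k * p j * D p) = (∑ k, J l k * p k) * (p j * D p) := by
      rw [Finset.sum_mul]; exact Finset.sum_congr rfl fun k _ => by ring
    rw [this]; ring
  have is : Integrable fun p : ι → ℝ => 2 * ∑ k, J l k * (p k * p j * D p) :=
    (integrable_finsetSum _ fun k _ => (i2 k j).const_mul _).const_mul _
  have ia : Integrable fun p : ι → ℝ => 2 * (a l * (p l * p j * D p)) :=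
    ((i2 l j).const_mul _).const_mul _
  have hibp := integral_bilinear_hasLineDerivAt_right_eq_neg_left_of_integrable
    (μ := (volume : Measure (ι → ℝ))) (f := fun p : ι → ℝ => p j)
    (f' := fun _ => if l = j then 1 else 0) (g := D)
    (g' := fun p => (2 * ∑ k, J l k * p k - 2 * (a l * p l)) * D p) (v := Pi.single l 1)
    (B := ContinuousLinearMap.mul ℝ ℝ)
    (by simpa only [ContinuousLinearMap.mul_apply'] using i0.const_mul (if l = j then (1 : ℝ) else 0))
    (by
      simp only [ContinuousLinearMap.mul_apply', hexp]
      exact is.sub ia)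
    (by simpa using i1)
    (by
      intro p _
      unfold HasLineDerivAt
      have : ∀ x : ℝ, (p + x • (Pi.single l 1 : ι → ℝ)) j = p j + x * if l = j then 1 else 0 := by
        intro x; simp [Pi.single_apply, eq_comm]
      simp only [this]
      simpa only [one_mul, id] using
        ((hasDerivAt_id (0 : ℝ)).mul_const (if l = j then (1 : ℝ) else 0)).const_add (p j))
    (by intro p _; exact hasLineDerivAt_gauss h p l)
  simp only [ContinuousLinearMap.mul_apply', hexp] at hibp
  rw [integral_sub is ia, integral_const_mul, integral_const_mul, integral_const_mul,
    integral_finsetSum _ fun k _ => (i2 k j).const_mul _, integral_const_mul] at hibp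
  simp only [integral_const_mul] at hibp
  linarith

/-- The covariance matrix of a centred Gaussian measure is half the inverse of the matrix of its
Hamiltonian. -/
lemma gauss_covariance [DecidableEq ι] {S : ι → ι → ℝ}
    (hS : ∀ i j, a i * S i j = ∑ l, J i l * S l j + if i = j then 1 else 0) (i j : ι) :
    ∫ p, p i * p j * spinDensity J (gaussWeight a 0) p
      = S i j / 2 * ∫ p, spinDensity J (gaussWeight a 0) p := by
  -- both sides solve the same uniquely solvable linear system in `i`
  set C : ι → ℝ := fun i => ∫ p, p i * p j * spinDensity J (gaussWeight a 0) p with hC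
  set Z := ∫ p, spinDensity J (gaussWeight a 0) p with hZ
  have h1 : ∀ i, a i * C i = ∑ k, J i k * C k + (if i = j then 1 else 0) * (Z / 2) := fun i => by
    have := gauss_covariance_system h i j
    simp only [hC, hZ]
    linarith
  have h2 : ∀ i, a i * (S i j / 2 * Z) = ∑ k, J i k * (S k j / 2 * Z)
      + (if i = j then 1 else 0) * (Z / 2) := fun i => by
    have e : ∑ k, J i k * (S k j / 2 * Z) = (∑ k, J i k * S k j) * (Z / 2) := by
      rw [Finset.sum_mul]; exact Finset.sum_congr rfl fun k _ => by ring
    rw [e]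
    linear_combination (Z / 2) * hS i j
  have h3 := h.nonneg_of_le (x := fun i => C i - S i j / 2 * Z) fun i => by
    simp only [mul_sub, Finset.sum_sub_distrib]; linarith [h1 i, h2 i]
  have h4 := h.nonneg_of_le (x := fun i => S i j / 2 * Z - C i) fun i => by
    simp only [mul_sub, Finset.sum_sub_distrib]; linarith [h1 i, h2 i]
  have := h3 i
  have := h4 i
  linarith

end

end

section
variable {ι : Type*} [Fintype ι]

lemma spinDensity_coshWeight [DecidableEq ι] (J : ι → ι → ℝ) (a : ι → ℝ) (b : ℝ) (p : ι → ℝ) :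
    spinDensity J (coshWeight a b) p
      = (1 / 2) ^ Fintype.card ι * ∑ σ : ι → ℤˣ, spinDensity J (gaussWeight a (b • spinVec σ)) p := by
  have h1 : ∀ k, coshWeight a b k (p k)
      = ∑ u : ℤˣ, 1 / 2 * Real.exp (-a k * p k ^ 2 + b * spin u * p k) := by
    intro k
    rw [sum_units, coshWeight, Real.cosh_eq, spin_neg, spin_one, Real.exp_add, Real.exp_add]
    have : b * -1 * p k = -(b * p k) := by ring
    rw [this, mul_one]
    ring
  have h2 := Finset.prod_univ_sum (fun _ : ι => (Finset.univ : Finset ℤˣ))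
    (fun k u => 1 / 2 * Real.exp (-a k * p k ^ 2 + b * spin u * p k))
  rw [Fintype.piFinset_univ] at h2
  simp only [spinDensity, h1]
  rw [h2, ← Finset.mul_sum, mul_left_comm]
  congr 1
  rw [Finset.mul_sum]
  refine Finset.sum_congr rfl fun σ _ => ?_
  rw [Finset.prod_mul_distrib, Finset.prod_const, Finset.card_univ]
  rfl

variable {a : ι → ℝ} {J : ι → ι → ℝ} {δ : ℝ} (h : DominantCoupling a J δ)
include h

/-- Integrating out the Gaussian variables leaves an Ising model whose couplings are proportional
to the inverse matrix `S`. -/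
lemma coshWeight_correlation_le [DecidableEq ι] {S : ι → ι → ℝ} (hS0 : ∀ i j, 0 ≤ S i j)
    (hSsymm : ∀ i j, S i j = S j i)
    (hS : ∀ i j, a i * S i j = ∑ l, J i l * S l j + if i = j then 1 else 0) (b : ℝ) (i j : ι) :
    ∫ p, p i * p j * spinDensity J (coshWeight a b) p
      ≤ (S i j / 2 + b ^ 2 / 4 * ∑ k, ∑ l, S i k
          * pairConn (edgeProb fun e : ι × ι => 2 * (b ^ 2 / 4 * S e.1 e.2)) k l * S l j)
        * ∫ p, spinDensity J (coshWeight a b) p := by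
  set c : ι → ι → ℝ := fun k l => b ^ 2 / 4 * S k l
  have hc : ∀ k l, 0 ≤ c k l := fun k l => mul_nonneg (by positivity) (hS0 k l)
  -- the centre of the Gaussian measure with linear terms `b σₖ`
  let m : (ι → ℤˣ) → ι → ℝ := fun σ k => b / 2 * ∑ l, S k l * spin (σ l)
  have hm : ∀ σ k, 2 * (a k * m σ k) = 2 * ∑ l, J k l * m σ l + (b • spinVec σ) k := by
    intro σ k
    have e1 : a k * ∑ l, S k l * spin (σ l)
        = ∑ n, J k n * ∑ l, S n l * spin (σ l) + spin (σ k) := by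
      have : ∀ l, a k * (S k l * spin (σ l))
          = ∑ n, J k n * (S n l * spin (σ l)) + if k = l then spin (σ l) else 0 := by
        intro l
        rw [← mul_assoc, hS, add_mul, Finset.sum_mul, ite_mul, one_mul, zero_mul]
        congr 1
        exact Finset.sum_congr rfl fun n _ => by ring
      rw [Finset.mul_sum, Finset.sum_congr rfl fun l _ => this l, Finset.sum_add_distrib,
        Finset.sum_comm]
      simp [Finset.mul_sum]
    have e2 : ∑ l, J k l * m σ l = b / 2 * ∑ n, J k n * ∑ l, S n l * spin (σ l) := by
      rw [Finset.mul_sum]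
      exact Finset.sum_congr rfl fun n _ => by simp only [m]; ring
    rw [e2]
    simp only [m, Pi.smul_apply, smul_eq_mul, spinVec]
    linear_combination b * e1
  have hexp : ∀ σ : ι → ℤˣ, ∑ k, (b • spinVec σ) k * m σ k / 2 = pairEnergy c (spinVec σ) := by
    intro σ
    refine Finset.sum_congr rfl fun k _ => ?_
    simp only [m, c, Pi.smul_apply, smul_eq_mul, spinVec]
    rw [Finset.mul_sum, Finset.mul_sum, Finset.sum_div]
    exact Finset.sum_congr rfl fun l _ => by ring
  set Z₀ := ∫ p, spinDensity J (gaussWeight a 0) p with hZ₀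
  have hw0 := siteWeight_gaussWeight h 0
  have hZ₀pos : 0 < Z₀ := integral_spinDensity_pos h.nonneg h.symm hw0
  have i2 : ∀ t, Integrable fun p => p i * p j * spinDensity J (gaussWeight a t) p := fun t =>
    integrable_mul_spinDensity h.nonneg h.symm (siteWeight_gaussWeight h t) (by fun_prop)
      fun p => abs_mul_le_prod p i j
  have i1 : ∀ k, Integrable fun p => p k * spinDensity J (gaussWeight a 0) p := fun k =>
    integrable_mul_spinDensity h.nonneg h.symm hw0 (by fun_prop) fun p => abs_le_prod p k
  have i0 : ∀ t, Integrable (spinDensity J (gaussWeight a t)) := fun t =>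
    integrable_spinDensity h.nonneg h.symm (siteWeight_gaussWeight h t)
  have hodd : ∀ k, ∫ p, p k * spinDensity J (gaussWeight a 0) p = 0 := fun k =>
    integral_mul_spinDensity_eq_zero (fun k x => by simp [gaussWeight]) k
  have hN : ∀ σ, ∫ p, p i * p j * spinDensity J (gaussWeight a (b • spinVec σ)) p
      = Real.exp (pairEnergy c (spinVec σ)) * ((S i j / 2 + m σ i * m σ j) * Z₀) := by
    intro σ
    rw [integral_mul_gaussWeight h (hm σ) (fun p => p i * p j), hexp]
    congr 1
    have e : ∀ p : ι → ℝ, (p + m σ) i * (p + m σ) j * spinDensity J (gaussWeight a 0) p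
        = p i * p j * spinDensity J (gaussWeight a 0) p
          + (m σ j * (p i * spinDensity J (gaussWeight a 0) p)
          + (m σ i * (p j * spinDensity J (gaussWeight a 0) p)
          + m σ i * m σ j * spinDensity J (gaussWeight a 0) p)) := by
      intro p; simp only [Pi.add_apply]; ring
    simp only [e]
    have iA : Integrable fun p => m σ i * m σ j * spinDensity J (gaussWeight a 0) p :=
      (i0 0).const_mul _
    have iB : Integrable fun p => m σ i * (p j * spinDensity J (gaussWeight a 0) p)
        + m σ i * m σ j * spinDensity J (gaussWeight a 0) p := ((i1 j).const_mul _).add iA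
    have iC : Integrable fun p => m σ j * (p i * spinDensity J (gaussWeight a 0) p)
        + (m σ i * (p j * spinDensity J (gaussWeight a 0) p)
          + m σ i * m σ j * spinDensity J (gaussWeight a 0) p) := ((i1 i).const_mul _).add iB
    rw [integral_add (i2 0) iC, integral_add ((i1 i).const_mul _) iB,
      integral_add ((i1 j).const_mul _) iA, integral_const_mul,
      integral_const_mul, integral_const_mul, hodd, hodd, gauss_covariance h hS]
    ring
  have hZ : ∀ σ, ∫ p, spinDensity J (gaussWeight a (b • spinVec σ)) p
      = Real.exp (pairEnergy c (spinVec σ)) * Z₀ := by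
    intro σ
    have := integral_mul_gaussWeight h (hm σ) (fun _ => 1)
    simpa only [one_mul, hexp] using this
  have eN : ∫ p, p i * p j * spinDensity J (coshWeight a b) p
      = (1 / 2) ^ Fintype.card ι * ∑ σ, Real.exp (pairEnergy c (spinVec σ))
        * ((S i j / 2 + m σ i * m σ j) * Z₀) := by
    simp only [spinDensity_coshWeight, ← hN]
    rw [← integral_finsetSum _ fun σ _ => i2 _, ← integral_const_mul]
    congr 1
    ext p
    rw [mul_left_comm, Finset.mul_sum]
  have eZ : ∫ p, spinDensity J (coshWeight a b) p
      = (1 / 2) ^ Fintype.card ι * ∑ σ, Real.exp (pairEnergy c (spinVec σ)) * Z₀ := by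
    simp only [spinDensity_coshWeight, ← hZ]
    rw [← integral_finsetSum _ fun σ _ => i0 _, ← integral_const_mul]
  rw [eN, eZ, mul_left_comm]
  refine mul_le_mul_of_nonneg_left ?_ (by positivity)
  rw [← Finset.sum_mul]
  have hsplit : ∑ σ, Real.exp (pairEnergy c (spinVec σ)) * ((S i j / 2 + m σ i * m σ j) * Z₀)
      = (S i j / 2 * ∑ σ, Real.exp (pairEnergy c (spinVec σ))
        + b ^ 2 / 4 * ∑ k, ∑ l, S i k * (∑ σ, spin (σ k) * spin (σ l)
            * Real.exp (pairEnergy c (spinVec σ))) * S l j) * Z₀ := by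
    have e1 : ∑ k, ∑ l, S i k * (∑ σ, spin (σ k) * spin (σ l)
        * Real.exp (pairEnergy c (spinVec σ))) * S l j
        = ∑ σ, Real.exp (pairEnergy c (spinVec σ))
          * ((∑ k, S i k * spin (σ k)) * ∑ l, S j l * spin (σ l)) := by
      rw [Finset.sum_comm]
      simp only [Finset.mul_sum, Finset.sum_mul]
      conv_rhs => rw [Finset.sum_comm]
      refine Finset.sum_congr rfl fun k _ => ?_
      conv_rhs => rw [Finset.sum_comm]
      refine Finset.sum_congr rfl fun l _ => Finset.sum_congr rfl fun σ _ => ?_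
      rw [hSsymm k j]; ring
    rw [e1, Finset.mul_sum, Finset.mul_sum, ← Finset.sum_add_distrib, Finset.sum_mul]
    refine Finset.sum_congr rfl fun σ _ => ?_
    simp only [m]; ring
  rw [hsplit, ← mul_assoc]
  refine mul_le_mul_of_nonneg_right ?_ hZ₀pos.le
  rw [add_mul, mul_assoc (b ^ 2 / 4)]
  refine add_le_add le_rfl (mul_le_mul_of_nonneg_left ?_ (by positivity))
  rw [Finset.sum_mul]
  refine Finset.sum_le_sum fun k _ => ?_
  rw [Finset.sum_mul]
  refine Finset.sum_le_sum fun l _ => ?_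
  have h1 := mul_le_mul_of_nonneg_right (mul_le_mul_of_nonneg_left (ising_le_pairConn hc k l)
    (hS0 i k)) (hS0 l j)
  refine h1.trans_eq ?_
  ring

end

/-! ### Decay of correlations of the Gaussian mixture -/

/-- The inverse of a diagonally dominant matrix with couplings of decay order `s` has the same
decay. -/
theorem exists_inverse_decay {δ K s : ℝ} (hδ : 0 < δ) (hK : 0 < K) (hs : 1 < s) :
    ∃ C : ℝ, 0 ≤ C ∧ ∀ {ι : Type} [Fintype ι] [DecidableEq ι] (pos : ι → ℤ),
      Function.Injective pos → ∀ (a : ι → ℝ) (J : ι → ι → ℝ), DominantCoupling a J δ →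
      (∀ k, a k ≤ K) → (∀ k l, J k l ≤ K / decayWeight s (pos k) (pos l)) →
      ∀ S : ι → ι → ℝ, (∀ i j, 0 ≤ S i j) → (∀ i j, S i j = S j i) →
      (∀ i j, a i * S i j = ∑ l, J i l * S l j + if i = j then 1 else 0) →
      ∀ i j, S i j ≤ C / decayWeight s (pos i) (pos j) := by
  obtain ⟨C, hC0, hC⟩ := decay_of_contraction (s := s) (η := 1 - δ / K) (C₁ := K / δ)
    (C₂ := 1 / δ) hs (by have : 0 < δ / K := by positivity
                         linarith) (by positivity) (by positivity)
  refine ⟨C, hC0, ?_⟩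
  intro ι _ _ pos hpos a J h haK hJ S hS0 hSsymm hS
  have hpa := h.diag_pos
  have hδa : ∀ k, δ ≤ a k := fun k => by
    have := h.le k
    have := Finset.sum_nonneg fun l (_ : l ∈ Finset.univ) => h.nonneg k l
    linarith
  refine hC pos hpos S (fun i l => J i l / a i) hS0 hSsymm
    (fun i l => div_nonneg (h.nonneg i l) (hpa i).le) ?_ ?_ ?_
  · intro i
    rw [← Finset.sum_div, div_le_iff₀ (hpa i)]
    have h1 : δ / K * a i ≤ δ := by
      rw [div_mul_eq_mul_div, div_le_iff₀ hK]
      exact mul_le_mul_of_nonneg_left (haK i) hδ.le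
    linarith [h.le i]
  · intro i l
    have hw := decayWeight_pos s (pos i) (pos l)
    calc J i l / a i ≤ (K / decayWeight s (pos i) (pos l)) / δ :=
          div_le_div₀ (by positivity) (hJ i l) hδ (hδa i)
      _ = _ := by ring
  · intro i j
    have hw := decayWeight_pos s (pos i) (pos j)
    have e : S i j = ∑ l, J i l / a i * S l j + (if i = j then 1 else 0) / a i := by
      have h1 : S i j = (a i * S i j) / a i := by field_simp [(hpa i).ne']
      rw [h1, hS, add_div, Finset.sum_div]
      congr 1
      exact Finset.sum_congr rfl fun l _ => by ring
    conv_lhs => rw [e]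
    refine add_le_add le_rfl ?_
    split_ifs with hij
    · subst hij
      have : decayWeight s (pos i) (pos i) = 1 := by
        simp [decayWeight, Real.zero_rpow (by linarith : s ≠ 0)]
      rw [this, div_one]
      exact one_div_le_one_div_of_le hδ (hδa i)
    · rw [zero_div]; positivity

/-- Decay of correlations of order `s > 2` for the ferromagnetic measures with single-site weights
`exp (-aₖ x ^ 2) cosh (b x)`. -/
theorem exists_coshWeight_decay {δ K s : ℝ} (b : ℝ) (hδ : 0 < δ) (hK : 0 < K) (hs : 2 < s) :
    ∃ C : ℝ, 0 ≤ C ∧ ∀ {ι : Type} [Fintype ι] [DecidableEq ι] (pos : ι → ℤ),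
      Function.Injective pos → ∀ (a : ι → ℝ) (J : ι → ι → ℝ), DominantCoupling a J δ →
      (∀ k, a k ≤ K) → (∀ k l, J k l ≤ K / decayWeight s (pos k) (pos l)) →
      ∀ i j, ∫ p, p i * p j * spinDensity J (coshWeight a b) p
        ≤ C / decayWeight s (pos i) (pos j) * ∫ p, spinDensity J (coshWeight a b) p := by
  obtain ⟨C₁, hC₁0, hC₁⟩ := exists_inverse_decay hδ hK (by linarith : 1 < s)
  obtain ⟨C₂, hC₂0, hC₂⟩ := exists_pairConn_decay (c := 2 * (b ^ 2 / 4 * C₁)) (by positivity) hs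
  set D := 2 * 2 ^ s * decaySum s
  have hD : 0 ≤ D := mul_nonneg (by positivity) (decaySum_nonneg s)
  refine ⟨C₁ / 2 + b ^ 2 / 4 * (C₁ * C₂ * C₁ * D * D), by positivity, ?_⟩
  intro ι _ _ pos hpos a J h haK hJ i j
  obtain ⟨S, hS0, hSsymm, hS⟩ := h.exists_inverse
  have hSd := hC₁ pos hpos a J h haK hJ S hS0 hSsymm hS
  refine (coshWeight_correlation_le h hS0 hSsymm hS b i j).trans ?_
  have hZ := integral_spinDensity_pos h.nonneg h.symm (siteWeight_coshWeight h b)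
  refine mul_le_mul_of_nonneg_right ?_ hZ.le
  set Θ := pairConn (edgeProb fun e : ι × ι => 2 * (b ^ 2 / 4 * S e.1 e.2))
  have hΘ : ∀ k l, Θ k l ≤ C₂ / decayWeight s (pos k) (pos l) :=
    hC₂ pos hpos _ (fun e => mul_nonneg zero_le_two (mul_nonneg (by positivity) (hS0 _ _)))
      fun k l => by
        have := mul_le_mul_of_nonneg_left (hSd k l) (by positivity : 0 ≤ 2 * (b ^ 2 / 4))
        calc 2 * (b ^ 2 / 4 * S k l) = 2 * (b ^ 2 / 4) * S k l := by ring
          _ ≤ _ := this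
          _ = _ := by ring
  have hw : ∀ k l : ι, 0 < decayWeight s (pos k) (pos l) := fun k l => decayWeight_pos _ _ _
  have hconv : ∑ k, ∑ l, S i k * Θ k l * S l j
      ≤ C₁ * C₂ * C₁ * D * D / decayWeight s (pos i) (pos j) := by
    calc ∑ k, ∑ l, S i k * Θ k l * S l j
        ≤ ∑ k, ∑ l, C₁ * C₂ * C₁ * ((1 / decayWeight s (pos i) (pos k))
            * ((1 / decayWeight s (pos k) (pos l)) * (1 / decayWeight s (pos l) (pos j)))) := by
          refine Finset.sum_le_sum fun k _ => Finset.sum_le_sum fun l _ => ?_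
          have h1 := hw i k
          have h2 := hw k l
          have h3 := hw l j
          calc S i k * Θ k l * S l j ≤ S i k * (C₂ / decayWeight s (pos k) (pos l)) * S l j :=
                mul_le_mul_of_nonneg_right (mul_le_mul_of_nonneg_left (hΘ k l) (hS0 _ _)) (hS0 _ _)
            _ ≤ (C₁ / decayWeight s (pos i) (pos k)) * (C₂ / decayWeight s (pos k) (pos l))
                * (C₁ / decayWeight s (pos l) (pos j)) := by
              refine mul_le_mul (mul_le_mul_of_nonneg_right (hSd i k) (by positivity)) (hSd l j)
                (hS0 _ _) (by positivity)
            _ = _ := by ring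
      _ = C₁ * C₂ * C₁ * ∑ k, (1 / decayWeight s (pos i) (pos k))
            * ∑ l, (1 / decayWeight s (pos k) (pos l)) * (1 / decayWeight s (pos l) (pos j)) := by
          simp only [Finset.mul_sum]
      _ ≤ C₁ * C₂ * C₁ * ∑ k, (1 / decayWeight s (pos i) (pos k))
            * (D / decayWeight s (pos k) (pos j)) := by
          refine mul_le_mul_of_nonneg_left (Finset.sum_le_sum fun k _ => ?_) (by positivity)
          have h1 := hw i k
          exact mul_le_mul_of_nonneg_left (sum_decay_mul_decay_le hpos (by linarith) _ _)
            (by positivity)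
      _ = C₁ * C₂ * C₁ * D * ∑ k, (1 / decayWeight s (pos i) (pos k))
            * (1 / decayWeight s (pos k) (pos j)) := by
          rw [mul_assoc _ D, Finset.mul_sum _ _ D]
          congr 1
          exact Finset.sum_congr rfl fun k _ => by ring
      _ ≤ C₁ * C₂ * C₁ * D * (D / decayWeight s (pos i) (pos j)) :=
          mul_le_mul_of_nonneg_left (sum_decay_mul_decay_le hpos (by linarith) _ _)
            (by positivity)
      _ = _ := by ring
  calc S i j / 2 + b ^ 2 / 4 * ∑ k, ∑ l, S i k * Θ k l * S l j
      ≤ C₁ / decayWeight s (pos i) (pos j) / 2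
        + b ^ 2 / 4 * (C₁ * C₂ * C₁ * D * D / decayWeight s (pos i) (pos j)) := by
        refine add_le_add ?_ (mul_le_mul_of_nonneg_left hconv (by positivity))
        have := hSd i j
        linarith
    _ = _ := by ring

/-! ### Comparison of single-site weights -/

/-- `w'` dominates `w`: if a function has mean zero under `w` and is nondecreasing in `|x|` where
it is nonnegative, then its mean under `w'` is nonnegative. -/
def SpinDominated (w w' : ℝ → ℝ) : Prop :=
  ∀ f : ℝ → ℝ, (∀ x y, |x| ≤ |y| → 0 ≤ f x → f x ≤ f y) →
    Integrable (fun x => f x * w x) → Integrable (fun x => f x * w' x) →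
    ∫ x, f x * w x = 0 → 0 ≤ ∫ x, f x * w' x

lemma integral_nonneg_of_crossing {f w ρ : ℝ → ℝ} (hw : ∀ x, 0 < w x) (hρ : ∀ x, 0 ≤ ρ x)
    (hC : ∀ x y, f x < 0 → 0 < f y → ρ x ≤ ρ y) (hi : Integrable fun x => f x * w x)
    (hi' : Integrable fun x => f x * (ρ x * w x)) (h0 : ∫ x, f x * w x = 0) :
    0 ≤ ∫ x, f x * (ρ x * w x) := by
  by_cases hne : ∃ y, 0 < f y
  · -- `κ` separates the values of `ρ` where `f < 0` from those where `f > 0`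
    set κ := sInf (ρ '' {y | 0 < f y})
    have hbdd : BddBelow (ρ '' {y | 0 < f y}) := ⟨0, by rintro _ ⟨y, _, rfl⟩; exact hρ y⟩
    have h1 : ∀ y, 0 < f y → κ ≤ ρ y := fun y hy => csInf_le hbdd ⟨y, hy, rfl⟩
    have h2 : ∀ x, f x < 0 → ρ x ≤ κ := fun x hx => by
      obtain ⟨y, hy⟩ := hne
      refine le_csInf ⟨_, y, hy, rfl⟩ ?_
      rintro _ ⟨z, hz, rfl⟩
      exact hC x z hx hz
    have h3 : ∫ x, κ * (f x * w x) ≤ ∫ x, f x * (ρ x * w x) := by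
      refine integral_mono (hi.const_mul κ) hi' fun x => ?_
      have hwx := hw x
      rcases lt_trichotomy (f x) 0 with h | h | h
      · have := h2 x h
        have : 0 ≤ (-f x) * (κ - ρ x) * w x := by
          refine mul_nonneg (mul_nonneg (by linarith) (by linarith)) hwx.le
        simp only []; nlinarith
      · simp [h]
      · have := h1 x h
        have : 0 ≤ f x * (ρ x - κ) * w x :=
          mul_nonneg (mul_nonneg h.le (by linarith)) hwx.le
        simp only []; nlinarith
    rw [integral_const_mul, h0, mul_zero] at h3
    exact h3
  · push Not at hne
    have h1 : (fun x => -(f x * w x)) =ᵐ[volume] 0 := by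
      refine (integral_eq_zero_iff_of_nonneg (f := fun x => -(f x * w x)) (fun x => ?_) hi.neg).1 ?_
      · have := mul_nonneg (neg_nonneg.2 (hne x)) (hw x).le
        simp only [Pi.zero_apply]; linarith
      · rw [integral_neg, h0, neg_zero]
    have h2 : ∫ x, f x * (ρ x * w x) = 0 := by
      refine integral_eq_zero_of_ae ?_
      filter_upwards [h1] with x hx
      simp only [Pi.zero_apply, neg_eq_zero, mul_eq_zero, (hw x).ne', or_false] at hx
      simp [hx]
    exact h2.ge

/-- A weight dominates another one if their ratio is nondecreasing in `|x|`. -/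
lemma SpinDominated.of_ratio {w ρ : ℝ → ℝ} (hw : ∀ x, 0 < w x) (hρ : ∀ x, 0 ≤ ρ x)
    (hmono : ∀ x y, |x| ≤ |y| → ρ x ≤ ρ y) : SpinDominated w (fun x => ρ x * w x) := by
  intro f hf hi hi' h0
  refine integral_nonneg_of_crossing hw hρ (fun x y hx hy => ?_) hi hi' h0
  refine hmono x y ?_
  by_contra hlt
  push Not at hlt
  linarith [hf y x hlt.le hy.le]

lemma integrable_exp_quadratic {a : ℝ} (ha : 0 < a) (c : ℝ) :
    Integrable fun x : ℝ => Real.exp (-a * x ^ 2 + c * x) := by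
  have h := ((integrable_exp_neg_mul_sq ha).comp_sub_right (c / (2 * a))).const_mul
    (Real.exp (c ^ 2 / (4 * a)))
  refine h.congr (Filter.Eventually.of_forall fun x => ?_)
  simp only []
  rw [← Real.exp_add]
  congr 1
  field_simp
  ring

lemma integral_exp_quadratic {a : ℝ} (ha : 0 < a) (c : ℝ) :
    ∫ x : ℝ, Real.exp (-a * x ^ 2 + c * x)
      = Real.exp (c ^ 2 / (4 * a)) * ∫ x : ℝ, Real.exp (-a * x ^ 2) := by
  rw [← integral_sub_right_eq_self (fun x : ℝ => Real.exp (-a * x ^ 2)) (c / (2 * a)),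
    ← integral_const_mul]
  congr 1
  ext x
  rw [← Real.exp_add]
  congr 1
  field_simp
  ring

lemma integral_exp_mul_cosh {a : ℝ} (ha : 0 < a) (c : ℝ) :
    Integrable (fun x : ℝ => Real.exp (-a * x ^ 2) * Real.cosh (c * x)) ∧
    ∫ x : ℝ, Real.exp (-a * x ^ 2) * Real.cosh (c * x)
      = Real.exp (c ^ 2 / (4 * a)) * ∫ x : ℝ, Real.exp (-a * x ^ 2) := by
  have e : ∀ x : ℝ, Real.exp (-a * x ^ 2) * Real.cosh (c * x)
      = 1 / 2 * Real.exp (-a * x ^ 2 + c * x) + 1 / 2 * Real.exp (-a * x ^ 2 + -c * x) := by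
    intro x
    rw [Real.cosh_eq, Real.exp_add, Real.exp_add]
    ring_nf
  have i1 := (integrable_exp_quadratic ha c).const_mul (1 / 2)
  have i2 := (integrable_exp_quadratic ha (-c)).const_mul (1 / 2)
  simp only [e]
  refine ⟨i1.add i2, ?_⟩
  rw [integral_add i1 i2, integral_const_mul, integral_const_mul, integral_exp_quadratic ha,
    integral_exp_quadratic ha, neg_sq]
  ring

/-- The ratio of the weights `exp (-a x ^ 2) cosh (b x)` and `exp (-a x ^ 2 + β |x|)`. -/
noncomputable def coshRatio (b β x : ℝ) : ℝ := Real.cosh (b * x) * Real.exp (-β * |x|)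

/-- The ratio is a convex function of `|x|` that is larger at `1` than at `0`. -/
lemma coshRatio_le {b β : ℝ} (hb : β + 1 ≤ b) {x y : ℝ} (hxy : |x| ≤ |y|)
    (hy : 1 ≤ |y|) : coshRatio b β x ≤ coshRatio b β y := by
  set φ : ℝ → ℝ := fun r => Real.exp ((b - β) * r) + Real.exp (-(b + β) * r)
  have hconv : ConvexOn ℝ Set.univ φ := by
    have hlin : ∀ c : ℝ, ConvexOn ℝ Set.univ fun r : ℝ => Real.exp (c * r) := fun c => by
      have := convexOn_exp.comp_linearMap (LinearMap.mul ℝ ℝ c)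
      simpa [Function.comp_def] using this
    exact (hlin _).add (hlin _)
  have hφ : ∀ z, coshRatio b β z = φ |z| / 2 := by
    intro z
    have : Real.cosh (b * z) = Real.cosh (b * |z|) := by
      rw [← Real.cosh_abs, ← Real.cosh_abs (b * |z|), abs_mul, abs_mul, abs_abs]
    rw [coshRatio, this, Real.cosh_eq, div_mul_eq_mul_div, add_mul, ← Real.exp_add, ← Real.exp_add]
    simp only [φ]
    ring_nf
  have h01 : φ 0 < φ 1 := by
    simp only [φ, mul_zero, Real.exp_zero, mul_one]
    have h1 : Real.exp 1 ≤ Real.exp (b - β) := Real.exp_le_exp.2 (by linarith)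
    have h2 := Real.exp_one_gt_d9
    have h3 := Real.exp_pos (-(b + β))
    linarith
  have h0y : φ 0 ≤ φ |y| := by
    have h := hconv.le_max_of_mem_Icc (Set.mem_univ 0) (Set.mem_univ |y|) ⟨zero_le_one, hy⟩
    by_contra hlt
    push Not at hlt
    rw [max_eq_left hlt.le] at h
    linarith
  have h := hconv.le_max_of_mem_Icc (Set.mem_univ 0) (Set.mem_univ |y|) ⟨abs_nonneg x, hxy⟩
  rw [max_eq_right h0y] at h
  rw [hφ, hφ]
  linarith

/-- The symmetric mixture of two Gaussian weights with distant centres dominates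
`exp (-a x ^ 2 + β |x|)`. The ratio of the two weights is not monotone near the origin; there the
weaker bound by its value at `1` is compensated by the total mass. -/
lemma spinDominated_cosh {a β K : ℝ} (ha : 0 < a) (haK : a ≤ K) (hβ : 0 ≤ β) :
    SpinDominated (fun x => Real.exp (-a * x ^ 2 + β * |x|))
      (fun x => Real.exp (-a * x ^ 2) * Real.cosh ((β + 4 * K + 1) * x)) := by
  set b := β + 4 * K + 1 with hb
  have hK : 0 < K := ha.trans_le haK
  have hb1 : β + 1 ≤ b := by linarith
  set w : ℝ → ℝ := fun x => Real.exp (-a * x ^ 2 + β * |x|) with hwdef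
  have hw : ∀ x, 0 < w x := fun x => Real.exp_pos _
  have hw' : (fun x => Real.exp (-a * x ^ 2) * Real.cosh (b * x))
      = fun x => coshRatio b β x * w x := by
    ext x
    simp only [coshRatio, w]
    rw [mul_assoc, ← Real.exp_add, mul_comm]
    congr 2
    ring
  have hρ : ∀ x, 0 ≤ coshRatio b β x := fun x =>
    mul_nonneg (Real.cosh_pos _).le (Real.exp_pos _).le
  rw [hw']
  intro f hf hi hi' h0
  rcases le_or_gt (f 1) 0 with h1 | h1
  · refine integral_nonneg_of_crossing hw hρ (fun x y hx hy => ?_) hi hi' h0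
    have hxy : |x| ≤ |y| := by
      by_contra hlt
      push Not at hlt
      linarith [hf y x hlt.le hy.le]
    refine coshRatio_le hb1 hxy ?_
    by_contra hlt
    push Not at hlt
    linarith [hf y 1 (by simpa using hlt.le) hy.le]
  · set ρ₁ := coshRatio b β 1 with hρ₁
    obtain ⟨ic, hc⟩ := integral_exp_mul_cosh ha b
    obtain ⟨iβ, hcβ⟩ := integral_exp_mul_cosh ha β
    have hcmp : ∀ x, w x ≤ 2 * (Real.exp (-a * x ^ 2) * Real.cosh (β * x)) := by
      intro x
      simp only [w]
      rw [Real.exp_add, ← Real.cosh_abs (β * x), abs_mul, abs_of_nonneg hβ, Real.cosh_eq]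
      have := mul_pos (Real.exp_pos (-a * x ^ 2)) (Real.exp_pos (-(β * |x|)))
      linarith
    have iw : Integrable w := by
      refine (iβ.const_mul 2).mono' (by fun_prop) (Filter.Eventually.of_forall fun x => ?_)
      rw [Real.norm_of_nonneg (hw x).le]
      exact hcmp x
    have hmass : ρ₁ * ∫ x, w x ≤ ∫ x, coshRatio b β x * w x := by
      rw [← hw', hc]
      have hI : 0 ≤ ∫ x : ℝ, Real.exp (-a * x ^ 2) := integral_nonneg fun x => (Real.exp_pos _).le
      have h2 : ∫ x, w x ≤ 2 * (Real.exp (β ^ 2 / (4 * a)) * ∫ x : ℝ, Real.exp (-a * x ^ 2)) := by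
        rw [← hcβ, ← integral_const_mul]
        exact integral_mono iw (iβ.const_mul 2) hcmp
      have h3 : ρ₁ ≤ Real.exp (b - β) := by
        have e : Real.exp (b - β) = Real.exp b * Real.exp (-β) := by
          rw [← Real.exp_add, sub_eq_add_neg]
        rw [hρ₁, coshRatio, mul_one, abs_one, mul_one, Real.cosh_eq, e]
        refine mul_le_mul_of_nonneg_right ?_ (Real.exp_pos _).le
        have : Real.exp (-b) ≤ Real.exp b := Real.exp_le_exp.2 (by linarith)
        linarith
      have h4 : 2 ≤ Real.exp 1 := by linarith [Real.exp_one_gt_d9]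
      have h5 : b - β + 1 + β ^ 2 / (4 * a) ≤ b ^ 2 / (4 * a) := by
        have h6 : b - β + 1 ≤ (b ^ 2 - β ^ 2) / (4 * a) := by
          rw [le_div_iff₀ (by positivity)]
          have h7 : (b - β + 1) * (4 * a) ≤ (b - β + 1) * (4 * K) :=
            mul_le_mul_of_nonneg_left (by linarith) (by linarith)
          have h8 : b ^ 2 - β ^ 2 = (b - β) * (b - β + 2 * β) := by ring
          have h9 : b - β = 4 * K + 1 := by rw [hb]; ring
          rw [h8]
          rw [h9] at h7 ⊢
          nlinarith
        have h10 : (b ^ 2 - β ^ 2) / (4 * a) = b ^ 2 / (4 * a) - β ^ 2 / (4 * a) := sub_div _ _ _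
        linarith
      calc ρ₁ * ∫ x, w x
          ≤ Real.exp (b - β)
            * (Real.exp 1 * (Real.exp (β ^ 2 / (4 * a)) * ∫ x : ℝ, Real.exp (-a * x ^ 2))) := by
            refine mul_le_mul h3 (h2.trans ?_) (integral_nonneg fun x => (hw x).le)
              (Real.exp_pos _).le
            exact mul_le_mul_of_nonneg_right h4 (mul_nonneg (Real.exp_pos _).le hI)
        _ = Real.exp (b - β + 1 + β ^ 2 / (4 * a)) * ∫ x : ℝ, Real.exp (-a * x ^ 2) := by
            rw [Real.exp_add, Real.exp_add]; ring
        _ ≤ _ := mul_le_mul_of_nonneg_right (Real.exp_le_exp.2 h5) hI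
    have iρw : Integrable fun x => coshRatio b β x * w x := by rw [← hw']; exact ic
    -- `f - f 1` and the difference of the weights `ρ w` and `ρ₁ w` have the same sign
    have hpt : ∀ x, f 1 * (coshRatio b β x * w x) - f 1 * (ρ₁ * w x)
        ≤ f x * (coshRatio b β x * w x) - ρ₁ * (f x * w x) := by
      intro x
      have key : 0 ≤ (f x - f 1) * (coshRatio b β x - ρ₁) := by
        rcases le_total |x| 1 with hx | hx
        · have h2 : coshRatio b β x ≤ ρ₁ := coshRatio_le hb1 (by simpa using hx) (by simp)
          have h3 : f x ≤ f 1 := by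
            rcases le_or_gt 0 (f x) with h | h
            · exact hf x 1 (by simpa using hx) h
            · linarith
          exact mul_nonneg_of_nonpos_of_nonpos (by linarith) (by linarith)
        · have h2 : ρ₁ ≤ coshRatio b β x := coshRatio_le hb1 (by simpa using hx) hx
          have h3 : f 1 ≤ f x := hf 1 x (by simpa using hx) h1.le
          exact mul_nonneg (by linarith) (by linarith)
      have := mul_nonneg key (hw x).le
      nlinarith
    have hint := integral_mono ((iρw.const_mul (f 1)).sub ((iw.const_mul ρ₁).const_mul (f 1)))
      (hi'.sub (hi.const_mul ρ₁)) hpt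
    have e1 : ∫ x, (f 1 * (coshRatio b β x * w x) - f 1 * (ρ₁ * w x))
        = f 1 * (∫ x, coshRatio b β x * w x) - f 1 * (ρ₁ * ∫ x, w x) := by
      rw [integral_sub (iρw.const_mul (f 1)) ((iw.const_mul ρ₁).const_mul (f 1)),
        integral_const_mul, integral_const_mul, integral_const_mul]
    have e2 : ∫ x, (f x * (coshRatio b β x * w x) - ρ₁ * (f x * w x))
        = ∫ x, f x * (coshRatio b β x * w x) := by
      rw [integral_sub hi' (hi.const_mul ρ₁), integral_const_mul, h0, mul_zero, sub_zero]
    have hint' : f 1 * (∫ x, coshRatio b β x * w x) - f 1 * (ρ₁ * ∫ x, w x)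
        ≤ ∫ x, f x * (coshRatio b β x * w x) := by rw [← e1, ← e2]; exact hint
    have := mul_le_mul_of_nonneg_left hmass h1.le
    linarith

/-! ### Conditioning on one spin -/

section
variable {ι : Type*} [DecidableEq ι]

/-- The configuration with spin `s` at the site `k` and spins `y` at the other sites. -/
def glue (k : ι) (s : ℝ) (y : {l // l ≠ k} → ℝ) (l : ι) : ℝ := if h : l = k then s else y ⟨l, h⟩

@[simp] lemma glue_self (k : ι) (s : ℝ) (y : {l // l ≠ k} → ℝ) : glue k s y k = s := by
  simp [glue]

@[simp] lemma glue_coe (k : ι) (s : ℝ) (y : {l // l ≠ k} → ℝ) (l : {l // l ≠ k}) :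
    glue k s y l = y l := by
  simp [glue, l.2]

lemma glue_neg (k : ι) (s : ℝ) (y : {l // l ≠ k} → ℝ) : glue k (-s) (-y) = -glue k s y := by
  ext l
  by_cases h : l = k <;> simp [glue, h]

lemma glue_eq_add_single (k : ι) (s : ℝ) (y : {l // l ≠ k} → ℝ) :
    glue k s y = glue k 0 y + s • Pi.single k 1 := by
  ext l
  by_cases h : l = k
  · subst h; simp
  · simp [glue, h]

lemma continuous_glue (k : ι) : Continuous fun z : ℝ × ({l // l ≠ k} → ℝ) => glue k z.1 z.2 := by
  refine continuous_pi fun l => ?_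
  by_cases h : l = k
  · simpa [glue, h] using continuous_fst
  · simp only [glue, h, dif_neg, not_false_eq_true]; fun_prop

variable [Fintype ι]

lemma prod_glue (k : ι) (g : ι → ℝ → ℝ) (s : ℝ) (y : {l // l ≠ k} → ℝ) :
    ∏ l, g l (glue k s y l) = g k s * ∏ l : {l // l ≠ k}, g l (y l) := by
  rw [Fintype.prod_eq_mul_prod_subtype_ne _ k]
  simp

/-- The coordinates on `ℝ^ι` that single out the spin at the site `k`. -/
def glueEquiv (k : ι) : (ℝ × ({l // l ≠ k} → ℝ)) ≃ᵐ (ι → ℝ) :=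
  (((MeasurableEquiv.piEquivPiSubtypeProd (fun _ : ι => ℝ) (· = k)).trans
    ((MeasurableEquiv.funUnique {l // l = k} ℝ).prodCongr (MeasurableEquiv.refl _)))).symm

omit [Fintype ι] in
lemma coe_glueEquiv (k : ι) :
    ⇑(glueEquiv k) = fun z : ℝ × ({l // l ≠ k} → ℝ) => glue k z.1 z.2 := by
  ext z l
  by_cases h : l = k <;> simp [glueEquiv, glue, h, MeasurableEquiv.piEquivPiSubtypeProd,
    MeasurableEquiv.prodCongr, Equiv.piEquivPiSubtypeProd, MeasurableEquiv.funUnique]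

lemma measurePreserving_glueEquiv (k : ι) : MeasurePreserving (glueEquiv k) := by
  refine MeasurePreserving.symm _ ?_
  have h1 : MeasurePreserving ((MeasurableEquiv.funUnique {l // l = k} ℝ).prodCongr
      (MeasurableEquiv.refl ({l // l ≠ k} → ℝ))) volume volume :=
    (volume_preserving_funUnique {l // l = k} ℝ).prod (MeasurePreserving.id volume)
  -- `convert` identifies two instances of `Fintype {l // l = k}`
  have h2 : MeasurePreserving (MeasurableEquiv.piEquivPiSubtypeProd (fun _ : ι => ℝ) (· = k))
      volume (volume : Measure (({l // l = k} → ℝ) × ({l // l ≠ k} → ℝ))) := by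
    convert volume_preserving_piEquivPiSubtypeProd (fun _ : ι => ℝ) (· = k) <;> rfl
  exact h1.comp h2

lemma integrable_comp_glue (k : ι) {f : (ι → ℝ) → ℝ} (hf : Integrable f) :
    Integrable fun z : ℝ × ({l // l ≠ k} → ℝ) => f (glue k z.1 z.2) := by
  have h := ((measurePreserving_glueEquiv k).integrable_comp_emb
    (glueEquiv k).measurableEmbedding (g := f)).2 hf
  rwa [coe_glueEquiv] at h

lemma integral_glue (k : ι) {f : (ι → ℝ) → ℝ} (hf : Integrable f) :
    ∫ p, f p = ∫ s, ∫ y, f (glue k s y) := by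
  rw [← (measurePreserving_glueEquiv k).integral_comp' f, coe_glueEquiv]
  exact integral_prod _ (integrable_comp_glue k hf)

/-- The density of the spins outside the site `k`, given the spin `s` at `k`. -/
noncomputable def partDensity (J : ι → ι → ℝ) (w : ι → ℝ → ℝ) (k : ι) (s : ℝ)
    (y : {l // l ≠ k} → ℝ) : ℝ :=
  Real.exp (pairEnergy J (glue k s y)) * ∏ l : {l // l ≠ k}, w l (y l)

lemma spinDensity_glue (J : ι → ι → ℝ) (w : ι → ℝ → ℝ) (k : ι) (s : ℝ) (y : {l // l ≠ k} → ℝ) :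
    spinDensity J w (glue k s y) = partDensity J w k s y * w k s := by
  rw [spinDensity, prod_glue, partDensity]; ring

lemma partDensity_pos (J : ι → ι → ℝ) {w : ι → ℝ → ℝ} (hw : ∀ k x, 0 < w k x) (k : ι) (s : ℝ)
    (y : {l // l ≠ k} → ℝ) : 0 < partDensity J w k s y :=
  mul_pos (Real.exp_pos _) (Finset.prod_pos fun l _ => hw l _)

lemma partDensity_neg (J : ι → ι → ℝ) {w : ι → ℝ → ℝ} (hw : ∀ k x, w k (-x) = w k x) (k : ι)
    (s : ℝ) (y : {l // l ≠ k} → ℝ) : partDensity J w k (-s) (-y) = partDensity J w k s y := by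
  simp only [partDensity, glue_neg, pairEnergy_neg, Pi.neg_apply, hw]

/-- The integral of `f` against the density of the spins outside the site `k`, given the spin `s`
at `k`. -/
noncomputable def partIntegral (J : ι → ι → ℝ) (w : ι → ℝ → ℝ) (k : ι) (f : (ι → ℝ) → ℝ)
    (s : ℝ) : ℝ :=
  ∫ y, f (glue k s y) * partDensity J w k s y

lemma partIntegral_congr (J : ι → ι → ℝ) {w w' : ι → ℝ → ℝ} {k : ι} (h : ∀ l, l ≠ k → w l = w' l)
    (f : (ι → ℝ) → ℝ) : partIntegral J w k f = partIntegral J w' k f := by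
  ext s
  simp only [partIntegral, partDensity]
  congr 1
  ext y
  congr 2
  exact Finset.prod_congr rfl fun l _ => by rw [h l l.2]

section
variable {J : ι → ι → ℝ} (hJ : ∀ k l, 0 ≤ J k l) (hsymm : ∀ k l, J k l = J l k) {w : ι → ℝ → ℝ}
  (hw : ∀ k, SiteWeight (∑ l, J k l) (w k))
include hJ hsymm hw

lemma integrable_mul_partDensity (k : ι) (s : ℝ) {f : (ι → ℝ) → ℝ} (hf : Continuous f)
    (hbound : ∀ p, |f p| ≤ ∏ k, (1 + p k ^ 2)) :
    Integrable fun y => f (glue k s y) * partDensity J w k s y := by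
  have h := Integrable.fintype_prod (μ := fun _ : {l // l ≠ k} => (volume : Measure ℝ))
    (fun l => (hw l).integrable)
  rw [← volume_pi] at h
  have hg : Continuous fun y : {l // l ≠ k} → ℝ => glue k s y :=
    (continuous_glue k).comp (by fun_prop : Continuous fun y : {l // l ≠ k} → ℝ => (s, y))
  have hc : Continuous fun y => f (glue k s y) * partDensity J w k s y := by
    refine (hf.comp hg).mul ?_
    refine (Real.continuous_exp.comp ((continuous_pairEnergy J).comp hg)).mul ?_
    exact continuous_finsetProd _ fun l _ => (hw l).continuous.comp (continuous_apply l)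
  refine (h.const_mul ((1 + s ^ 2) * Real.exp ((∑ l, J k l) * s ^ 2))).mono'
    hc.aestronglyMeasurable (Filter.Eventually.of_forall fun y => ?_)
  have hw0 : 0 ≤ ∏ l : {l // l ≠ k}, w l (y l) := Finset.prod_nonneg fun l _ => ((hw l).pos _).le
  have h1 := hbound (glue k s y)
  rw [prod_glue k (fun _ x => 1 + x ^ 2)] at h1
  have h2 := Real.exp_le_exp.2 (pairEnergy_le hJ hsymm (glue k s y))
  rw [Real.exp_sum, prod_glue k (fun l x => Real.exp ((∑ m, J l m) * x ^ 2))] at h2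
  rw [Real.norm_eq_abs, abs_mul, partDensity, abs_of_nonneg (mul_nonneg (Real.exp_pos _).le hw0),
    Finset.prod_mul_distrib, Finset.prod_mul_distrib]
  calc |f (glue k s y)| * (Real.exp (pairEnergy J (glue k s y)) * ∏ l : {l // l ≠ k}, w l (y l))
      ≤ ((1 + s ^ 2) * ∏ l : {l // l ≠ k}, (1 + y l ^ 2))
        * ((Real.exp ((∑ l, J k l) * s ^ 2)
          * ∏ l : {l // l ≠ k}, Real.exp ((∑ m, J l m) * y l ^ 2))
          * ∏ l : {l // l ≠ k}, w l (y l)) := by gcongr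
    _ = _ := by ring

lemma integrable_partDensity (k : ι) (s : ℝ) : Integrable (partDensity J w k s) := by
  simpa using integrable_mul_partDensity hJ hsymm hw k s (f := fun _ => 1) continuous_const
    fun p => by simpa using one_le_prod_one_add_sq p Finset.univ

lemma integrable_partIntegral_mul (k : ι) {f : (ι → ℝ) → ℝ} (hf : Continuous f)
    (hbound : ∀ p, |f p| ≤ ∏ k, (1 + p k ^ 2)) :
    Integrable (fun s => partIntegral J w k f s * w k s) ∧
      ∫ s, partIntegral J w k f s * w k s = ∫ p, f p * spinDensity J w p := by
  have hi := integrable_mul_spinDensity hJ hsymm hw hf hbound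
  have e : ∀ s, ∫ y, f (glue k s y) * spinDensity J w (glue k s y)
      = partIntegral J w k f s * w k s := fun s => by
    rw [partIntegral, ← integral_mul_const]
    congr 1
    ext y
    rw [spinDensity_glue]; ring
  have h1 := (integrable_comp_glue k hi).integral_prod_left
  simp only [e] at h1
  refine ⟨h1, ?_⟩
  rw [integral_glue k hi]
  simp only [e]

end

lemma partIntegral_neg (J : ι → ι → ℝ) {w : ι → ℝ → ℝ} (heven : ∀ k x, w k (-x) = w k x) (k : ι)
    {f : (ι → ℝ) → ℝ} (hf : ∀ p, f (-p) = f p) (s : ℝ) :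
    partIntegral J w k f (-s) = partIntegral J w k f s := by
  rw [partIntegral, partIntegral, ← integral_neg_eq_self]
  simp only [glue_neg, hf, partDensity_neg J heven]

lemma partIntegral_abs (J : ι → ι → ℝ) {w : ι → ℝ → ℝ} (heven : ∀ k x, w k (-x) = w k x) (k : ι)
    {f : (ι → ℝ) → ℝ} (hf : ∀ p, f (-p) = f p) (s : ℝ) :
    partIntegral J w k f |s| = partIntegral J w k f s := by
  rcases abs_choice s with h | h <;> rw [h]
  exact partIntegral_neg J heven k hf s

/-- The conditional partition function is nondecreasing in the absolute value of the given spin: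
after averaging over `y` and `-y` it depends on `s` through a hyperbolic cosine. -/
lemma partIntegral_one_mono {J : ι → ι → ℝ} (hJ : ∀ k l, 0 ≤ J k l)
    (hsymm : ∀ k l, J k l = J l k) {w : ι → ℝ → ℝ} (hw : ∀ k, SiteWeight (∑ l, J k l) (w k))
    (heven : ∀ k x, w k (-x) = w k x) (k : ι) {s t : ℝ} (hst : |s| ≤ |t|) :
    partIntegral J w k (fun _ => 1) s ≤ partIntegral J w k (fun _ => 1) t := by
  have hi := integrable_partDensity hJ hsymm hw k
  have e : ∀ s, 2 * partIntegral J w k (fun _ => 1) s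
      = ∫ y, (partDensity J w k s y + partDensity J w k (-s) y) := fun s => by
    have h1 := partIntegral_neg J heven k (f := fun _ => 1) (fun _ => rfl) s
    simp only [partIntegral, one_mul] at h1 ⊢
    rw [integral_add (hi s) (hi (-s)), h1]; ring
  have h2 : 2 * partIntegral J w k (fun _ => 1) s ≤ 2 * partIntegral J w k (fun _ => 1) t := by
    rw [e, e]
    refine integral_mono ((hi s).add (hi (-s))) ((hi t).add (hi (-t))) fun y => ?_
    have e2 : ∀ s, partDensity J w k s y + partDensity J w k (-s) y
        = (2 * Real.exp (s ^ 2 * J k k) * Real.cosh (s * (2 * ∑ l, J k l * glue k 0 y l)))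
          * (Real.exp (pairEnergy J (glue k 0 y)) * ∏ l : {l // l ≠ k}, w l (y l)) := fun s => by
      simp only [partDensity]
      rw [glue_eq_add_single k s, glue_eq_add_single k (-s), pairEnergy_add_single hsymm,
        pairEnergy_add_single hsymm, Real.cosh_eq]
      have h3 : -s = -1 * s := by ring
      rw [Real.exp_add, Real.exp_add, Real.exp_add, Real.exp_add, neg_sq]
      ring_nf
    simp only [e2]
    have hw0 : 0 ≤ ∏ l : {l // l ≠ k}, w l (y l) := Finset.prod_nonneg fun l _ => ((hw l).pos _).le
    refine mul_le_mul_of_nonneg_right ?_ (mul_nonneg (Real.exp_pos _).le hw0)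
    have h3 : Real.cosh (s * (2 * ∑ l, J k l * glue k 0 y l))
        ≤ Real.cosh (t * (2 * ∑ l, J k l * glue k 0 y l)) := by
      rw [Real.cosh_le_cosh, abs_mul s, abs_mul t]
      exact mul_le_mul_of_nonneg_right hst (abs_nonneg _)
    have h4 : s ^ 2 * J k k ≤ t ^ 2 * J k k :=
      mul_le_mul_of_nonneg_right (sq_le_sq.2 hst) (hJ k k)
    have := Real.exp_le_exp.2 h4
    have := Real.cosh_pos (s * (2 * ∑ l, J k l * glue k 0 y l))
    gcongr
  linarith

end

/-! ### Correlations given one spin -/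

section
variable {ι : Type*} [Fintype ι]

lemma exp_pairEnergy_mem_signCone {κ : Type*} {J : ι → ι → ℝ} (hJ : ∀ k l, 0 ≤ J k l) {c : ι → ℝ}
    (hc : ∀ k, 0 ≤ c k) {τ : ι → (κ → ℤˣ) → ℝ} (hτ : ∀ k, τ k ∈ signCone κ)
    (hτ1 : ∀ k σ, τ k σ = 1 ∨ τ k σ = -1) :
    (fun σ => Real.exp (pairEnergy J (fun k => c k * τ k σ) / 2)) ∈ signCone κ := by
  have e : ∀ σ, Real.exp (pairEnergy J (fun k => c k * τ k σ) / 2)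
      = ∏ k, ∏ l, Real.exp (J k l / 2 * c k * c l * (τ k σ * τ l σ)) := fun σ => by
    simp only [← Real.exp_sum, pairEnergy]
    congr 1
    rw [Finset.sum_div]
    refine Finset.sum_congr rfl fun k _ => ?_
    rw [Finset.sum_div]
    exact Finset.sum_congr rfl fun l _ => by ring
  simp only [e]
  refine prod_mem_signCone _ fun k _ => prod_mem_signCone _ fun l _ => ?_
  refine exp_mem_signCone ?_ (mul_mem_signCone (hτ k) (hτ l)) fun σ => ?_
  · have := hJ k l; have := hc k; have := hc l; positivity
  · rcases hτ1 k σ with h | h <;> rcases hτ1 l σ with h' | h' <;> simp [h, h']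

lemma pairEnergy_add_pairEnergy (J : ι → ι → ℝ) (x y : ι → ℝ) :
    pairEnergy J x + pairEnergy J y
      = pairEnergy J (fun k => x k + y k) / 2 + pairEnergy J (fun k => x k - y k) / 2 := by
  simp only [pairEnergy, Finset.sum_div, ← Finset.sum_add_distrib]
  exact Finset.sum_congr rfl fun k _ => Finset.sum_congr rfl fun l _ => by ring

end

section
variable {ι : Type*} [DecidableEq ι]

lemma glue_add (k : ι) (s t : ℝ) (x y : {l // l ≠ k} → ℝ) (l : ι) :
    glue k s x l + glue k t y l = glue k (s + t) (fun m => x m + y m) l := by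
  by_cases h : l = k <;> simp [glue, h]

lemma glue_sub (k : ι) (s t : ℝ) (x y : {l // l ≠ k} → ℝ) (l : ι) :
    glue k s x l - glue k t y l = glue k (s - t) (fun m => x m - y m) l := by
  by_cases h : l = k <;> simp [glue, h]

lemma glue_mul (k : ι) (s t : ℝ) (x y : {l // l ≠ k} → ℝ) (l : ι) :
    glue k (s * t) (fun m => x m * y m) l = glue k s x l * glue k t y l := by
  by_cases h : l = k <;> simp [glue, h]

variable [Fintype ι]

/-- In the variables `U = X + Y` and `V = X - Y` of two copies of the system the weights become
polynomials with nonnegative coefficients in the signs of the coordinates. -/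
lemma sum_signs_nonneg {J : ι → ι → ℝ} (hJ : ∀ k l, 0 ≤ J k l) (k i j : ι) {a b : ℝ} (ha : 0 ≤ a)
    (hb : 0 ≤ b) (u v : {l // l ≠ k} → ℝ) :
    0 ≤ ∑ σ : {l // l ≠ k} ⊕ {l // l ≠ k} → ℤˣ,
      (glue k a (fun l => spin (σ (Sum.inl l)) * u l) i
          * glue k b (fun l => spin (σ (Sum.inr l)) * v l) j
        + glue k b (fun l => spin (σ (Sum.inr l)) * v l) i
          * glue k a (fun l => spin (σ (Sum.inl l)) * u l) j)
      * (Real.exp (pairEnergy J (glue k a fun l => spin (σ (Sum.inl l)) * u l) / 2)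
        * Real.exp (pairEnergy J (glue k b fun l => spin (σ (Sum.inr l)) * v l) / 2)) := by
  set κ := {l // l ≠ k} ⊕ {l // l ≠ k}
  have pos : ∀ u v : {l // l ≠ k} → ℝ, (∀ l, 0 ≤ u l) → (∀ l, 0 ≤ v l) → 0 ≤ ∑ σ : κ → ℤˣ,
      (glue k a (fun l => spin (σ (Sum.inl l)) * u l) i
          * glue k b (fun l => spin (σ (Sum.inr l)) * v l) j
        + glue k b (fun l => spin (σ (Sum.inr l)) * v l) i
          * glue k a (fun l => spin (σ (Sum.inl l)) * u l) j)
      * (Real.exp (pairEnergy J (glue k a fun l => spin (σ (Sum.inl l)) * u l) / 2)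
        * Real.exp (pairEnergy J (glue k b fun l => spin (σ (Sum.inr l)) * v l) / 2)) := by
    intro u v hu hv
    have hglue : ∀ (a : ℝ), 0 ≤ a → ∀ u : {l // l ≠ k} → ℝ, (∀ l, 0 ≤ u l) →
        ∀ l, 0 ≤ glue k a u l := by
      intro a ha u hu l
      by_cases h : l = k
      · simpa [glue, h] using ha
      · simpa [glue, h] using hu _
    have hτ : ∀ (f : {l // l ≠ k} → κ) (l : ι),
        (fun σ : κ → ℤˣ => glue k 1 (fun l => spin (σ (f l))) l) ∈ signCone κ := by
      intro f l
      by_cases h : l = k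
      · simpa [glue, h] using const_mem_signCone (κ := κ) zero_le_one
      · simpa [glue, h] using spin_mem_signCone (κ := κ) (f ⟨l, h⟩)
    have hτ1 : ∀ (f : {l // l ≠ k} → κ) (l : ι) (σ : κ → ℤˣ),
        glue k 1 (fun l => spin (σ (f l))) l = 1 ∨ glue k 1 (fun l => spin (σ (f l))) l = -1 := by
      intro f l σ
      by_cases h : l = k
      · simp [glue, h]
      · simpa [glue, h] using spin_eq_or _
    have e : ∀ (a : ℝ) (u : {l // l ≠ k} → ℝ) (f : {l // l ≠ k} → κ) (σ : κ → ℤˣ) (l : ι),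
        glue k a (fun l => spin (σ (f l)) * u l) l
          = glue k a u l * glue k 1 (fun l => spin (σ (f l))) l := by
      intro a u f σ l
      rw [← glue_mul, mul_one]
      simp only [mul_comm]
    have hm : ∀ (a : ℝ), 0 ≤ a → ∀ u : {l // l ≠ k} → ℝ, (∀ l, 0 ≤ u l) →
        ∀ (f : {l // l ≠ k} → κ) (l : ι),
        (fun σ : κ → ℤˣ => glue k a (fun l => spin (σ (f l)) * u l) l) ∈ signCone κ := by
      intro a ha u hu f l
      simp only [e]
      exact const_mul_mem_signCone (hglue a ha u hu l) (hτ f l)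
    have hE : ∀ (a : ℝ), 0 ≤ a → ∀ u : {l // l ≠ k} → ℝ, (∀ l, 0 ≤ u l) →
        ∀ (f : {l // l ≠ k} → κ),
        (fun σ : κ → ℤˣ => Real.exp (pairEnergy J (glue k a fun l => spin (σ (f l)) * u l) / 2))
          ∈ signCone κ := by
      intro a ha u hu f
      have := exp_pairEnergy_mem_signCone hJ (hglue a ha u hu) (hτ f) (hτ1 f)
      simp only [← e] at this
      exact this
    refine sum_nonneg_of_mem_signCone (mul_mem_signCone (add_mem_signCone
      (mul_mem_signCone (hm a ha u hu _ i) (hm b hb v hv _ j))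
      (mul_mem_signCone (hm b hb v hv _ i) (hm a ha u hu _ j)))
      (mul_mem_signCone (hE a ha u hu _) (hE b hb v hv _)))
  -- the signs of `u` and `v` are absorbed into `σ`
  choose θ hθ using fun l => exists_spin_mul_abs (Sum.elim u v l)
  have h := pos (fun l => |u l|) (fun l => |v l|) (fun l => abs_nonneg _) fun l => abs_nonneg _
  rw [← Equiv.sum_comp (Equiv.mulLeft θ)] at h
  have eu : ∀ (σ : κ → ℤˣ) l, spin (Equiv.mulLeft θ σ (Sum.inl l)) * |u l|
      = spin (σ (Sum.inl l)) * u l := fun σ l => by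
    have := hθ (Sum.inl l)
    simp only [Sum.elim_inl] at this
    rw [show Equiv.mulLeft θ σ (Sum.inl l) = θ (Sum.inl l) * σ (Sum.inl l) from rfl,
      spin_mul, mul_comm (spin (θ _)), mul_assoc, ← this]
  have ev : ∀ (σ : κ → ℤˣ) l, spin (Equiv.mulLeft θ σ (Sum.inr l)) * |v l|
      = spin (σ (Sum.inr l)) * v l := fun σ l => by
    have := hθ (Sum.inr l)
    simp only [Sum.elim_inr] at this
    rw [show Equiv.mulLeft θ σ (Sum.inr l) = θ (Sum.inr l) * σ (Sum.inr l) from rfl,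
      spin_mul, mul_comm (spin (θ _)), mul_assoc, ← this]
  simpa only [eu, ev] using h

end

/-- The linear map on pairs that multiplies the sum of the two entries by `e` and their difference
by `h`. -/
noncomputable def signFlip (e h : ℤˣ) (z : ℝ × ℝ) : ℝ × ℝ :=
  ((spin e * (z.1 + z.2) + spin h * (z.1 - z.2)) / 2,
    (spin e * (z.1 + z.2) - spin h * (z.1 - z.2)) / 2)

/-- A sign flip permutes the two entries and changes both of their signs or none. -/
lemma signFlip_eq (e h : ℤˣ) : signFlip e h = id ∨ signFlip e h = Neg.neg ∨
    signFlip e h = Prod.swap ∨ signFlip e h = Neg.neg ∘ Prod.swap := by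
  rcases spin_eq_or e with he | he <;> rcases spin_eq_or h with hh | hh
  · left; ext z <;> simp only [signFlip, he, hh, id] <;> ring
  · right; right; left; ext z <;> simp only [signFlip, he, hh, Prod.swap] <;> ring
  · right; right; right
    ext z <;> simp only [signFlip, he, hh, Function.comp, Prod.swap, Prod.fst_neg, Prod.snd_neg]
      <;> ring
  · right; left; ext z <;> simp only [signFlip, he, hh, Prod.fst_neg, Prod.snd_neg] <;> ring

lemma measurePreserving_signFlip (e h : ℤˣ) : MeasurePreserving (signFlip e h) := by
  have hneg : MeasurePreserving (Neg.neg : ℝ × ℝ → ℝ × ℝ) volume volume :=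
    (Measure.measurePreserving_neg (volume : Measure ℝ)).prod
      (Measure.measurePreserving_neg (volume : Measure ℝ))
  have hswap : MeasurePreserving (Prod.swap : ℝ × ℝ → ℝ × ℝ) volume volume :=
    Measure.measurePreserving_swap
  rcases signFlip_eq e h with H | H | H | H <;> rw [H]
  · exact MeasurePreserving.id _
  · exact hneg
  · exact hswap
  · exact hneg.comp hswap

lemma signFlip_mul {w : ℝ → ℝ} (hw : ∀ x, w (-x) = w x) (e h : ℤˣ) (z : ℝ × ℝ) :
    w (signFlip e h z).1 * w (signFlip e h z).2 = w z.1 * w z.2 := by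
  rcases signFlip_eq e h with H | H | H | H <;> rw [H] <;> simp [hw, mul_comm]

section
variable {ι : Type*} [DecidableEq ι] [Fintype ι]

/-- The integrand of the duplicated system: the difference of the pair products of the two copies,
with spins `s` and `t` at the site `k`, against their joint density. -/
noncomputable def dupIntegrand (J : ι → ι → ℝ) (w : ι → ℝ → ℝ) (k i j : ι) (s t : ℝ)
    (z : {l // l ≠ k} → ℝ × ℝ) : ℝ :=
  (glue k t (fun l => (z l).1) i * glue k t (fun l => (z l).1) j
    - glue k s (fun l => (z l).2) i * glue k s (fun l => (z l).2) j)
  * (partDensity J w k t (fun l => (z l).1) * partDensity J w k s fun l => (z l).2)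

lemma sum_dupIntegrand_nonneg {J : ι → ι → ℝ} (hJ : ∀ k l, 0 ≤ J k l) {w : ι → ℝ → ℝ}
    (hpos : ∀ k x, 0 < w k x) (heven : ∀ k x, w k (-x) = w k x) (k i j : ι) {s t : ℝ}
    (hs : 0 ≤ s) (hst : s ≤ t) (z : {l // l ≠ k} → ℝ × ℝ) :
    0 ≤ ∑ σ : {l // l ≠ k} ⊕ {l // l ≠ k} → ℤˣ, dupIntegrand J w k i j s t
      fun l => signFlip (σ (Sum.inl l)) (σ (Sum.inr l)) (z l) := by
  set W : ℝ := ∏ l : {l // l ≠ k}, w l (z l).1 * w l (z l).2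
  have hW : 0 ≤ W := Finset.prod_nonneg fun l _ => (mul_pos (hpos _ _) (hpos _ _)).le
  have key := mul_nonneg (mul_nonneg one_half_pos.le hW)
    (sum_signs_nonneg hJ k i j (add_nonneg (hs.trans hst) hs) (sub_nonneg.2 hst)
      (fun l => (z l).1 + (z l).2) fun l => (z l).1 - (z l).2)
  rw [Finset.mul_sum] at key
  refine key.trans_eq (Finset.sum_congr rfl fun σ _ => ?_)
  set X := glue k t fun l => (signFlip (σ (Sum.inl l)) (σ (Sum.inr l)) (z l)).1 with hX
  set Y := glue k s fun l => (signFlip (σ (Sum.inl l)) (σ (Sum.inr l)) (z l)).2 with hY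
  have hU : (glue k (t + s) fun l => spin (σ (Sum.inl l)) * ((z l).1 + (z l).2))
      = fun l => X l + Y l := by
    ext l
    rw [hX, hY, glue_add]
    congr 1
    ext m
    simp only [signFlip]; ring
  have hV : (glue k (t - s) fun l => spin (σ (Sum.inr l)) * ((z l).1 - (z l).2))
      = fun l => X l - Y l := by
    ext l
    rw [hX, hY, glue_sub]
    congr 1
    ext m
    simp only [signFlip]; ring
  have hWσ : W = (∏ l : {l // l ≠ k}, w l (signFlip (σ (Sum.inl l)) (σ (Sum.inr l)) (z l)).1)
      * ∏ l : {l // l ≠ k}, w l (signFlip (σ (Sum.inl l)) (σ (Sum.inr l)) (z l)).2 := by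
    rw [← Finset.prod_mul_distrib]
    exact Finset.prod_congr rfl fun l _ => (signFlip_mul (heven l) _ _ _).symm
  rw [hU, hV, ← Real.exp_add, ← pairEnergy_add_pairEnergy, Real.exp_add, hWσ]
  simp only [dupIntegrand, partDensity]
  rw [← hX, ← hY]
  ring

/-- The correlation given the spin `s` at the site `k` is nondecreasing in `s ≥ 0`: the duplicated
system is invariant under sign flips, and the average of its integrand over them is nonnegative. -/
lemma partIntegral_mul_le {J : ι → ι → ℝ} (hJ : ∀ k l, 0 ≤ J k l)
    (hsymm : ∀ k l, J k l = J l k) {w : ι → ℝ → ℝ} (hw : ∀ k, SiteWeight (∑ l, J k l) (w k))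
    (heven : ∀ k x, w k (-x) = w k x) (k i j : ι) {s t : ℝ} (hs : 0 ≤ s) (hst : s ≤ t) :
    partIntegral J w k (fun p => p i * p j) s * partIntegral J w k (fun _ => 1) t
      ≤ partIntegral J w k (fun p => p i * p j) t * partIntegral J w k (fun _ => 1) s := by
  have iF := fun s => integrable_mul_partDensity hJ hsymm hw k s (f := fun p => p i * p j)
    (by fun_prop) fun p => abs_mul_le_prod p i j
  have iG := integrable_partDensity hJ hsymm hw k
  set e := MeasurableEquiv.arrowProdEquivProdArrow ℝ ℝ {l // l ≠ k}
  have hmp : MeasurePreserving e volume volume :=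
    volume_measurePreserving_arrowProdEquivProdArrow ℝ ℝ {l // l ≠ k}
  set Φ := dupIntegrand J w k i j s t
  have hΦ : Φ = (fun z : ({l // l ≠ k} → ℝ) × ({l // l ≠ k} → ℝ) =>
      glue k t z.1 i * glue k t z.1 j * partDensity J w k t z.1 * partDensity J w k s z.2
      - partDensity J w k t z.1 * (glue k s z.2 i * glue k s z.2 j * partDensity J w k s z.2))
      ∘ e := by
    ext z
    have h1 : (e z).1 = fun l => (z l).1 := rfl
    have h2 : (e z).2 = fun l => (z l).2 := rfl
    simp only [Φ, dupIntegrand, Function.comp, h1, h2]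
    ring
  have i1 := (iF t).mul_prod (iG s)
  have i2 := (iG t).mul_prod (iF s)
  have iΦ : Integrable Φ := by
    rw [hΦ, hmp.integrable_comp_emb e.measurableEmbedding]
    exact i1.sub i2
  have eΦ : ∫ z, Φ z
      = partIntegral J w k (fun p => p i * p j) t * partIntegral J w k (fun _ => 1) s
        - partIntegral J w k (fun _ => 1) t * partIntegral J w k (fun p => p i * p j) s := by
    rw [hΦ]
    simp only [Function.comp_def]
    rw [hmp.integral_comp' (g := fun z : ({l // l ≠ k} → ℝ) × ({l // l ≠ k} → ℝ) =>
      glue k t z.1 i * glue k t z.1 j * partDensity J w k t z.1 * partDensity J w k s z.2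
      - partDensity J w k t z.1 * (glue k s z.2 i * glue k s z.2 j * partDensity J w k s z.2)),
      Measure.volume_eq_prod, integral_sub i1 i2,
      integral_prod_mul (fun y => glue k t y i * glue k t y j * partDensity J w k t y)
        (partDensity J w k s),
      integral_prod_mul (partDensity J w k t)
        (fun y => glue k s y i * glue k s y j * partDensity J w k s y)]
    simp only [partIntegral, one_mul]
  have hflip : ∀ σ : {l // l ≠ k} ⊕ {l // l ≠ k} → ℤˣ, MeasurePreserving
      (fun (z : {l // l ≠ k} → ℝ × ℝ) l => signFlip (σ (Sum.inl l)) (σ (Sum.inr l)) (z l)) :=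
    fun σ => volume_preserving_pi fun l => measurePreserving_signFlip _ _
  have iσ : ∀ σ : {l // l ≠ k} ⊕ {l // l ≠ k} → ℤˣ, Integrable
      fun z : {l // l ≠ k} → ℝ × ℝ => Φ fun l => signFlip (σ (Sum.inl l)) (σ (Sum.inr l)) (z l) :=
    fun σ =>
    ((hflip σ).integrable_comp iΦ.aestronglyMeasurable).2 iΦ
  have eσ : ∀ σ : {l // l ≠ k} ⊕ {l // l ≠ k} → ℤˣ,
      ∫ z : {l // l ≠ k} → ℝ × ℝ, Φ (fun l => signFlip (σ (Sum.inl l)) (σ (Sum.inr l)) (z l)) = ∫ z, Φ z := fun σ => by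
    have := integral_map (hflip σ).aemeasurable (f := Φ)
      (by rw [(hflip σ).map_eq]; exact iΦ.aestronglyMeasurable)
    rw [(hflip σ).map_eq] at this
    exact this.symm
  have hsum : 0 ≤ ∑ σ : {l // l ≠ k} ⊕ {l // l ≠ k} → ℤˣ,
      ∫ z : {l // l ≠ k} → ℝ × ℝ, Φ (fun l => signFlip (σ (Sum.inl l)) (σ (Sum.inr l)) (z l)) := by
    rw [← integral_finsetSum _ fun σ _ => iσ σ]
    exact integral_nonneg fun z =>
      sum_dupIntegrand_nonneg hJ (fun k => (hw k).pos) heven k i j hs hst z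
  simp only [eσ, Finset.sum_const, nsmul_eq_mul] at hsum
  have hcard : (0 : ℝ) < (Finset.univ : Finset ({l // l ≠ k} ⊕ {l // l ≠ k} → ℤˣ)).card :=
    Nat.cast_pos.2 (Finset.card_pos.2 Finset.univ_nonempty)
  have := nonneg_of_mul_nonneg_right hsum hcard
  rw [eΦ] at this
  linarith

end

/-! ### Comparison of correlations -/

section
variable {ι : Type*} [Fintype ι] [DecidableEq ι] {J : ι → ι → ℝ} (hJ : ∀ k l, 0 ≤ J k l)
  (hsymm : ∀ k l, J k l = J l k)
include hJ hsymm

/-- Replacing the weight of one site by a dominating weight increases the correlations: the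
conditional correlation and the conditional partition function are nondecreasing in the absolute
value of the spin at that site. -/
lemma correlation_le_of_spinDominated {w w' : ι → ℝ → ℝ}
    (hw : ∀ k, SiteWeight (∑ l, J k l) (w k)) (hw' : ∀ k, SiteWeight (∑ l, J k l) (w' k))
    (heven : ∀ k x, w k (-x) = w k x) {k : ι} (hk : ∀ l, l ≠ k → w l = w' l)
    (hdom : SpinDominated (w k) (w' k)) (i j : ι) :
    (∫ p, p i * p j * spinDensity J w p) * ∫ p, spinDensity J w' p
      ≤ (∫ p, p i * p j * spinDensity J w' p) * ∫ p, spinDensity J w p := by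
  set F := partIntegral J w k fun p => p i * p j with hF
  set G := partIntegral J w k fun _ => 1 with hG
  have hc : Continuous fun p : ι → ℝ => p i * p j := by fun_prop
  have b1 : ∀ p : ι → ℝ, |(1 : ℝ)| ≤ ∏ k, (1 + p k ^ 2) := fun p => by
    simpa using one_le_prod_one_add_sq p Finset.univ
  obtain ⟨iF, eF⟩ := integrable_partIntegral_mul hJ hsymm hw k hc fun p => abs_mul_le_prod p i j
  obtain ⟨iF', eF'⟩ :=
    integrable_partIntegral_mul hJ hsymm hw' k hc fun p => abs_mul_le_prod p i j
  obtain ⟨iG, eG⟩ :=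
    integrable_partIntegral_mul hJ hsymm hw k (f := fun _ => 1) continuous_const b1
  obtain ⟨iG', eG'⟩ :=
    integrable_partIntegral_mul hJ hsymm hw' k (f := fun _ => 1) continuous_const b1
  rw [← partIntegral_congr J hk] at iF' eF' iG' eG'
  simp only [← hF, ← hG, one_mul] at iF eF iF' eF' iG eG iG' eG'
  have hZ := integral_spinDensity_pos hJ hsymm hw
  set N := ∫ p, p i * p j * spinDensity J w p
  set Z := ∫ p, spinDensity J w p
  have hGpos : ∀ s, 0 < G s := fun s => by
    have hpos := partDensity_pos J (fun k => (hw k).pos) k s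
    simp only [hG, partIntegral, one_mul]
    rw [integral_pos_iff_support_of_nonneg (fun y => (hpos y).le)
      (integrable_partDensity hJ hsymm hw k s)]
    have : Function.support (partDensity J w k s) = Set.univ := by
      ext y; simp [(hpos y).ne']
    rw [this]
    exact Measure.measure_univ_pos.2 (NeZero.ne _)
  have e : ∀ (v : ℝ → ℝ) s, (F s - N / Z * G s) * v s = F s * v s - N / Z * (G s * v s) :=
    fun v s => by ring
  have h0 : ∫ s, (F s - N / Z * G s) * w k s = 0 := by
    simp only [e]
    rw [integral_sub iF (iG.const_mul _), integral_const_mul, eF, eG]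
    field_simp
    ring
  have h := hdom (fun s => F s - N / Z * G s) (fun x y hxy hx => ?_)
    (by simp only [e]; exact iF.sub (iG.const_mul _))
    (by simp only [e]; exact iF'.sub (iG'.const_mul _)) h0
  · simp only [e] at h
    rw [integral_sub iF' (iG'.const_mul _), integral_const_mul, eF', eG', div_mul_eq_mul_div,
      sub_nonneg, div_le_iff₀ hZ] at h
    exact h
  · have h1 : F x * G y ≤ F y * G x := by
      have := partIntegral_mul_le hJ hsymm hw heven k i j (abs_nonneg x) hxy
      rwa [partIntegral_abs J heven k (f := fun p => p i * p j) (fun p => by simp),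
        partIntegral_abs J heven k (f := fun p => p i * p j) (fun p => by simp),
        partIntegral_abs J heven k (f := fun _ => 1) (fun p => rfl),
        partIntegral_abs J heven k (f := fun _ => 1) (fun p => rfl)] at this
    have h2 : G x ≤ G y := partIntegral_one_mono hJ hsymm hw heven k hxy
    have h3 : (F x - N / Z * G x) * G x ≤ (F y - N / Z * G y) * G x := by
      have := mul_le_mul_of_nonneg_left h2 hx
      linarith
    exact le_of_mul_le_mul_right h3 (hGpos x)

/-- Dominating single-site weights have larger correlations. -/
theorem correlation_le {w w' : ι → ℝ → ℝ}
    (hw : ∀ k, SiteWeight (∑ l, J k l) (w k)) (hw' : ∀ k, SiteWeight (∑ l, J k l) (w' k))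
    (heven : ∀ k x, w k (-x) = w k x) (heven' : ∀ k x, w' k (-x) = w' k x)
    (hdom : ∀ k, SpinDominated (w k) (w' k)) (i j : ι) :
    (∫ p, p i * p j * spinDensity J w p) * ∫ p, spinDensity J w' p
      ≤ (∫ p, p i * p j * spinDensity J w' p) * ∫ p, spinDensity J w p := by
  set v : Finset ι → ι → ℝ → ℝ := fun A k => if k ∈ A then w' k else w k with hv
  have hvw : ∀ A k, SiteWeight (∑ l, J k l) (v A k) := fun A k => by
    simp only [hv]; split_ifs; exacts [hw' k, hw k]
  have hve : ∀ A k x, v A k (-x) = v A k x := fun A k x => by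
    simp only [hv]; split_ifs; exacts [heven' k x, heven k x]
  have key : ∀ A, (∫ p, p i * p j * spinDensity J w p) / ∫ p, spinDensity J w p
      ≤ (∫ p, p i * p j * spinDensity J (v A) p) / ∫ p, spinDensity J (v A) p := by
    intro A
    induction A using Finset.induction_on with
    | empty => simp [hv]
    | insert k A hk ih =>
      refine ih.trans ?_
      rw [div_le_div_iff₀ (integral_spinDensity_pos hJ hsymm (hvw A))
        (integral_spinDensity_pos hJ hsymm (hvw _))]
      refine correlation_le_of_spinDominated hJ hsymm (hvw A) (hvw _) (hve A) (k := k)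
        (fun l hl => ?_) ?_ i j
      · simp [hv, hl]
      · simpa [hv, hk] using hdom k
  have h := key Finset.univ
  have huniv : v Finset.univ = w' := by ext k x; simp [hv]
  rwa [huniv, div_le_div_iff₀ (integral_spinDensity_pos hJ hsymm hw)
    (integral_spinDensity_pos hJ hsymm hw')] at h

end

/-! ### The single-site weights of a perturbed convex potential -/

lemma symmetrized_neg (ψ : ℝ → ℝ) (q p : ℝ) : symmetrized ψ q (-p) = symmetrized ψ q p := by
  simp only [symmetrized, sub_neg_eq_add, ← sub_eq_add_neg]; ring

lemma symmetrized_abs (ψ : ℝ → ℝ) (q p : ℝ) : symmetrized ψ q |p| = symmetrized ψ q p := by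
  rcases abs_choice p with h | h <;> rw [h]
  exact symmetrized_neg ψ q p

lemma symmetrized_mono_of_convexOn {ψ : ℝ → ℝ} (hψ : ConvexOn ℝ Set.univ ψ) (q : ℝ) {x y : ℝ}
    (hxy : |x| ≤ |y|) : symmetrized ψ q x ≤ symmetrized ψ q y := by
  rw [← symmetrized_abs ψ q y]
  rcases (abs_nonneg y).eq_or_lt with h | h
  · have hx : x = 0 := abs_nonpos_iff.1 (hxy.trans h.ge)
    rw [← h, hx]
  · set r := |y|
    obtain ⟨h1, h2⟩ := abs_le.1 hxy
    set t := (r + x) / (2 * r)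
    have ht : 0 ≤ t := div_nonneg (by linarith) (by linarith)
    have hs : 0 ≤ 1 - t := by
      rw [sub_nonneg, div_le_one (by linarith)]; linarith
    have ht2 : 2 * r * t = r + x := mul_div_cancel₀ _ (by positivity)
    have c1 := hψ.2 (Set.mem_univ (q + r)) (Set.mem_univ (q - r)) ht hs (by ring)
    have c2 := hψ.2 (Set.mem_univ (q + r)) (Set.mem_univ (q - r)) hs ht (by ring)
    simp only [smul_eq_mul] at c1 c2
    have e1 : t * (q + r) + (1 - t) * (q - r) = q + x := by linear_combination ht2
    have e2 : (1 - t) * (q + r) + t * (q - r) = q - x := by linear_combination -ht2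
    rw [e1] at c1
    rw [e2] at c2
    simp only [symmetrized]
    linarith

namespace PerturbedConvex
variable {ψc ψb : ℤ → ℝ → ℝ} {B : ℝ} (h : PerturbedConvex ψc ψb B)
include h

lemma convexOn (k : ℤ) : ConvexOn ℝ Set.univ (ψc k) :=
  convexOn_univ_of_deriv2_nonneg (h.differentiable_convex k) (h.differentiable_deriv_convex k)
    fun x => h.convex k x

lemma nonneg : 0 ≤ B := (add_nonneg (abs_nonneg _) (abs_nonneg _)).trans (h.bounded 0 0)

lemma abs_sub_le (k : ℤ) (x y : ℝ) : |ψb k x - ψb k y| ≤ B * |x - y| := by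
  refine Convex.norm_image_sub_le_of_norm_deriv_le (s := Set.univ)
    (fun z _ => h.differentiable_bounded k z) (fun z _ => ?_) convex_univ (Set.mem_univ y)
    (Set.mem_univ x)
  exact (le_add_of_nonneg_left (abs_nonneg _)).trans (h.bounded k z)

lemma neg_le_symmetrized (k : ℤ) (q p : ℝ) : -(2 * B) ≤ symmetrized (ψb k) q p := by
  have h1 : ∀ z, -B ≤ ψb k z := fun z =>
    (abs_le.1 ((le_add_of_nonneg_right (abs_nonneg _)).trans (h.bounded k z))).1
  have := h1 (q + p)
  have := h1 (q - p)
  simp only [symmetrized]; linarith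

/-- The bounded part of the potential is Lipschitz, so adding `2 B |p|` makes the symmetrized
potential nondecreasing in `|p|`. -/
lemma singleSite_mono (k : ℤ) (q : ℝ) {x y : ℝ} (hxy : |x| ≤ |y|) :
    2 * B * |x| + singleSite ψc ψb k q x ≤ 2 * B * |y| + singleSite ψc ψb k q y := by
  have h1 := symmetrized_mono_of_convexOn (h.convexOn k) q hxy
  have h2 : symmetrized (ψb k) q |x| - symmetrized (ψb k) q |y| ≤ 2 * B * (|y| - |x|) := by
    have e1 := (abs_le.1 (h.abs_sub_le k (q + |x|) (q + |y|))).2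
    have e2 := (abs_le.1 (h.abs_sub_le k (q - |x|) (q - |y|))).2
    have e3 : |q + |x| - (q + |y|)| = |y| - |x| := by
      rw [abs_sub_comm, abs_of_nonneg (by linarith)]; ring
    have e4 : |q - |x| - (q - |y|)| = |y| - |x| := by
      rw [abs_of_nonneg (by linarith)]; ring
    rw [e3] at e1
    rw [e4] at e2
    simp only [symmetrized]; linarith
  rw [symmetrized_abs, symmetrized_abs] at h2
  simp only [singleSite]; linarith

lemma continuous_singleSite (k : ℤ) (q : ℝ) : Continuous (singleSite ψc ψb k q) := by
  have h1 := (h.differentiable_convex k).continuous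
  have h2 := (h.differentiable_bounded k).continuous
  unfold singleSite symmetrized
  fun_prop

end PerturbedConvex

/-- The single-site weights `exp (-ψ_{k,q}(x) - aₖ x ^ 2)`. -/
noncomputable def siteDensity (ψc ψb : ℤ → ℝ → ℝ) {Λ : Finset ℤ} (a q : Λ → ℝ) (k : Λ) (x : ℝ) :
    ℝ :=
  Real.exp (-(singleSite ψc ψb k (q k) x + a k * x ^ 2))

/-- The weights `exp (-aₖ x ^ 2 + β |x|)`. -/
noncomputable def wedgeWeight {ι : Type*} (a : ι → ℝ) (β : ℝ) (k : ι) (x : ℝ) : ℝ :=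
  Real.exp (-a k * x ^ 2 + β * |x|)

lemma siteDensity_neg (ψc ψb : ℤ → ℝ → ℝ) {Λ : Finset ℤ} (a q : Λ → ℝ) (k : Λ) (x : ℝ) :
    siteDensity ψc ψb a q k (-x) = siteDensity ψc ψb a q k x := by
  simp only [siteDensity, singleSite, symmetrized_neg, neg_sq]

lemma siteWeight_wedgeWeight {ι : Type*} [Fintype ι] {a : ι → ℝ} {J : ι → ι → ℝ} {δ : ℝ}
    (h : DominantCoupling a J δ) (β : ℝ) (k : ι) :
    SiteWeight (∑ l, J k l) (wedgeWeight a β k) := by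
  refine SiteWeight.of_le (D := 1) (t := β) h.gap_pos (h.le k) (by unfold wedgeWeight; fun_prop)
    (fun x => Real.exp_pos _) fun x => ?_
  rw [one_mul, wedgeWeight]

section
variable {ψc ψb : ℤ → ℝ → ℝ} {B : ℝ} (h : PerturbedConvex ψc ψb B) {Λ : Finset ℤ}
include h

lemma siteWeight_siteDensity {a : Λ → ℝ} {J : Λ → Λ → ℝ} {δ : ℝ} (hJ : DominantCoupling a J δ)
    (q : Λ → ℝ) (k : Λ) : SiteWeight (∑ l, J k l) (siteDensity ψc ψb a q k) := by
  have hc := h.continuous_singleSite k (q k)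
  refine SiteWeight.of_le (D := Real.exp (2 * B - symmetrized (ψc k) (q k) 0)) (t := 0) hJ.gap_pos
    (hJ.le k) (by unfold siteDensity; fun_prop) (fun x => Real.exp_pos _) fun x => ?_
  rw [siteDensity, ← Real.exp_add]
  refine Real.exp_le_exp.2 ?_
  have h1 := symmetrized_mono_of_convexOn (h.convexOn k) (q k) (x := 0) (y := x) (by simp)
  have h2 := h.neg_le_symmetrized k (q k) x
  simp only [singleSite]
  linarith

lemma spinDominated_siteDensity (a q : Λ → ℝ) (k : Λ) :
    SpinDominated (siteDensity ψc ψb a q k) (wedgeWeight a (2 * B) k) := by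
  have e : wedgeWeight a (2 * B) k
      = fun x => Real.exp (2 * B * |x| + singleSite ψc ψb k (q k) x) * siteDensity ψc ψb a q k x := by
    ext x
    rw [wedgeWeight, siteDensity, ← Real.exp_add]
    congr 1
    ring
  rw [e]
  exact SpinDominated.of_ratio (fun x => Real.exp_pos _) (fun x => (Real.exp_pos _).le)
    fun x y hxy => Real.exp_le_exp.2 (h.singleSite_mono k (q k) hxy)

end

/-! ### The ferromagnetic measure -/

/-- The couplings `|Mₖₗ|` of distinct sites of `Λ`. -/
noncomputable def coupling (M : ℤ → ℤ → ℝ) (Λ : Finset ℤ) (k l : Λ) : ℝ :=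
  if l ≠ k then |M k l| else 0

namespace AdmissibleInteraction
variable {M : ℤ → ℤ → ℝ} {δ K α : ℝ} (h : AdmissibleInteraction M δ K α)
include h

lemma dominantCoupling (hδ : 0 < δ) (Λ : Finset ℤ) :
    DominantCoupling (fun k : Λ => M k k) (coupling M Λ) δ := by
  refine ⟨hδ, fun k l => ?_, fun k l => ?_, fun k => ?_⟩
  · unfold coupling; split_ifs; exacts [abs_nonneg _, le_rfl]
  · unfold coupling
    rw [h.symm k l]
    simp only [ne_comm]
  · refine le_trans (add_le_add_left ?_ δ) (h.diagonally_dominant k)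
    have e : ∑ l, coupling M Λ k l = ∑ j ∈ Λ.subtype (fun j : ℤ => j ≠ k), |M k j| := by
      rw [Finset.sum_subtype_eq_sum_filter (f := fun j => |M k j|), Finset.sum_filter,
        ← Finset.sum_coe_sort Λ]
      refine Finset.sum_congr rfl fun l _ => ?_
      simp only [coupling, ne_eq, Subtype.ext_iff]
    rw [e]
    exact (h.summable k).sum_le_tsum _ fun j _ => abs_nonneg _

lemma coupling_le (hK : 0 ≤ K) (Λ : Finset ℤ) (k l : Λ) :
    coupling M Λ k l ≤ K / decayWeight (2 + α) (k : ℤ) l := by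
  unfold coupling
  split_ifs
  · exact h.decay k l
  · exact div_nonneg hK (decayWeight_pos _ _ _).le

lemma diag_le (hα : 0 < α) (k : ℤ) : M k k ≤ K := by
  have h1 := (le_abs_self _).trans (h.decay k k)
  have h2 : (0 : ℝ) ^ (2 + α) = 0 := Real.zero_rpow (by linarith)
  simpa [h2] using h1

end AdmissibleInteraction

lemma exp_neg_ferroHamiltonian (ψc ψb : ℤ → ℝ → ℝ) (M : ℤ → ℤ → ℝ) (Λ : Finset ℤ)
    (q p : Λ → ℝ) : Real.exp (-ferroHamiltonian ψc ψb M Λ q p)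
      = spinDensity (coupling M Λ) (siteDensity ψc ψb (fun k : Λ => M k k) q) p := by
  simp only [spinDensity, siteDensity, ← Real.exp_sum, ← Real.exp_add]
  congr 1
  have e : pairEnergy (coupling M Λ) p
      = ∑ k : Λ, ∑ l : Λ with l ≠ k, |M k l| * p k * p l := by
    refine Finset.sum_congr rfl fun k _ => ?_
    rw [Finset.sum_filter]
    refine Finset.sum_congr rfl fun l _ => ?_
    simp only [coupling]
    split_ifs <;> simp
  rw [e, ferroHamiltonian, Finset.sum_neg_distrib, Finset.sum_add_distrib]
  ring

section
variable {ψc ψb : ℤ → ℝ → ℝ} {B : ℝ} (h : PerturbedConvex ψc ψb B) {M : ℤ → ℤ → ℝ}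
  {δ K α : ℝ} (hM : AdmissibleInteraction M δ K α) (hδ : 0 < δ) (Λ : Finset ℤ) (q : Λ → ℝ)
include h hM hδ

lemma integrable_exp_neg_ferroHamiltonian :
    Integrable fun p => Real.exp (-ferroHamiltonian ψc ψb M Λ q p) := by
  have hJ := hM.dominantCoupling hδ Λ
  simp only [exp_neg_ferroHamiltonian]
  exact integrable_spinDensity hJ.nonneg hJ.symm (siteWeight_siteDensity h hJ q)

lemma isProbabilityMeasure_ferroMeasure :
    IsProbabilityMeasure (ferroMeasure ψc ψb M Λ q) :=
  isProbabilityMeasure_tilted (integrable_exp_neg_ferroHamiltonian h hM hδ Λ q)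

lemma memLp_ferroMeasure (k : Λ) : MemLp (fun p : Λ → ℝ => p k) 2 (ferroMeasure ψc ψb M Λ q) := by
  have hJ := hM.dominantCoupling hδ Λ
  rw [memLp_two_iff_integrable_sq (measurable_pi_apply k).aestronglyMeasurable, ferroMeasure,
    integrable_tilted_iff (integrable_exp_neg_ferroHamiltonian h hM hδ Λ q)]
  have := integrable_mul_spinDensity hJ.nonneg hJ.symm (siteWeight_siteDensity h hJ q)
    (f := fun p => p k * p k) (by fun_prop) fun p => abs_mul_le_prod p k k
  refine this.congr (Filter.Eventually.of_forall fun p => ?_)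
  simp only [exp_neg_ferroHamiltonian, smul_eq_mul]
  ring

omit h hM hδ in
lemma integral_ferroMeasure (f : (Λ → ℝ) → ℝ) : ∫ p, f p ∂ferroMeasure ψc ψb M Λ q
    = (∫ p, f p * spinDensity (coupling M Λ) (siteDensity ψc ψb (fun k : Λ => M k k) q) p)
      / ∫ p, spinDensity (coupling M Λ) (siteDensity ψc ψb (fun k : Λ => M k k) q) p := by
  rw [ferroMeasure, integral_tilted, ← integral_div]
  simp only [exp_neg_ferroHamiltonian, smul_eq_mul]
  congr 1
  ext p
  ring

lemma covariance_ferroMeasure (i j : Λ) :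
    covariance (fun p : Λ → ℝ => p i) (fun p : Λ → ℝ => p j) (ferroMeasure ψc ψb M Λ q)
      = (∫ p, p i * p j
          * spinDensity (coupling M Λ) (siteDensity ψc ψb (fun k : Λ => M k k) q) p)
        / ∫ p, spinDensity (coupling M Λ) (siteDensity ψc ψb (fun k : Λ => M k k) q) p := by
  have := isProbabilityMeasure_ferroMeasure h hM hδ Λ q
  rw [covariance_eq_sub (memLp_ferroMeasure h hM hδ Λ q i) (memLp_ferroMeasure h hM hδ Λ q j),
    integral_ferroMeasure Λ q fun p => p i,
    integral_mul_spinDensity_eq_zero (siteDensity_neg ψc ψb _ q), zero_div, zero_mul, sub_zero,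
    integral_ferroMeasure]
  rfl

end

/-- The covariances of the ferromagnetic measure are dominated by those of the mixture of Gaussian
measures with single-site weights `exp (-aₖ x ^ 2) cosh (b x)`. -/
lemma covariance_le_coshWeight {ψc ψb : ℤ → ℝ → ℝ} {B : ℝ} (h : PerturbedConvex ψc ψb B)
    {M : ℤ → ℤ → ℝ} {δ K α : ℝ} (hM : AdmissibleInteraction M δ K α) (hδ : 0 < δ) (hα : 0 < α)
    (Λ : Finset ℤ) (q : Λ → ℝ) (i j : Λ) :
    covariance (fun p : Λ → ℝ => p i) (fun p : Λ → ℝ => p j) (ferroMeasure ψc ψb M Λ q)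
      ≤ (∫ p, p i * p j * spinDensity (coupling M Λ)
          (coshWeight (fun k : Λ => M k k) (2 * B + 4 * K + 1)) p)
        / ∫ p, spinDensity (coupling M Λ)
          (coshWeight (fun k : Λ => M k k) (2 * B + 4 * K + 1)) p := by
  have hJ := hM.dominantCoupling hδ Λ
  set a : Λ → ℝ := fun k => M k k
  have s0 := siteWeight_siteDensity h hJ q
  have s1 := siteWeight_wedgeWeight hJ (2 * B)
  have s2 := siteWeight_coshWeight hJ (2 * B + 4 * K + 1)
  have e1 : ∀ k x, wedgeWeight a (2 * B) k (-x) = wedgeWeight a (2 * B) k x := by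
    intro k x; simp [wedgeWeight]
  have e2 : ∀ k x, coshWeight a (2 * B + 4 * K + 1) k (-x)
      = coshWeight a (2 * B + 4 * K + 1) k x := by
    intro k x; simp [coshWeight]
  rw [covariance_ferroMeasure h hM hδ]
  have z0 := integral_spinDensity_pos hJ.nonneg hJ.symm s0
  have z1 := integral_spinDensity_pos hJ.nonneg hJ.symm s1
  have z2 := integral_spinDensity_pos hJ.nonneg hJ.symm s2
  have c1 := correlation_le hJ.nonneg hJ.symm s0 s1 (siteDensity_neg ψc ψb a q) e1
    (spinDominated_siteDensity h a q) i j
  have c2 := correlation_le hJ.nonneg hJ.symm s1 s2 e1 e2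
    (fun k => spinDominated_cosh (hJ.diag_pos k) (hM.diag_le hα k)
      (mul_nonneg zero_le_two h.nonneg)) i j
  rw [← div_le_div_iff₀ z0 z1] at c1
  rw [← div_le_div_iff₀ z1 z2] at c2
  exact c1.trans c2

end SpinSystem

theorem mainTheorem3 (δ B K α : ℝ) (hδ : 0 < δ) (hα : 0 < α) :
    ∃ αHat : ℝ, 0 < αHat ∧ ∃ C : ℝ, 0 ≤ C ∧
      ∀ (ψc ψb : ℤ → ℝ → ℝ) (M : ℤ → ℤ → ℝ),
        SpinSystem.PerturbedConvex ψc ψb B →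
        SpinSystem.AdmissibleInteraction M δ K α →
        ∀ (Λ : Finset ℤ) (q : Λ → ℝ),
          IsProbabilityMeasure (SpinSystem.ferroMeasure ψc ψb M Λ q) ∧
          (∀ k : Λ, MemLp (fun p : Λ → ℝ => p k) 2 (SpinSystem.ferroMeasure ψc ψb M Λ q)) ∧
          ∀ i j : Λ,
            covariance (fun p : Λ → ℝ => p i) (fun p : Λ → ℝ => p j)
                (SpinSystem.ferroMeasure ψc ψb M Λ q)
              ≤ C / (|((i : ℤ) : ℝ) - ((j : ℤ) : ℝ)| ^ (2 + αHat) + 1) := by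
  refine ⟨α, hα, ?_⟩
  rcases le_or_gt K 0 with hK | hK
  · -- there is no admissible interaction: the diagonal entries are at most `K` and positive
    refine ⟨0, le_rfl, fun ψc ψb M h hM => ?_⟩
    have h1 := hM.diag_le hα 0
    have h2 := hM.diagonally_dominant 0
    have h3 : 0 ≤ ∑' j : {j : ℤ // j ≠ 0}, |M 0 j| := tsum_nonneg fun j => abs_nonneg _
    linarith
  · obtain ⟨C, hC, hdecay⟩ := SpinSystem.exists_coshWeight_decay (2 * B + 4 * K + 1) hδ hK
      (by linarith : 2 < 2 + α)
    refine ⟨C, hC, fun ψc ψb M h hM Λ q =>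
      ⟨SpinSystem.isProbabilityMeasure_ferroMeasure h hM hδ Λ q,
        SpinSystem.memLp_ferroMeasure h hM hδ Λ q, fun i j => ?_⟩⟩
    have hJ := hM.dominantCoupling hδ Λ
    refine (SpinSystem.covariance_le_coshWeight h hM hδ hα Λ q i j).trans ?_
    rw [div_le_iff₀ (SpinSystem.integral_spinDensity_pos hJ.nonneg hJ.symm
      (SpinSystem.siteWeight_coshWeight hJ _))]
    exact hdecay Subtype.val Subtype.val_injective _ _ hJ (fun k => hM.diag_le hα k)
      (hM.coupling_le hK.le Λ) i j
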